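/- Let $H\in(0,1)$, $K\in(0,1]$, $\theta>0$, $\mu\in\mathbb R$, and put $\alpha=\theta\mu$. Let $G=(G_t)_{t\ge 0}$ be a bifractional Brownian motion $B^{H,K}$ with (almost surely) continuous paths, that is, a centered Gaussian process with $$E(G_sG_t)=\frac1{2^K}\Big(\big(t^{2H}+s^{2H}\big)^K-|t-s|^{2HK}\Big),\qquad s,t\ge 0,$$ and let $X$ be the pathwise continuous solution of $X_0=0$, $dX_t=\theta(\mu+X_t)\,dt+dG_t$, $t\ge 0$. For $T\geq 0$ define the least squares-type estimators $$\widetilde\theta_T=\frac{\frac12TX_T^2-X_T\int_0^TX_sds}{T\int_0^TX_s^2ds-\big(\int_0^TX_sds\big)^2},\quad \widetilde\alpha_T=\frac{X_T\int_0^TX_s^2ds-\frac12X_T^2\int_0^TX_sds}{T\int_0^TX_s^2ds-\big(\int_0^TX_sds\big)^2},\quad \widetilde\mu_T=\frac{\int_0^TX_s^2ds-\frac12X_T\int_0^TX_sds}{\frac12TX_T-\int_0^TX_sds}$$ (with the convention $x/0=0$; the denominators are almost surely non-zero for all large $T$). Then, almost surely as $T\to\infty$, $$(\widetilde\theta_T,\widetilde\mu_T)\to(\theta,\mu),\qquad(\widetilde\theta_T,\widetilde\alpha_T)\to(\theta,\alpha).$$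 Moreover, let $\sigma>0$ be given by $$\sigma^2=\lim_{T\to\infty}E\Big[\Big(e^{-\theta T}\int_0^Te^{\theta s}\,dG_s\Big)^2\Big]=\frac{2^{1-K}HK\,\Gamma(2HK)}{\theta^{2HK}}$$ (the limit exists and has this value; the inner integral is a Young integral, $\int_0^T e^{\theta s}dG_s=e^{\theta T}G_T-\theta\int_0^Te^{\theta s}G_s\,ds$), and let $\zeta_\infty=\theta\int_0^\infty e^{-\theta s}G_s\,ds$, which almost surely converges absolutely, is square integrable, and has law $\mathcal N(0,E(\zeta_\infty^2))$. If $N_1\sim\mathcal N(0,1)$, $N_2\sim\mathcal N(0,1)$ and $G$ are independent, then $\zeta_\infty,N_1,N_2$ are independent and, as $T\to\infty$, $$\big(e^{\theta T}(\widetilde\theta_T-\theta),\,T^{1-HK}(\widetilde\mu_T-\mu)\big)\xrightarrow{\text{Law}}\Big(\frac{2\theta\sigma N_2}{\mu+\zeta_\infty},\,\frac{1}{\theta}N_1\Big),$$ $$\big(e^{\theta T}(\widetilde\theta_T-\theta),\,T^{1-HK}(\widetilde\alpha_T-\alpha)\big)\xrightarrow{\text{Law}}\Big(\frac{2\theta\sigma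 N_2}{\mu+\zeta_\infty},\,N_1\Big).$$ -/

import Mathlib

open MeasureTheory ProbabilityTheory Filter Topology
open scoped NNReal

noncomputable section

namespace BifractionalVasicek

variable {Ω : Type*} [MeasurableSpace Ω]

/-- A (one-parameter, real) bifractional Brownian motion with parameters `H`, `K` under `P`: a
centered Gaussian process indexed by `[0, ∞)` with covariance
`2^{-K} ((t^{2H} + s^{2H})^K - |t - s|^{2HK})`. -/
structure IsBifractionalBrownianMotion (H K : ℝ) (G : ℝ≥0 → Ω → ℝ) (P : Measure Ω) : Prop where
  measurable : ∀ t, Measurable (G t)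
  gaussian : IsGaussianProcess G P
  centered : ∀ t, ∫ ω, G t ω ∂P = 0
  covariance_eq : ∀ s t : ℝ≥0, ∫ ω, G s ω * G t ω ∂P =
    1 / 2 ^ K * (((t : ℝ) ^ (2 * H) + (s : ℝ) ^ (2 * H)) ^ K - |(t : ℝ) - (s : ℝ)| ^ (2 * H * K))

/-- `x` is a continuous solution on `[0, ∞)` of `x 0 = 0`, `dx = θ (μ + x) dt + dg`, where `g` is
the driving path (`g 0 = 0`). -/
def IsVasicekPath (θ μ : ℝ) (g x : ℝ≥0 → ℝ) : Prop :=
  Continuous x ∧ x 0 = 0 ∧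
    ∀ t : ℝ≥0, x t = (∫ s in (0 : ℝ)..t, θ * (μ + x s.toNNReal)) + g t

/-- `∫_0^T x_s ds`. -/
def integralPath (x : ℝ≥0 → ℝ) (T : ℝ≥0) : ℝ := ∫ s in (0 : ℝ)..T, x s.toNNReal

/-- `∫_0^T x_s² ds`. -/
def integralSqPath (x : ℝ≥0 → ℝ) (T : ℝ≥0) : ℝ := ∫ s in (0 : ℝ)..T, x s.toNNReal ^ 2

/-- The least squares-type estimator of `θ` from the observed path `x` on `[0, T]`. -/
def thetaEst (x : ℝ≥0 → ℝ) (T : ℝ≥0) : ℝ :=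
  (1 / 2 * T * x T ^ 2 - x T * integralPath x T) /
    (T * integralSqPath x T - integralPath x T ^ 2)

/-- The least squares-type estimator of `α = θ μ` from the observed path `x` on `[0, T]`. -/
def alphaEst (x : ℝ≥0 → ℝ) (T : ℝ≥0) : ℝ :=
  (x T * integralSqPath x T - 1 / 2 * x T ^ 2 * integralPath x T) /
    (T * integralSqPath x T - integralPath x T ^ 2)

/-- The least squares-type estimator of `μ` from the observed path `x` on `[0, T]` (the quotient
of the estimators of `α` and `θ`, with the common factors cancelled). -/
def muEst (x : ℝ≥0 → ℝ) (T : ℝ≥0) : ℝ :=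
  (integralSqPath x T - 1 / 2 * x T * integralPath x T) /
    (1 / 2 * T * x T - integralPath x T)

/-- `ζ_∞ = θ ∫_0^∞ e^{-θ s} g_s ds`. -/
def zetaInf (θ : ℝ) (g : ℝ≥0 → ℝ) : ℝ :=
  θ * ∫ s in Set.Ioi (0 : ℝ), Real.exp (-θ * s) * g s.toNNReal

/-- The Young integral `e^{-θ T} ∫_0^T e^{θ s} dg_s` of a smooth integrand against a continuous
path with `g 0 = 0`, given by integration by parts. -/
def noiseConvolution (θ : ℝ) (g : ℝ≥0 → ℝ) (T : ℝ≥0) : ℝ :=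
  Real.exp (-θ * T) *
    (Real.exp (θ * T) * g T - ∫ s in (0 : ℝ)..T, θ * Real.exp (θ * s) * g s.toNNReal)

/-- The limiting standard deviation `σ`, with `σ² = 2^{1-K} H K Γ(2HK) / θ^{2HK}`. -/
def sigma (H K θ : ℝ) : ℝ :=
  √(2 ^ (1 - K) * (H * K * Real.Gamma (2 * H * K)) / θ ^ (2 * H * K))

end BifractionalVasicek

end

/-! Write I = ∫X, S = ∫X² over [0, T]. The equation gives X_T = θI + αT + G_T and, after integration
by parts, X_T²/2 = θS + αI + E_T, where E_T (`energy`) plays the role of ∫X dG. The estimators of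
(θ, α) solve the same linear system with G_T and E_T dropped, so Cramer's rule gives their errors
exactly: (T E_T - G_T I)/(TS - I²) and (G_T S - E_T I)/(TS - I²) (`thetaEst_sub`, `alphaEst_sub`).

Pathwise part. Gaussian moments and dyadic chaining give G_t/t → 0 almost surely. Variation of
constants gives X_t = G_t - μ + e^{θt}D_t with D_t → μ + ζ_∞, so e^{-θT}X_T, e^{-θT}I and e^{-2θT}S
converge. Moreover e^{-θT}E_T = D_T A_T + o(1), where A_T = e^{-θT}∫e^{θs}dG_s
(`tendsto_energy_sub_drift_mul_noise`). The limit μ + ζ_∞ is almost surely non-zero because ζ_∞ is a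
nondegenerate Gaussian variable. Thus e^{θT} times the error in θ behaves like 2θA_T/(μ + ζ_∞), and
T^{1-HK} times the error in α behaves like T^{-HK}G_T. Consistency follows from A_T = o(T) and G_T =
o(T); the estimator of μ is the quotient of the other two.

Probabilistic part. A_T, T^{-HK}G_T and ζ_∞ lie in the Gaussian Hilbert space of G, so only
covariances matter. Up to e^{-θT}G_T, A_T is the mean of G_T - G_{T-u} over an exponential variable
u (`noise_eq_add_integral`), which reduces everything to differences of the covariance function.
Smooth second differences vanish at infinity because 2HK < 2; the stationary part that remains
yields σ², and all cross covariances tend to 0. Subtracting the regression on ζ_∞ makes the pair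
exactly independent of ζ_∞, and Slutsky's lemma restores what was removed
(`tendstoInDistribution_of_asymptotically_uncorrelated`). -/

namespace BifractionalVasicek

/-! ### Asymptotics of scaled Taylor remainders -/

/-- A function vanishing to first order at `0`, evaluated at `1 / T`, beats `T ^ a` for `a < 1`. -/
theorem tendsto_rpow_mul_comp_inv_of_differentiableAt {φ : ℝ → ℝ} {a : ℝ}
    (hφ : DifferentiableAt ℝ φ 0) (h0 : φ 0 = 0) (ha : a < 1) :
    Tendsto (fun T : ℝ => T ^ a * φ T⁻¹) atTop (𝓝 0) := by
  have h1 : φ =O[𝓝 0] fun x => x := by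
    simpa [h0] using hφ.hasDerivAt.isBigO_sub
  have h2 : (fun T : ℝ => φ T⁻¹) =O[atTop] fun T => T⁻¹ :=
    h1.comp_tendsto tendsto_inv_atTop_zero
  have h3 : (fun T : ℝ => T ^ a * φ T⁻¹) =O[atTop] fun T => T ^ a * T⁻¹ :=
    (Asymptotics.isBigO_refl _ _).mul h2
  refine h3.trans_tendsto ?_
  have h4 : Tendsto (fun T : ℝ => T ^ (-(1 - a))) atTop (𝓝 0) :=
    tendsto_rpow_neg_atTop (by linarith)
  refine h4.congr' ?_
  filter_upwards [eventually_gt_atTop 0] with T hT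
  rw [← Real.rpow_neg_one T, ← Real.rpow_add hT]
  congr 1; ring

/-- A function vanishing to second order at `0`, evaluated at `1 / T`, beats `T ^ a` for
`a < 2`. -/
theorem tendsto_rpow_mul_comp_inv_of_contDiffAt {φ : ℝ → ℝ} {a : ℝ}
    (hφ : ContDiffAt ℝ 2 φ 0) (h0 : φ 0 = 0) (h1 : HasDerivAt φ 0 0) (ha : a < 2) :
    Tendsto (fun T : ℝ => T ^ a * φ T⁻¹) atTop (𝓝 0) := by
  have hf0 : fderiv ℝ φ 0 = 0 := by
    have := h1.hasFDerivAt.fderiv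
    rw [this]; ext; simp
  have hd : ContDiffAt ℝ 1 (fderiv ℝ φ) 0 := hφ.fderiv_right (by norm_num)
  have hO : (fderiv ℝ φ) =O[𝓝 0] fun x => x := by
    simpa [hf0] using (hd.differentiableAt (by norm_num)).hasFDerivAt.isBigO_sub
  obtain ⟨C, hC⟩ := hO.bound
  have hev : ∀ᶠ x in 𝓝 (0 : ℝ), DifferentiableAt ℝ φ x :=
    (hφ.eventually (by simp)).mono fun x hx => hx.differentiableAt (by norm_num)
  obtain ⟨r, hr, hball⟩ := Metric.eventually_nhds_iff_ball.1 (hC.and hev)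
  -- The derivative is O(|x|), so the mean value inequality on the ball of radius |x| gains a second
  -- factor |x|.
  have hφO : φ =O[𝓝 0] fun x => x ^ 2 := by
    refine Asymptotics.IsBigO.of_bound |C| ?_
    filter_upwards [Metric.ball_mem_nhds 0 hr] with x hx
    have hsub : ∀ y ∈ Metric.closedBall (0 : ℝ) |x|, y ∈ Metric.ball (0 : ℝ) r := fun y hy => by
      simp only [Metric.mem_closedBall, dist_zero_right, Real.norm_eq_abs, Metric.mem_ball] at *
      linarith
    have := (convex_closedBall (0 : ℝ) |x|).norm_image_sub_le_of_norm_fderiv_le (𝕜 := ℝ) (f := φ)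
      (C := |C| * |x|) (x := 0) (y := x) (fun y hy => (hball y (hsub y hy)).2)
      (fun y hy => ((hball y (hsub y hy)).1.trans (by
        gcongr
        · exact le_abs_self C
        · simpa using hy))) (by simp) (by simp)
    simpa [h0, sq, mul_assoc] using this
  have h3 : (fun T : ℝ => T ^ a * φ T⁻¹) =O[atTop] fun T => T ^ a * T⁻¹ ^ 2 :=
    (Asymptotics.isBigO_refl _ _).mul (hφO.comp_tendsto tendsto_inv_atTop_zero)
  refine h3.trans_tendsto ?_
  have h4 : Tendsto (fun T : ℝ => T ^ (-(2 - a))) atTop (𝓝 0) :=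
    tendsto_rpow_neg_atTop (by linarith)
  refine h4.congr' ?_
  filter_upwards [eventually_gt_atTop 0] with T hT
  rw [← Real.rpow_neg_one T, ← Real.rpow_natCast, ← Real.rpow_mul hT.le, ← Real.rpow_add hT]
  congr 1; push_cast; ring

/-! ### The covariance function -/

/-- The covariance function of bifractional Brownian motion, with real arguments. -/
noncomputable def bifCov (H K s t : ℝ) : ℝ :=
  1 / 2 ^ K * ((t ^ (2 * H) + s ^ (2 * H)) ^ K - |t - s| ^ (2 * H * K))

section

variable {H K : ℝ} (hH : H ∈ Set.Ioo (0 : ℝ) 1) (hK : K ∈ Set.Ioc (0 : ℝ) 1)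

include hH hK

theorem two_mul_mul_pos : 0 < 2 * H * K := mul_pos (mul_pos two_pos hH.1) hK.1

theorem two_mul_mul_lt_two : 2 * H * K < 2 := by nlinarith [hH.1, hH.2, hK.1, hK.2]

theorem mul_lt_one_of_mem : H * K < 1 := by linarith [two_mul_mul_lt_two hH hK]

theorem bifCov_self {t : ℝ} (ht : 0 ≤ t) : bifCov H K t t = t ^ (2 * H * K) := by
  have h2 : (2 : ℝ) ^ K ≠ 0 := (Real.rpow_pos_of_pos two_pos K).ne'
  rw [bifCov, ← two_mul, Real.mul_rpow two_pos.le (by positivity), ← Real.rpow_mul ht]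
  simp [Real.zero_rpow (two_mul_mul_pos hH hK).ne', h2]

/-- Midpoint concavity of x ↦ x^K at t^{2H}, s^{2H} makes all terms other than 2^{1-K}|t - s|^{2HK}
sum to something nonpositive. This quasi-helix bound replaces stationarity of increments. -/
theorem bifCov_increment_le {s t : ℝ} (hs : 0 ≤ s) (ht : 0 ≤ t) :
    bifCov H K t t + bifCov H K s s - 2 * bifCov H K s t ≤ 2 * |t - s| ^ (2 * H * K) := by
  have h2 : (1 : ℝ) ≤ 2 ^ K := Real.one_le_rpow one_le_two hK.1.le
  have hc := (Real.concaveOn_rpow hK.1.le hK.2).2 (Set.mem_Ici.2 (Real.rpow_nonneg ht (2 * H)))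
    (Set.mem_Ici.2 (Real.rpow_nonneg hs (2 * H))) (by norm_num : (0 : ℝ) ≤ 1 / 2)
    (by norm_num : (0 : ℝ) ≤ 1 / 2) (by norm_num)
  simp only [smul_eq_mul] at hc
  rw [← mul_add, ← mul_add, Real.mul_rpow (by norm_num) (by positivity), Real.div_rpow zero_le_one two_pos.le,
    Real.one_rpow, ← Real.rpow_mul ht, ← Real.rpow_mul hs] at hc
  rw [bifCov_self hH hK ht, bifCov_self hH hK hs, bifCov]
  have h3 : 1 / 2 ^ K * |t - s| ^ (2 * H * K) ≤ |t - s| ^ (2 * H * K) := by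
    apply mul_le_of_le_one_left (by positivity)
    rw [div_le_one (by positivity)]; exact h2
  linarith

/-- For a ≤ b, (b - a)^{2H} ≤ b^{2H} < b^{2H} + a^{2H}; raise to the power K. Positivity is what
shows that ζ_∞ is nondegenerate. -/
theorem bifCov_pos {s t : ℝ} (hs : 0 < s) (ht : 0 < t) : 0 < bifCov H K s t := by
  have key : ∀ {a b : ℝ}, 0 < a → a ≤ b → |b - a| ^ (2 * H * K) < (b ^ (2 * H) + a ^ (2 * H)) ^ K := by
    intro a b ha hab
    have hb := ha.trans_le hab
    rw [Real.rpow_mul (abs_nonneg _), abs_of_nonneg (sub_nonneg.2 hab)]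
    apply Real.rpow_lt_rpow (Real.rpow_nonneg (sub_nonneg.2 hab) _) _ hK.1
    have h1 : (b - a) ^ (2 * H) ≤ b ^ (2 * H) :=
      Real.rpow_le_rpow (sub_nonneg.2 hab) (by linarith) (by linarith [hH.1])
    have := Real.rpow_pos_of_pos ha (2 * H)
    linarith
  have h2 : (0 : ℝ) < 1 / 2 ^ K := by positivity
  apply mul_pos h2
  rw [sub_pos]
  rcases le_total s t with h | h
  · exact key hs h
  · rw [abs_sub_comm, add_comm]; exact key ht h

omit hH hK in
theorem add_rpow_rpow_homogeneous {T a b : ℝ} (hT : 0 ≤ T) (ha : 0 ≤ a) (hb : 0 ≤ b) :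
    ((T * a) ^ (2 * H) + (T * b) ^ (2 * H)) ^ K =
      T ^ (2 * H * K) * (a ^ (2 * H) + b ^ (2 * H)) ^ K := by
  rw [Real.mul_rpow hT ha, Real.mul_rpow hT hb, ← mul_add, Real.mul_rpow (by positivity)
    (by positivity), ← Real.rpow_mul hT]

omit hH hK in
theorem contDiffAt_one_sub_mul_rpow (a p : ℝ) : ContDiffAt ℝ 2 (fun x : ℝ => (1 - a * x) ^ p) 0 :=
  ContDiffAt.rpow_const_of_ne (by fun_prop) (by simp)

omit hH hK in
theorem hasDerivAt_one_sub_mul_rpow (a p : ℝ) :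
    HasDerivAt (fun x : ℝ => (1 - a * x) ^ p) (-a * p) 0 := by
  have h : HasDerivAt (fun x : ℝ => 1 - a * x) (-a) 0 := by
    simpa using ((hasDerivAt_id (0 : ℝ)).const_mul a).const_sub 1
  simpa using h.rpow_const (p := p) (Or.inl (by simp))

omit hH hK in
theorem contDiffAt_add_rpow_rpow (a b : ℝ) : ContDiffAt ℝ 2
    (fun x : ℝ => ((1 - a * x) ^ (2 * H) + (1 - b * x) ^ (2 * H)) ^ K) 0 :=
  ((contDiffAt_one_sub_mul_rpow a _).add (contDiffAt_one_sub_mul_rpow b _)).rpow_const_of_ne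
    (by norm_num)

omit hH hK in
theorem hasDerivAt_add_rpow_rpow (a b : ℝ) : HasDerivAt
    (fun x : ℝ => ((1 - a * x) ^ (2 * H) + (1 - b * x) ^ (2 * H)) ^ K)
    (-(a + b) * (2 * H * K * 2 ^ (K - 1))) 0 := by
  have h := ((hasDerivAt_one_sub_mul_rpow a (2 * H)).add
    (hasDerivAt_one_sub_mul_rpow b (2 * H))).rpow_const (p := K) (Or.inl (by norm_num))
  refine h.congr_deriv ?_
  simp only [Pi.add_apply, mul_zero, sub_zero, Real.one_rpow, one_add_one_eq_two]
  ring

/-- This is the limiting covariance of the increments over [T - u, T] and [T - v, T]. By homogeneity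
the terms (·+·)^K contribute T^{2HK}φ(1/T); the first-order coefficient of each is proportional to
the sum of its two shifts, so it cancels in the mixed difference. As 2HK < 2, only the powers of
time differences survive. -/
theorem tendsto_bifCov_second_difference {u v : ℝ} (hu : 0 ≤ u) (hv : 0 ≤ v) :
    Tendsto (fun T : ℝ => bifCov H K T T - bifCov H K (T - u) T - bifCov H K T (T - v) +
      bifCov H K (T - u) (T - v)) atTop
      (𝓝 (1 / 2 ^ K * (u ^ (2 * H * K) + v ^ (2 * H * K) - |u - v| ^ (2 * H * K)))) := by
  let q : ℝ → ℝ → ℝ → ℝ := fun a b x => ((1 - a * x) ^ (2 * H) + (1 - b * x) ^ (2 * H)) ^ K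
  let φ : ℝ → ℝ := fun x => q 0 0 x - q u 0 x - q 0 v x + q u v x
  have hφ : ContDiffAt ℝ 2 φ 0 :=
    (((contDiffAt_add_rpow_rpow 0 0).sub (contDiffAt_add_rpow_rpow u 0)).sub
      (contDiffAt_add_rpow_rpow 0 v)).add (contDiffAt_add_rpow_rpow u v)
  have hd : HasDerivAt φ 0 0 := by
    have := (((hasDerivAt_add_rpow_rpow (H := H) (K := K) 0 0).sub
      (hasDerivAt_add_rpow_rpow (H := H) (K := K) u 0)).sub
      (hasDerivAt_add_rpow_rpow (H := H) (K := K) 0 v)).add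
      (hasDerivAt_add_rpow_rpow (H := H) (K := K) u v)
    exact this.congr_deriv (by ring)
  have h0 : φ 0 = 0 := by simp [φ, q]
  have hlim := ((tendsto_rpow_mul_comp_inv_of_contDiffAt hφ h0 hd
    (two_mul_mul_lt_two hH hK)).add_const (u ^ (2 * H * K) + v ^ (2 * H * K) -
      |u - v| ^ (2 * H * K))).const_mul (1 / 2 ^ K)
  rw [zero_add] at hlim
  refine hlim.congr' ?_
  filter_upwards [eventually_gt_atTop 0, eventually_ge_atTop u, eventually_ge_atTop v]
    with T hT hTu hTv
  have hq : ∀ a b : ℝ, a ≤ T → b ≤ T →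
      T ^ (2 * H * K) * q a b T⁻¹ = ((T - a) ^ (2 * H) + (T - b) ^ (2 * H)) ^ K := by
    intro a b ha hb
    have e : ∀ c, T - c = T * (1 - c * T⁻¹) := fun c => by field_simp
    have p : ∀ c ≤ T, 0 ≤ 1 - c * T⁻¹ := fun c hc => by
      rw [← div_eq_mul_inv, sub_nonneg, div_le_one hT]; exact hc
    rw [e a, e b, add_rpow_rpow_homogeneous hT.le (p a ha) (p b hb)]
  simp only [φ, mul_add, mul_sub, hq 0 0 hT.le hT.le, hq u 0 hTu hT.le, hq 0 v hT.le hTv,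
    hq u v hTu hTv, bifCov, sub_self, abs_zero, Real.zero_rpow (two_mul_mul_pos hH hK).ne',
    sub_zero, sub_sub_cancel, abs_of_nonneg hu]
  have e1 : |T - v - T| = v := by rw [sub_sub_cancel_left, abs_neg, abs_of_nonneg hv]
  have e2 : |T - v - (T - u)| = |u - v| := by congr 1; ring
  rw [e1, e2, add_comm ((T - u) ^ (2 * H)) (T ^ (2 * H)),
    add_comm ((T - u) ^ (2 * H)) ((T - v) ^ (2 * H)), add_comm (T ^ (2 * H)) ((T - v) ^ (2 * H))]
  ring

omit hH in
-- Bernoulli's inequality for an exponent at most 1, after factoring out y.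
theorem add_rpow_sub_rpow_le {y a : ℝ} (hy : 0 < y) (ha : 0 ≤ a) :
    (y + a) ^ K - y ^ K ≤ K * a * y ^ (K - 1) := by
  have h := rpow_one_add_le_one_add_mul_self (s := a / y)
    (by linarith [div_nonneg ha hy.le]) hK.1.le hK.2
  have e : y + a = y * (1 + a / y) := by field_simp
  rw [e, Real.mul_rpow hy.le (by positivity), Real.rpow_sub_one hy.ne']
  have hyK := Real.rpow_pos_of_pos hy K
  calc y ^ K * (1 + a / y) ^ K - y ^ K ≤ y ^ K * (1 + K * (a / y)) - y ^ K := by gcongr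
    _ = K * a * (y ^ K / y) := by field_simp; ring

/-- The excess `(T^{2H} + s^{2H})^K - T^{2HK}` has a limit as `T → ∞`. -/
theorem exists_tendsto_add_rpow_sub_rpow {s : ℝ} (hs : 0 ≤ s) :
    ∃ c, Tendsto (fun T : ℝ => (T ^ (2 * H) + s ^ (2 * H)) ^ K - T ^ (2 * H * K)) atTop (𝓝 c) := by
  -- For K = 1 the excess is constantly s^{2H}; for K < 1 it is O(T^{2H(K-1)}) and vanishes.
  rcases hK.2.eq_or_lt with rfl | hK1
  · exact ⟨s ^ (2 * H), by simp⟩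
  refine ⟨0, ?_⟩
  have hlim : Tendsto (fun T : ℝ => K * s ^ (2 * H) * (T ^ (2 * H)) ^ (K - 1)) atTop (𝓝 0) := by
    have h1 : Tendsto (fun T : ℝ => (T ^ (2 * H)) ^ (-(1 - K))) atTop (𝓝 0) :=
      (tendsto_rpow_neg_atTop (by linarith)).comp (tendsto_rpow_atTop (by linarith [hH.1]))
    simpa using h1.const_mul (K * s ^ (2 * H))
  refine tendsto_of_tendsto_of_tendsto_of_le_of_le' tendsto_const_nhds hlim ?_ ?_
  · filter_upwards [eventually_gt_atTop 0] with T hT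
    rw [Real.rpow_mul hT.le (2 * H), sub_nonneg]
    exact Real.rpow_le_rpow (by positivity) (le_add_of_nonneg_right (Real.rpow_nonneg hs _)) hK.1.le
  · filter_upwards [eventually_gt_atTop 0] with T hT
    rw [Real.rpow_mul hT.le (2 * H)]
    exact add_rpow_sub_rpow_le hK (Real.rpow_pos_of_pos hT _) (Real.rpow_nonneg hs _)

omit hH hK in
theorem mul_one_sub_rpow {T a p : ℝ} (hT : 0 < T) (ha : a ≤ T) :
    T ^ p * (1 - a * T⁻¹) ^ p = (T - a) ^ p := by
  rw [← Real.mul_rpow hT.le]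
  · congr 1; field_simp
  · rw [← div_eq_mul_inv, sub_nonneg, div_le_one hT]; exact ha

/-- Late increments decorrelate from a fixed time s. The excesses at T and T - u share a limit and
cancel; what is left is a second difference of x ↦ x^{2HK}, which vanishes because 2HK < 2. -/
theorem tendsto_bifCov_sub_shift {u s : ℝ} (hs : 0 ≤ s) :
    Tendsto (fun T : ℝ => bifCov H K T s - bifCov H K (T - u) s) atTop (𝓝 0) := by
  let p := 2 * H * K
  let φ : ℝ → ℝ := fun x => (1 - 0 * x) ^ p - (1 - s * x) ^ p - (1 - u * x) ^ p
    + (1 - (u + s) * x) ^ p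
  have hφ : ContDiffAt ℝ 2 φ 0 :=
    (((contDiffAt_one_sub_mul_rpow 0 _).sub (contDiffAt_one_sub_mul_rpow s _)).sub
      (contDiffAt_one_sub_mul_rpow u _)).add (contDiffAt_one_sub_mul_rpow (u + s) _)
  have hd : HasDerivAt φ 0 0 := by
    have := (((hasDerivAt_one_sub_mul_rpow 0 p).sub (hasDerivAt_one_sub_mul_rpow s p)).sub
      (hasDerivAt_one_sub_mul_rpow u p)).add (hasDerivAt_one_sub_mul_rpow (u + s) p)
    exact this.congr_deriv (by ring)
  have h0 : φ 0 = 0 := by simp [φ]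
  obtain ⟨c, hc⟩ := exists_tendsto_add_rpow_sub_rpow hH hK hs
  have hc' := hc.comp (tendsto_atTop_add_const_right atTop (-u) tendsto_id)
  have hlim := (((tendsto_rpow_mul_comp_inv_of_contDiffAt hφ h0 hd
    (two_mul_mul_lt_two hH hK)).add (hc.sub hc'))).const_mul (1 / 2 ^ K)
  rw [sub_self, add_zero, mul_zero] at hlim
  refine hlim.congr' ?_
  filter_upwards [eventually_gt_atTop 0, eventually_ge_atTop u, eventually_ge_atTop s,
    eventually_ge_atTop (u + s)] with T hT hTu hTs hTus
  simp only [φ, mul_add, mul_sub, p, Function.comp, id]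
  rw [mul_one_sub_rpow hT hT.le, mul_one_sub_rpow hT hTs, mul_one_sub_rpow hT hTu,
    mul_one_sub_rpow hT hTus, bifCov, bifCov, abs_sub_comm, abs_sub_comm s (T - u),
    abs_of_nonneg (sub_nonneg.2 hTs), abs_of_nonneg (by linarith : 0 ≤ T - u - s),
    add_comm (s ^ (2 * H)) (T ^ (2 * H)), add_comm (s ^ (2 * H)) ((T - u) ^ (2 * H)),
    ← sub_sub T u s, sub_zero, ← sub_eq_add_neg]
  ring

/-- T^{HK} is the standard deviation of G_T. The excess is bounded, and T^{2HK} - (T - s)^{2HK} =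
O(T^{2HK-1}), which is o(T^{HK}) because HK < 1. -/
theorem tendsto_bifCov_div_rpow {s : ℝ} (hs : 0 ≤ s) :
    Tendsto (fun T : ℝ => bifCov H K T s / T ^ (H * K)) atTop (𝓝 0) := by
  have hh : 0 < H * K := mul_pos hH.1 hK.1
  let φ : ℝ → ℝ := fun x => (1 - 0 * x) ^ (2 * H * K) - (1 - s * x) ^ (2 * H * K)
  have hφ : DifferentiableAt ℝ φ 0 :=
    ((hasDerivAt_one_sub_mul_rpow 0 _).sub (hasDerivAt_one_sub_mul_rpow s _)).differentiableAt
  have h0 : φ 0 = 0 := by simp [φ]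
  obtain ⟨c, hc⟩ := exists_tendsto_add_rpow_sub_rpow hH hK hs
  have hc' := hc.div_atTop (tendsto_rpow_atTop hh)
  have hlim := ((tendsto_rpow_mul_comp_inv_of_differentiableAt hφ h0
    (mul_lt_one_of_mem hH hK)).add hc').const_mul (1 / 2 ^ K)
  rw [add_zero, mul_zero] at hlim
  refine hlim.congr' ?_
  filter_upwards [eventually_gt_atTop 0, eventually_ge_atTop s] with T hT hTs
  have hT' := Real.rpow_pos_of_pos hT (H * K)
  have e : T ^ (H * K) * φ T⁻¹ = (T ^ (2 * H * K) - (T - s) ^ (2 * H * K)) / T ^ (H * K) := by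
    rw [eq_div_iff hT'.ne', mul_right_comm, ← Real.rpow_add hT,
      show H * K + H * K = 2 * H * K by ring]
    simp only [φ, mul_sub]
    rw [mul_one_sub_rpow hT hT.le, mul_one_sub_rpow hT hTs, sub_zero]
  rw [e, bifCov, abs_sub_comm, abs_of_nonneg (sub_nonneg.2 hTs), add_comm (s ^ (2 * H))]
  ring

/-- The normalized G_T decorrelates from its own recent increments: the smooth first difference is
O(T^{2HK-1}), and u^{2HK} is constant. -/
theorem tendsto_bifCov_self_sub_div_rpow {u : ℝ} (hu : 0 ≤ u) :
    Tendsto (fun T : ℝ => (bifCov H K T T - bifCov H K (T - u) T) / T ^ (H * K)) atTop (𝓝 0) := by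
  have hh : 0 < H * K := mul_pos hH.1 hK.1
  let q : ℝ → ℝ → ℝ → ℝ := fun a b x => ((1 - a * x) ^ (2 * H) + (1 - b * x) ^ (2 * H)) ^ K
  let φ : ℝ → ℝ := fun x => q 0 0 x - q 0 u x
  have hφ : DifferentiableAt ℝ φ 0 :=
    ((hasDerivAt_add_rpow_rpow 0 0).sub (hasDerivAt_add_rpow_rpow 0 u)).differentiableAt
  have h0 : φ 0 = 0 := by simp [φ, q]
  have hc : Tendsto (fun T : ℝ => u ^ (2 * H * K) / T ^ (H * K)) atTop (𝓝 0) :=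
    tendsto_const_nhds.div_atTop (tendsto_rpow_atTop hh)
  have hlim := ((tendsto_rpow_mul_comp_inv_of_differentiableAt hφ h0
    (mul_lt_one_of_mem hH hK)).add hc).const_mul (1 / 2 ^ K)
  rw [add_zero, mul_zero] at hlim
  refine hlim.congr' ?_
  filter_upwards [eventually_gt_atTop 0, eventually_ge_atTop u] with T hT hTu
  have hT' := Real.rpow_pos_of_pos hT (H * K)
  have hq : ∀ a b : ℝ, a ≤ T → b ≤ T →
      T ^ (2 * H * K) * q a b T⁻¹ = ((T - a) ^ (2 * H) + (T - b) ^ (2 * H)) ^ K := by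
    intro a b ha hb
    have e : ∀ c, T - c = T * (1 - c * T⁻¹) := fun c => by field_simp
    have p : ∀ c ≤ T, 0 ≤ 1 - c * T⁻¹ := fun c hc => by
      rw [← div_eq_mul_inv, sub_nonneg, div_le_one hT]; exact hc
    rw [e a, e b, add_rpow_rpow_homogeneous hT.le (p a ha) (p b hb)]
  have e : T ^ (H * K) * φ T⁻¹ =
      ((T ^ (2 * H) + T ^ (2 * H)) ^ K - (T ^ (2 * H) + (T - u) ^ (2 * H)) ^ K) / T ^ (H * K) := by
    rw [eq_div_iff hT'.ne', mul_right_comm, ← Real.rpow_add hT,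
      show H * K + H * K = 2 * H * K by ring]
    simp only [φ, mul_sub]
    rw [hq 0 0 hT.le hT.le, hq 0 u hT.le hTu, sub_zero]
  rw [e, bifCov, bifCov, sub_self, abs_zero, Real.zero_rpow (two_mul_mul_pos hH hK).ne',
    sub_sub_cancel, abs_of_nonneg hu]
  ring

end

end BifractionalVasicek

namespace BifractionalVasicek

/-! ### The exponential law -/

/-- The exponential law with rate `θ`. -/
noncomputable def expLaw (θ : ℝ) : Measure ℝ :=
  (volume.restrict (Set.Ioi 0)).withDensity fun x => ENNReal.ofReal (θ * Real.exp (-θ * x))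

section

variable {θ : ℝ} (hθ : 0 < θ)

theorem integrable_expLaw_iff (hθ : 0 < θ) {f : ℝ → ℝ} : Integrable f (expLaw θ) ↔
    IntegrableOn (fun x => θ * Real.exp (-θ * x) * f x) (Set.Ioi 0) := by
  rw [expLaw, integrable_withDensity_iff_integrable_smul' (by fun_prop) (by simp)]
  simp only [smul_eq_mul, IntegrableOn]
  refine integrable_congr (Eventually.of_forall fun x => ?_)
  simp only
  rw [ENNReal.toReal_ofReal (by positivity)]

theorem integral_expLaw (hθ : 0 < θ) (f : ℝ → ℝ) :
    ∫ x, f x ∂(expLaw θ) = ∫ x in Set.Ioi 0, θ * Real.exp (-θ * x) * f x := by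
  rw [expLaw, integral_withDensity_eq_integral_toReal_smul (by fun_prop) (by simp)]
  refine integral_congr_ae (Eventually.of_forall fun x => ?_)
  simp only [smul_eq_mul]
  rw [ENNReal.toReal_ofReal (by positivity)]

theorem ae_expLaw_pos : ∀ᵐ x ∂(expLaw θ), 0 < x :=
  (withDensity_absolutelyContinuous _ _).ae_le (ae_restrict_mem measurableSet_Ioi)

include hθ

theorem isProbabilityMeasure_expLaw : IsProbabilityMeasure (expLaw θ) := by
  constructor
  rw [expLaw, withDensity_apply _ MeasurableSet.univ, Measure.restrict_univ,
    ← ofReal_integral_eq_lintegral_ofReal]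
  · rw [integral_const_mul, integral_exp_mul_Ioi (by linarith)]
    simp [hθ.ne']
  · exact (integrableOn_exp_mul_Ioi (by linarith) 0).const_mul θ
  · exact Eventually.of_forall fun x => by positivity

theorem integrable_rpow_expLaw {p : ℝ} (hp : 0 ≤ p) : Integrable (fun x => x ^ p) (expLaw θ) := by
  rw [integrable_expLaw_iff hθ]
  have h := (integrableOn_rpow_mul_exp_neg_mul_rpow (s := p) (by linarith) one_pos hθ).const_mul θ
  refine h.congr (Eventually.of_forall fun x => ?_)
  simp only [Real.rpow_one]; ring

theorem integral_rpow_expLaw {p : ℝ} (hp : 0 ≤ p) :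
    ∫ x, x ^ p ∂(expLaw θ) = Real.Gamma (p + 1) / θ ^ p := by
  rw [integral_expLaw hθ]
  have h := Real.integral_rpow_mul_exp_neg_mul_Ioi (a := p + 1) (by linarith) hθ
  simp only [add_sub_cancel_right] at h
  have e : ∀ x : ℝ, θ * Real.exp (-θ * x) * x ^ p = θ * (x ^ p * Real.exp (-(θ * x))) := fun x => by
    rw [neg_mul]; ring
  simp_rw [e]
  rw [integral_const_mul, h, one_div, Real.inv_rpow hθ.le, Real.rpow_add_one hθ.ne']
  field_simp

/-- Memorylessness: the substitution v = w + u pulls out the factor e^{-θu}. -/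
theorem integral_posPart_sub_rpow_expLaw {p u : ℝ} (hp : 0 ≤ p) (hu : 0 ≤ u) :
    ∫ v, (Set.Ioi u).indicator (fun v => (v - u) ^ p) v ∂(expLaw θ) =
      Real.exp (-θ * u) * (Real.Gamma (p + 1) / θ ^ p) := by
  rw [← integral_rpow_expLaw hθ hp, integral_expLaw hθ, integral_expLaw hθ, ← integral_const_mul]
  have e : ∀ v, θ * Real.exp (-θ * v) * (Set.Ioi u).indicator (fun v => (v - u) ^ p) v =
      (Set.Ioi u).indicator (fun v => θ * Real.exp (-θ * v) * (v - u) ^ p) v := fun v => by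
    by_cases hv : v ∈ Set.Ioi u <;> simp [hv]
  simp_rw [e]
  rw [setIntegral_indicator measurableSet_Ioi, Set.inter_eq_right.2 (Set.Ioi_subset_Ioi hu)]
  have := integral_add_right_eq_self
    ((Set.Ioi u).indicator fun v => θ * Real.exp (-θ * v) * (v - u) ^ p) (μ := volume) u
  rw [← integral_indicator measurableSet_Ioi, ← this, ← integral_indicator measurableSet_Ioi]
  congr 1 with w
  by_cases hw : 0 < w
  · have : u < w + u := by linarith
    simp only [Set.indicator, Set.mem_Ioi, hw, this, if_true, add_sub_cancel_right]
    rw [mul_add, Real.exp_add]; ring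
  · have : ¬ u < w + u := by linarith
    simp [Set.indicator, hw, this]

theorem integrable_posPart_sub_rpow_expLaw {p : ℝ} (hp : 0 ≤ p) :
    Integrable (fun z : ℝ × ℝ => (Set.Ioi z.1).indicator (fun v => (v - z.1) ^ p) z.2)
      ((expLaw θ).prod (expLaw θ)) := by
  have := isProbabilityMeasure_expLaw hθ
  refine ((integrable_rpow_expLaw hθ hp).comp_snd (expLaw θ)).mono' ?_ ?_
  · have : (fun z : ℝ × ℝ => (Set.Ioi z.1).indicator (fun v => (v - z.1) ^ p) z.2) =
        {z : ℝ × ℝ | z.1 < z.2}.indicator fun z => (z.2 - z.1) ^ p := by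
      ext z; simp [Set.indicator]
    rw [this]
    exact ((by fun_prop : Measurable fun z : ℝ × ℝ => (z.2 - z.1) ^ p).indicator
      (measurableSet_lt measurable_fst measurable_snd)).aestronglyMeasurable
  · filter_upwards [Measure.quasiMeasurePreserving_fst.ae (ae_expLaw_pos (θ := θ)),
      Measure.quasiMeasurePreserving_snd.ae (ae_expLaw_pos (θ := θ))] with z hz1 hz2
    by_cases h : z.1 < z.2
    · simp only [Set.indicator, Set.mem_Ioi, h, if_true, Real.norm_eq_abs]
      rw [abs_of_nonneg (Real.rpow_nonneg (by linarith) _)]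
      exact Real.rpow_le_rpow (by linarith) (by linarith) hp
    · simp only [Set.indicator, Set.mem_Ioi, h, if_false, norm_zero]
      exact Real.rpow_nonneg hz2.le _

/-- The distance of two independent exponential variables is again exponential. Each of the regions
u < v and v < u contributes half the moment, since e^{-θu} has mean 1/2. -/
theorem integral_integral_abs_sub_rpow_expLaw {p : ℝ} (hp : 0 < p) :
    ∫ u, ∫ v, |u - v| ^ p ∂(expLaw θ) ∂(expLaw θ) = Real.Gamma (p + 1) / θ ^ p := by
  have := isProbabilityMeasure_expLaw hθ
  let F : ℝ → ℝ → ℝ := fun u v => (Set.Ioi u).indicator (fun v => (v - u) ^ p) v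
  have hF : Integrable (Function.uncurry F) ((expLaw θ).prod (expLaw θ)) :=
    integrable_posPart_sub_rpow_expLaw hθ hp.le
  have hF' : Integrable (fun z : ℝ × ℝ => F z.2 z.1) ((expLaw θ).prod (expLaw θ)) := hF.swap
  have e : ∀ u v : ℝ, |u - v| ^ p = F u v + F v u := by
    intro u v
    rcases lt_trichotomy u v with h | h | h
    · simp [F, Set.indicator, h, h.not_gt, abs_sub_comm u v, abs_of_pos (sub_pos.2 h)]
    · simp [F, h, Real.zero_rpow hp.ne']
    · simp [F, Set.indicator, h, h.not_gt, abs_of_pos (sub_pos.2 h)]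
  have h1 : ∫ u, ∫ v, F u v ∂(expLaw θ) ∂(expLaw θ) = Real.Gamma (p + 1) / θ ^ p / 2 := by
    have : ∀ᵐ u ∂(expLaw θ), ∫ v, F u v ∂(expLaw θ) =
        Real.exp (-θ * u) * (Real.Gamma (p + 1) / θ ^ p) := by
      filter_upwards [ae_expLaw_pos (θ := θ)] with u hu
      exact integral_posPart_sub_rpow_expLaw hθ hp.le hu.le
    rw [integral_congr_ae this, integral_mul_const, integral_expLaw hθ]
    have e2 : ∀ x : ℝ, θ * Real.exp (-θ * x) * Real.exp (-θ * x) =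
        θ * Real.exp (-(2 * θ) * x) := fun x => by
      rw [mul_assoc, ← Real.exp_add]; ring_nf
    simp_rw [e2]
    rw [integral_const_mul, integral_exp_mul_Ioi (by linarith)]
    simp
    field_simp
  have h2 : ∫ u, ∫ v, F v u ∂(expLaw θ) ∂(expLaw θ) = Real.Gamma (p + 1) / θ ^ p / 2 := by
    rw [← h1, integral_integral_swap hF]
  simp_rw [e]
  have h3 : ∫ u, ∫ v, F u v + F v u ∂(expLaw θ) ∂(expLaw θ) =
      ∫ u, (∫ v, F u v ∂(expLaw θ)) + (∫ v, F v u ∂(expLaw θ)) ∂(expLaw θ) := by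
    refine integral_congr_ae ?_
    filter_upwards [hF.prod_right_ae, hF'.prod_right_ae] with u hu1 hu2
    exact integral_add hu1 hu2
  have h4 := integral_add hF.integral_prod_left hF'.integral_prod_left
  simp only [Function.uncurry_apply_pair] at h4
  rw [h3, h4, h1, h2]
  ring

theorem integrable_abs_sub_rpow_expLaw {p u : ℝ} (hp : 0 < p) (hu : 0 ≤ u) :
    Integrable (fun v => |u - v| ^ p) (expLaw θ) := by
  have := isProbabilityMeasure_expLaw hθ
  refine ((integrable_const (u ^ p)).add (integrable_rpow_expLaw hθ hp.le)).mono'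
    (by fun_prop : Measurable fun v : ℝ => |u - v| ^ p).aestronglyMeasurable ?_
  filter_upwards [ae_expLaw_pos (θ := θ)] with v hv
  rw [Real.norm_of_nonneg (by positivity)]
  have hu' := Real.rpow_nonneg hu p
  have hv' := Real.rpow_nonneg hv.le p
  rcases le_total u v with h | h
  · rw [abs_sub_comm, abs_of_nonneg (by linarith)]
    have := Real.rpow_le_rpow (by linarith) (by linarith : v - u ≤ v) hp.le
    simp only [Pi.add_apply]; linarith
  · rw [abs_of_nonneg (by linarith)]
    have := Real.rpow_le_rpow (by linarith) (by linarith : u - v ≤ u) hp.le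
    simp only [Pi.add_apply]; linarith

/-- The limiting variance as a double integral of the increment covariance of fractional noise. -/
theorem integral_integral_eq_sigma_sq {H K : ℝ} (hH : H ∈ Set.Ioo (0 : ℝ) 1)
    (hK : K ∈ Set.Ioc (0 : ℝ) 1) :
    ∫ u, ∫ v, 1 / 2 ^ K * (u ^ (2 * H * K) + v ^ (2 * H * K) - |u - v| ^ (2 * H * K))
      ∂(expLaw θ) ∂(expLaw θ) = sigma H K θ ^ 2 := by
  have := isProbabilityMeasure_expLaw hθ
  have hp := two_mul_mul_pos hH hK
  set p := 2 * H * K with hpdef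
  set M := Real.Gamma (p + 1) / θ ^ p
  have h1 : ∀ᵐ u ∂(expLaw θ), ∫ v, 1 / 2 ^ K * (u ^ p + v ^ p - |u - v| ^ p) ∂(expLaw θ) =
      1 / 2 ^ K * (u ^ p + M - ∫ v, |u - v| ^ p ∂(expLaw θ)) := by
    filter_upwards [ae_expLaw_pos (θ := θ)] with u hu
    have hI : Integrable (fun v => u ^ p + v ^ p) (expLaw θ) :=
      (integrable_const _).add (integrable_rpow_expLaw hθ hp.le)
    rw [integral_const_mul, integral_sub hI
      (integrable_abs_sub_rpow_expLaw hθ hp hu.le), integral_add (integrable_const _)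
      (integrable_rpow_expLaw hθ hp.le), integral_rpow_expLaw hθ hp.le]
    simp [M]
  have hint : Integrable (fun u => ∫ v, |u - v| ^ p ∂(expLaw θ)) (expLaw θ) := by
    have hF := integrable_posPart_sub_rpow_expLaw hθ hp.le
    have h := (hF.add hF.swap).integral_prod_left
    refine h.congr (Eventually.of_forall fun u => integral_congr_ae
      (Eventually.of_forall fun v => ?_))
    rcases lt_trichotomy u v with h | h | h
    · simp [Set.indicator, h, h.not_gt, abs_sub_comm u v, abs_of_pos (sub_pos.2 h)]
    · simp [h, Real.zero_rpow hp.ne']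
    · simp [Set.indicator, h, h.not_gt, abs_of_pos (sub_pos.2 h)]
  have hI : Integrable (fun u => u ^ p + M) (expLaw θ) :=
    (integrable_rpow_expLaw hθ hp.le).add (integrable_const _)
  -- The three terms contribute M + M - M, so the value is 2^{-K}M with M = 2HKΓ(2HK)/θ^{2HK}.
  rw [integral_congr_ae h1, integral_const_mul, integral_sub hI hint, integral_add (integrable_rpow_expLaw hθ hp.le) (integrable_const _),
    integral_rpow_expLaw hθ hp.le, integral_integral_abs_sub_rpow_expLaw hθ hp, sigma,
    Real.sq_sqrt, ← hpdef]
  · simp only [integral_const, probReal_univ, one_smul, M, add_sub_cancel_right]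
    rw [Real.Gamma_add_one hp.ne', Real.rpow_sub two_pos, Real.rpow_one, hpdef]
    ring
  · have := Real.Gamma_pos_of_pos hp
    have := hH.1
    have := hK.1
    positivity

end

end BifractionalVasicek

namespace BifractionalVasicek

/-! ### The Gaussian Hilbert space of a Gaussian process -/

section Hull

variable {Ω ι : Type*} [mΩ : MeasurableSpace Ω] {P : Measure Ω} {G : ι → Ω → ℝ} {Y Z : Ω → ℝ}

/-- `Y` belongs to the closed linear span in `L²(P)` of the variables `G t`, expressed as
orthogonality to everything that is orthogonal to all the `G t`. -/
def InHull (G : ι → Ω → ℝ) (P : Measure Ω) (Y : Ω → ℝ) : Prop :=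
  MemLp Y 2 P ∧ ∀ W : Ω → ℝ, MemLp W 2 P → (∀ t, ∫ ω, G t ω * W ω ∂P = 0) →
    ∫ ω, Y ω * W ω ∂P = 0

theorem InHull.of_mem (hG : ∀ t, MemLp (G t) 2 P) (t : ι) : InHull G P (G t) :=
  ⟨hG t, fun _ _ h => h t⟩

theorem InHull.congr (hY : InHull G P Y) (h : Y =ᵐ[P] Z) : InHull G P Z :=
  ⟨hY.1.ae_eq h, fun W hW h0 => by
    rw [← hY.2 W hW h0]
    exact integral_congr_ae (h.mono fun ω hω => by simp only [hω])⟩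

theorem InHull.add (hY : InHull G P Y) (hZ : InHull G P Z) :
    InHull G P (fun ω => Y ω + Z ω) :=
  ⟨hY.1.add hZ.1, fun W hW h0 => by
    have h := integral_add (hY.1.integrable_mul hW) (hZ.1.integrable_mul hW)
    simp only [Pi.mul_apply, hY.2 W hW h0, hZ.2 W hW h0, add_zero] at h
    simpa only [add_mul] using h⟩

theorem InHull.const_mul (hY : InHull G P Y) (c : ℝ) : InHull G P (fun ω => c * Y ω) :=
  ⟨hY.1.const_mul c, fun W hW h0 => by
    simp only [mul_assoc]
    rw [integral_const_mul, hY.2 W hW h0, mul_zero]⟩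

theorem InHull.sub (hY : InHull G P Y) (hZ : InHull G P Z) :
    InHull G P (fun ω => Y ω - Z ω) :=
  (hY.add (hZ.const_mul (-1))).congr (Eventually.of_forall fun ω => by ring)

/-- In a Hilbert space the double orthogonal complement is the closed span. -/
theorem InHull.toLp_mem_topologicalClosure (hG : ∀ t, MemLp (G t) 2 P) (hY : InHull G P Y) :
    hY.1.toLp Y ∈ (Submodule.span ℝ (Set.range fun t => (hG t).toLp (G t))).topologicalClosure := by
  rw [← Submodule.orthogonal_orthogonal_eq_closure, Submodule.mem_orthogonal]
  intro W hW
  rw [Submodule.mem_orthogonal] at hW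
  have key : ∀ {Z : Ω → ℝ} (hZ : MemLp Z 2 P),
      inner ℝ (hZ.toLp Z) W = ∫ ω, Z ω * W ω ∂P := by
    intro Z hZ
    rw [L2.inner_def]
    refine integral_congr_ae ?_
    filter_upwards [hZ.coeFn_toLp] with ω hω
    rw [hω]
    simp [mul_comm]
  rw [real_inner_comm, key hY.1]
  refine hY.2 W (Lp.memLp W) fun t => ?_
  rw [← key (hG t)]
  exact hW _ (Submodule.subset_span ⟨t, rfl⟩)

variable [IsProbabilityMeasure P]

theorem map_eq_gaussianReal_of_mem_span (hG : IsGaussianProcess G P)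
    (hG2 : ∀ t, MemLp (G t) 2 P) (hG0 : ∀ t, ∫ ω, G t ω ∂P = 0) {f : Lp ℝ 2 P}
    (hf : f ∈ Submodule.span ℝ (Set.range fun t => (hG2 t).toLp (G t))) :
    P.map f = gaussianReal 0 (‖f‖ ^ 2).toNNReal := by
  obtain ⟨c, rfl⟩ := (Finsupp.mem_span_range_iff_exists_finsupp).1 hf
  set f : Lp ℝ 2 P := c.sum fun t a => a • (hG2 t).toLp (G t) with hfdef
  have hae : f =ᵐ[P] fun ω => ∑ t ∈ c.support, c t * G t ω := by
    rw [hfdef, Finsupp.sum]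
    have h1 := Lp.coeFn_finsetSum (μ := P) c.support fun t => c t • (hG2 t).toLp (G t)
    have h2 : ∀ᵐ ω ∂P, ∀ t ∈ c.support, (c t • (hG2 t).toLp (G t)) ω = c t * G t ω := by
      refine (Finset.eventually_all _).2 fun t _ => ?_
      filter_upwards [Lp.coeFn_smul (c t) ((hG2 t).toLp (G t)), (hG2 t).coeFn_toLp] with ω h3 h4
      rw [h3, Pi.smul_apply, h4, smul_eq_mul]
    filter_upwards [h1, h2] with ω h3 h4
    rw [h3, Finset.sum_apply]
    exact Finset.sum_congr rfl h4
  have hgauss : HasGaussianLaw f P := by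
    let L : (c.support → ℝ) →L[ℝ] ℝ :=
      ∑ t : c.support, c t • ContinuousLinearMap.proj (R := ℝ) (φ := fun _ => ℝ) t
    refine ((hG.hasGaussianLaw c.support).map L).congr (EventuallyEq.trans ?_ hae.symm)
    refine Eventually.of_forall fun ω => ?_
    simp only [L, Function.comp, _root_.sum_apply, _root_.smul_apply,
      ContinuousLinearMap.proj_apply, Finset.restrict, smul_eq_mul]
    exact Finset.sum_coe_sort c.support fun t => c t * G t ω
  have h0 : ∫ ω, f ω ∂P = 0 := by
    rw [integral_congr_ae hae, integral_finsetSum _ fun t _ =>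
      ((hG2 t).integrable one_le_two).const_mul _]
    simp [integral_const_mul, hG0]
  have hvar : Var[f; P] = ‖f‖ ^ 2 := by
    rw [variance_of_integral_eq_zero (Lp.aestronglyMeasurable f).aemeasurable h0,
      ← real_inner_self_eq_norm_sq, L2.inner_def]
    simp [sq]
  rw [hgauss.map_eq_gaussianReal, h0, hvar]

/-- An L² limit is a limit in distribution, and the characteristic functions of the approximating
centered Gaussians converge because their variances, the squared norms, do. -/
theorem map_eq_gaussianReal_of_mem_topologicalClosure (hG : IsGaussianProcess G P)
    (hG2 : ∀ t, MemLp (G t) 2 P) (hG0 : ∀ t, ∫ ω, G t ω ∂P = 0) {f : Lp ℝ 2 P}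
    (hf : f ∈ (Submodule.span ℝ (Set.range fun t => (hG2 t).toLp (G t))).topologicalClosure) :
    P.map f = gaussianReal 0 (‖f‖ ^ 2).toNNReal := by
  rw [← SetLike.mem_coe, Submodule.topologicalClosure_coe, mem_closure_iff_seq_limit] at hf
  obtain ⟨y, hy, hlim⟩ := hf
  have hdist := (tendstoInMeasure_of_tendsto_Lp hlim).tendstoInDistribution
    fun n => (Lp.aestronglyMeasurable (y n)).aemeasurable
  have hch := ProbabilityMeasure.tendsto_iff_tendsto_charFun.1 hdist.tendsto
  have : IsProbabilityMeasure (P.map f) :=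
    Measure.isProbabilityMeasure_map (Lp.aestronglyMeasurable f).aemeasurable
  refine Measure.ext_of_charFun (funext fun t => ?_)
  refine tendsto_nhds_unique (hch t) ?_
  have hnorm := ((Complex.continuous_ofReal.tendsto _).comp ((hlim.norm.pow 2)))
  have h2 : Tendsto (fun n => charFun (gaussianReal 0 (‖y n‖ ^ 2).toNNReal) t) atTop
      (𝓝 (charFun (gaussianReal 0 (‖f‖ ^ 2).toNNReal) t)) := by
    simp only [charFun_gaussianReal, Real.coe_toNNReal _ (sq_nonneg _)]
    have := (((hnorm.mul_const ((t : ℂ) ^ 2)).div_const 2).const_sub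
      ((t : ℂ) * ((0 : ℝ) : ℂ) * Complex.I)).cexp
    simpa using this
  refine h2.congr fun n => ?_
  rw [← map_eq_gaussianReal_of_mem_span hG hG2 hG0 (hy n)]
  rfl

theorem InHull.map_eq_gaussianReal (hG : IsGaussianProcess G P)
    (hG0 : ∀ t, ∫ ω, G t ω ∂P = 0) (hY : InHull G P Y) :
    P.map Y = gaussianReal 0 (∫ ω, Y ω ^ 2 ∂P).toNNReal := by
  have hG2 : ∀ t, MemLp (G t) 2 P := fun t => (hG.hasGaussianLaw_eval t).memLp_two
  have h := map_eq_gaussianReal_of_mem_topologicalClosure hG hG2 hG0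
    (hY.toLp_mem_topologicalClosure hG2)
  rw [Measure.map_congr hY.1.coeFn_toLp] at h
  rw [h, ← real_inner_self_eq_norm_sq, L2.inner_def]
  congr 2
  refine integral_congr_ae ?_
  filter_upwards [hY.1.coeFn_toLp] with ω hω
  rw [hω]; simp [sq]

/-- The constant 1 is orthogonal to every centered G t, hence to the hull. -/
theorem InHull.integral_eq_zero (hG0 : ∀ t, ∫ ω, G t ω ∂P = 0) (hY : InHull G P Y) : ∫ ω, Y ω ∂P = 0 := by
  have := hY.2 (fun _ => 1) (memLp_const 1) fun t => by simpa using hG0 t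
  simpa using this

/-- Random vectors all of whose linear functionals lie in the Gaussian Hilbert space are
Gaussian. -/
theorem hasGaussianLaw_of_forall_inHull {E : Type*} [NormedAddCommGroup E] [NormedSpace ℝ E]
    [MeasurableSpace E] [BorelSpace E] (hG : IsGaussianProcess G P)
    (hG0 : ∀ t, ∫ ω, G t ω ∂P = 0) {U : Ω → E} (hU : AEMeasurable U P)
    (h : ∀ L : E →L[ℝ] ℝ, InHull G P (fun ω => L (U ω))) : HasGaussianLaw U P := by
  constructor
  refine isGaussian_of_map_eq_gaussianReal fun L => ⟨0, (∫ ω, L (U ω) ^ 2 ∂P).toNNReal, ?_⟩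
  rw [AEMeasurable.map_map_of_aemeasurable (by fun_prop) hU]
  exact (h L).map_eq_gaussianReal hG hG0

end Hull

/-! ### Measurability and independence of elements of the hull -/

section HullMeasurable

variable {Ω ι : Type*} {m mΩ : MeasurableSpace Ω} {P : Measure Ω} {G : ι → Ω → ℝ} {Y : Ω → ℝ}

/-- The classes measurable with respect to the smaller σ-algebra form a closed subspace of L²
containing the generators. -/
theorem InHull.aestronglyMeasurable (hm : m ≤ mΩ) (hG2 : ∀ t, MemLp (G t) 2 P)
    (hGm : ∀ t, Measurable[m] (G t)) (hY : InHull G P Y) : AEStronglyMeasurable[m] Y P := by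
  have hsub : (Submodule.span ℝ (Set.range fun t => (hG2 t).toLp (G t))).topologicalClosure ≤
      lpMeas ℝ ℝ m 2 P := by
    refine Submodule.topologicalClosure_minimal _ (Submodule.span_le.2 ?_)
      (isClosed_aestronglyMeasurable hm)
    rintro _ ⟨t, rfl⟩
    refine mem_lpMeas_iff_aestronglyMeasurable.2 ?_
    exact (hGm t).stronglyMeasurable.aestronglyMeasurable.congr (hG2 t).coeFn_toLp.symm
  exact (mem_lpMeas_iff_aestronglyMeasurable.1
    (hsub (hY.toLp_mem_topologicalClosure hG2))).congr hY.1.coeFn_toLp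

/-- Elements of the Gaussian Hilbert space are independent of whatever is independent of the
process. -/
theorem InHull.indepFun {β : Type*} [MeasurableSpace β] {W : Ω → β}
    (hGm : ∀ t, Measurable (G t)) (hG2 : ∀ t, MemLp (G t) 2 P) (hY : InHull G P Y)
    (h : IndepFun W (fun ω t => G t ω) P) : IndepFun W Y P := by
  obtain ⟨Y', hY', hae⟩ := hY.aestronglyMeasurable (measurable_pi_lambda _ hGm).comap_le hG2
    fun t => (measurable_pi_apply t).comp (comap_measurable fun ω t => G t ω)
  obtain ⟨φ, hφ, rfl⟩ := hY'.measurable.exists_eq_measurable_comp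
  exact (h.comp measurable_id hφ).congr EventuallyEq.rfl hae.symm

end HullMeasurable

/-! ### Averages of square integrable processes -/

section Average

variable {Ω : Type*} [MeasurableSpace Ω] {P : Measure Ω} [IsProbabilityMeasure P] {ν : Measure ℝ}
  [IsProbabilityMeasure ν] {y : ℝ → Ω → ℝ}

omit [IsProbabilityMeasure ν] in
theorem memLp_two_prod_of_integrable (hy : Measurable (Function.uncurry y))
    (h2 : ∀ᵐ s ∂ν, MemLp (y s) 2 P) (hint : Integrable (fun s => ∫ ω, y s ω ^ 2 ∂P) ν) :
    MemLp (Function.uncurry y) 2 (ν.prod P) := by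
  rw [memLp_two_iff_integrable_sq hy.aestronglyMeasurable,
    integrable_prod_iff (hy.pow_const 2).aestronglyMeasurable]
  refine ⟨h2.mono fun s hs => hs.integrable_sq, ?_⟩
  simpa using hint

/-- Jensen's inequality for the square, under the probability measure ν. -/
theorem memLp_two_integral (hy : MemLp (Function.uncurry y) 2 (ν.prod P)) :
    MemLp (fun ω => ∫ s, y s ω ∂ν) 2 P := by
  have h1 : Integrable (Function.uncurry y) (ν.prod P) := hy.integrable one_le_two
  have hm : AEStronglyMeasurable (fun ω => ∫ s, y s ω ∂ν) P :=
    h1.integral_prod_right.aestronglyMeasurable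
  have hsq : Integrable (fun z : ℝ × Ω => y z.1 z.2 ^ 2) (ν.prod P) := hy.integrable_sq
  rw [memLp_two_iff_integrable_sq hm]
  refine hsq.integral_prod_right.mono' (hm.pow 2) ?_
  filter_upwards [h1.prod_left_ae, hsq.prod_left_ae] with ω hω1 hω2
  rw [Real.norm_of_nonneg (sq_nonneg _)]
  exact (even_two.convexOn_pow (𝕜 := ℝ)).map_integral_le (continuous_pow 2).continuousOn
    isClosed_univ (by simp) hω1 hω2

theorem integral_integral_mul (hy : MemLp (Function.uncurry y) 2 (ν.prod P)) {W : Ω → ℝ}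
    (hW : MemLp W 2 P) :
    ∫ ω, (∫ s, y s ω ∂ν) * W ω ∂P = ∫ s, ∫ ω, y s ω * W ω ∂P ∂ν := by
  have hint : Integrable (fun z : ℝ × Ω => y z.1 z.2 * W z.2) (ν.prod P) :=
    hy.integrable_mul (hW.comp_snd ν)
  rw [integral_integral_swap hint]
  simp only [integral_mul_const]

end Average

end BifractionalVasicek

namespace BifractionalVasicek

/-! ### Growth of the paths by dyadic chaining -/

/-- Chaining: each dyadic point is reached from a by at most one step per level, so the geometric
series bounds the displacement; continuity extends this to all t in [0, 1]. -/
theorem abs_sub_le_of_dyadic {f : ℝ → ℝ} {a L q : ℝ} (hf : Continuous f) (hL : 0 ≤ L)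
    (hq0 : 0 ≤ q) (hq1 : q < 1)
    (h : ∀ k j : ℕ, j < 2 ^ k → |f (a + (j + 1) / 2 ^ k) - f (a + j / 2 ^ k)| ≤ L * q ^ k)
    {t : ℝ} (ht0 : 0 ≤ t) (ht1 : t ≤ 1) : |f (a + t) - f a| ≤ L / (1 - q) := by
  have hind : ∀ k j : ℕ, j ≤ 2 ^ k →
      |f (a + j / 2 ^ k) - f a| ≤ L * ∑ i ∈ Finset.range (k + 1), q ^ i := by
    intro k
    induction k with
    | zero =>
      intro j hj
      have h0 := h 0 0 (by norm_num)
      interval_cases j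
      · simpa using hL
      · simpa using h0
    | succ k ih =>
      intro j hj
      rw [Finset.sum_range_succ, mul_add]
      -- An even numerator already belongs to the coarser level; an odd one is a single fine step
      -- away from its even left neighbour.
      rcases Nat.even_or_odd' j with ⟨i, rfl | rfl⟩
      · have hi : i ≤ 2 ^ k := by rw [pow_succ] at hj; omega
        have e : ((2 * i : ℕ) : ℝ) / 2 ^ (k + 1) = i / 2 ^ k := by
          push_cast; rw [pow_succ]; field_simp
        rw [e]
        exact (ih i hi).trans (le_add_of_nonneg_right (by positivity))
      · have hi : i ≤ 2 ^ k := by rw [pow_succ] at hj; omega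
        have hi' : 2 * i < 2 ^ (k + 1) := by omega
        have e : ((2 * i : ℕ) : ℝ) / 2 ^ (k + 1) = i / 2 ^ k := by
          push_cast; rw [pow_succ]; field_simp
        have h1 := h (k + 1) (2 * i) hi'
        rw [e] at h1
        have h2 := abs_sub_le (f (a + ((2 * i + 1 : ℕ) : ℝ) / 2 ^ (k + 1))) (f (a + i / 2 ^ k)) (f a)
        have h3 := ih i hi
        push_cast at h1 h2 ⊢
        linarith
  have hlim : Tendsto (fun k : ℕ => a + (⌊t * 2 ^ k⌋₊ : ℝ) / 2 ^ k) atTop (𝓝 (a + t)) :=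
    ((tendsto_nat_floor_mul_div_atTop ht0).comp
      (tendsto_pow_atTop_atTop_of_one_lt one_lt_two)).const_add a
  refine le_of_tendsto ((((hf.tendsto _).comp hlim).sub_const (f a)).abs)
    (Eventually.of_forall fun k => ?_)
  have hj : ⌊t * 2 ^ k⌋₊ ≤ 2 ^ k := by
    have : t * 2 ^ k ≤ ((2 ^ k : ℕ) : ℝ) := by
      push_cast; exact mul_le_of_le_one_left (by positivity) ht1
    exact Nat.floor_le_of_le this
  refine (hind k _ hj).trans ?_
  rw [div_eq_mul_inv]
  gcongr
  rw [← tsum_geometric_of_lt_one hq0 hq1]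
  exact (summable_geometric_of_lt_one hq0 hq1).sum_le_tsum _ fun i _ => by positivity

/-- A crude bound, sufficient for finiteness, which avoids taking 2m-th roots. -/
theorem abs_le_max_one_of_pow_le {x M : ℝ} {m : ℕ} (hm : m ≠ 0) (h : x ^ (2 * m) ≤ M) :
    |x| ≤ max 1 M := by
  rcases le_total |x| 1 with h1 | h1
  · exact h1.trans (le_max_left _ _)
  · refine le_trans ?_ (h.trans (le_max_right _ _))
    rw [← Even.pow_abs (even_two_mul m)]
    exact le_self_pow₀ h1 (by omega)

section

variable {Ω : Type*} [MeasurableSpace Ω] {P : Measure Ω}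

/-- By scaling, C can be taken to be the 2m-th moment of the standard normal law, whatever the
variance. -/
theorem exists_lintegral_pow_le (m : ℕ) : ∃ C : ℝ, 0 ≤ C ∧ ∀ (Y : Ω → ℝ) (v : ℝ≥0),
    AEMeasurable Y P → P.map Y = gaussianReal 0 v →
    ∫⁻ ω, ENNReal.ofReal (Y ω ^ (2 * m)) ∂P ≤ ENNReal.ofReal (C * (v : ℝ) ^ m) := by
  have hI : Integrable (fun x : ℝ => x ^ (2 * m)) (gaussianReal 0 1) := by
    rcases Nat.eq_zero_or_pos m with rfl | hm
    · simp
    have := (memLp_id_gaussianReal (μ := 0) (v := 1) ((2 * m : ℕ) : ℝ≥0)).integrable_norm_pow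
      (p := 2 * m) (by omega)
    refine this.congr (Eventually.of_forall fun x => ?_)
    simp [pow_mul]
  refine ⟨∫ x, x ^ (2 * m) ∂(gaussianReal 0 1),
    integral_nonneg fun x => Even.pow_nonneg (even_two_mul m) x, fun Y v hY hmap => ?_⟩
  have hv : gaussianReal 0 v = (gaussianReal 0 1).map (fun x => √v * x) := by
    rw [gaussianReal_map_const_mul]
    congr 1
    · simp
    · ext; simp
  have h1 : ∫⁻ ω, ENNReal.ofReal (Y ω ^ (2 * m)) ∂P =
      ∫⁻ x, ENNReal.ofReal (x ^ (2 * m)) ∂(P.map Y) := by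
    rw [lintegral_map' (by fun_prop) hY]
  rw [h1, hmap, hv, lintegral_map (by fun_prop) (by fun_prop)]
  have e : ∀ x : ℝ, (√v * x) ^ (2 * m) = (v : ℝ) ^ m * x ^ (2 * m) := fun x => by
    rw [mul_pow, pow_mul, Real.sq_sqrt (NNReal.coe_nonneg v)]
  simp_rw [e]
  rw [← ofReal_integral_eq_lintegral_ofReal (hI.const_mul _)
    (Eventually.of_forall fun x => mul_nonneg (by positivity)
      (Even.pow_nonneg (even_two_mul m) x)), integral_const_mul, mul_comm]

variable {g : ℝ → Ω → ℝ} {h : ℝ}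

/-- Almost sure bound of countably many variables with summable expectations. -/
theorem ae_exists_forall_le_of_tsum_lintegral_ne_top {ι : Type*} [Countable ι] {Z : ι → Ω → ℝ}
    (hZ : ∀ i, AEMeasurable (Z i) P)
    (hsum : ∑' i, ∫⁻ ω, ENNReal.ofReal (Z i ω) ∂P ≠ ⊤) :
    ∀ᵐ ω ∂P, ∃ M : ℝ, ∀ i, Z i ω ≤ M := by
  rw [← lintegral_tsum fun i => (hZ i).ennreal_ofReal] at hsum
  filter_upwards [ae_lt_top' (AEMeasurable.tsum fun i => (hZ i).ennreal_ofReal) hsum]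
    with ω hω
  refine ⟨(∑' i, ENNReal.ofReal (Z i ω)).toReal, fun i => ?_⟩
  rw [← ENNReal.ofReal_le_iff_le_toReal hω.ne]
  exact ENNReal.le_tsum i

/-- Kolmogorov's argument made uniform over the unit intervals [n, n + 1]. High moments make the
dyadic increments, normalized by q^k (n + 1)^δ, and the values at integers, normalized by (n + 1)^δ,
have summable expectations. They are then almost surely bounded, so |g t| = O(t^δ) with δ < 1. -/
theorem ae_tendsto_div_atTop_of_moments (hh0 : 0 < h) (hh1 : h < 1)
    (hmeas : ∀ t, Measurable (g t)) (hcont : ∀ ω, Continuous fun t => g t ω)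
    (hzero : ∀ᵐ ω ∂P, g 0 ω = 0)
    (hmom : ∀ m : ℕ, ∃ C : ℝ, 0 ≤ C ∧ ∀ s t : ℝ, 0 ≤ s → 0 ≤ t →
      ∫⁻ ω, ENNReal.ofReal ((g t ω - g s ω) ^ (2 * m)) ∂P ≤
        ENNReal.ofReal (C * (|t - s| ^ h) ^ (2 * m))) :
    ∀ᵐ ω ∂P, Tendsto (fun t => g t ω / t) atTop (𝓝 0) := by
  -- m h > 1 beats the 2^k intervals of level k; m (1 - h) > 1 makes the sum over the integers n
  -- converge.
  obtain ⟨m, hm⟩ := exists_nat_gt (max (1 / h) (1 / (1 - h)))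
  have hm1 : 1 < m * h := by
    rw [← div_lt_iff₀ hh0]; exact (le_max_left _ _).trans_lt hm
  have hm2 : 1 < m * (1 - h) := by
    rw [← div_lt_iff₀ (by linarith)]; exact (le_max_right _ _).trans_lt hm
  have hm0 : m ≠ 0 := by rintro rfl; norm_num at hm1
  obtain ⟨C, hC, hmom⟩ := hmom m
  -- Both exponents leave room: h < δ < 1, and q decays more slowly than the natural scale 2^{-h}.
  set δ : ℝ := (1 + h) / 2 with hδ
  set q : ℝ := 2 ^ (-(h / 2)) with hq
  have hq0 : 0 < q := by positivity
  have hq1 : q < 1 := Real.rpow_lt_one_of_one_lt_of_neg one_lt_two (by linarith)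
  -- the normalized dyadic increments and integer values
  let Z : (ℕ × (Σ k : ℕ, Fin (2 ^ k))) → Ω → ℝ := fun i ω =>
    ((g (i.1 + (i.2.2 + 1) / 2 ^ i.2.1) ω - g (i.1 + i.2.2 / 2 ^ i.2.1) ω) /
      (q ^ i.2.1 * (i.1 + 1 : ℝ) ^ δ)) ^ (2 * m)
  let Z' : ℕ → Ω → ℝ := fun n ω => ((g n ω - g 0 ω) / (n + 1 : ℝ) ^ δ) ^ (2 * m)
  have hscale : ∀ {x y c : ℝ}, 0 ≤ x → 0 ≤ y → 0 < c →
      ∫⁻ ω, ENNReal.ofReal (((g y ω - g x ω) / c) ^ (2 * m)) ∂P ≤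
        ENNReal.ofReal (C * (|y - x| ^ h / c) ^ (2 * m)) := by
    intro x y c hx hy hc
    have e : ∀ ω, ENNReal.ofReal (((g y ω - g x ω) / c) ^ (2 * m)) =
        ENNReal.ofReal ((c ^ (2 * m))⁻¹) * ENNReal.ofReal ((g y ω - g x ω) ^ (2 * m)) := fun ω => by
      rw [← ENNReal.ofReal_mul (by positivity), div_pow, div_eq_inv_mul]
    simp_rw [e]
    rw [lintegral_const_mul' _ _ ENNReal.ofReal_ne_top]
    refine (mul_le_mul_right (hmom x y hx hy) _).trans ?_
    rw [← ENNReal.ofReal_mul (by positivity), div_pow]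
    exact ENNReal.ofReal_le_ofReal (le_of_eq (by ring))
  have hn : Summable fun n : ℕ => (((n : ℝ) + 1) ^ δ)⁻¹ ^ (2 * m) := by
    have := (summable_nat_add_iff 1).2 (Real.summable_nat_rpow_inv (p := δ * (2 * m)) |>.2 (by
      rw [hδ]; nlinarith))
    refine this.congr fun n => ?_
    push_cast
    rw [inv_pow, ← Real.rpow_natCast (((n : ℝ) + 1) ^ δ), ← Real.rpow_mul (by positivity)]
    push_cast; rfl
  have hn' : Summable fun n : ℕ => ((n : ℝ) ^ h / ((n : ℝ) + 1) ^ δ) ^ (2 * m) := by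
    have := (summable_nat_add_iff 1).2 (Real.summable_nat_rpow_inv (p := (1 - h) * m) |>.2 (by
      linarith))
    refine Summable.of_nonneg_of_le (fun n => by positivity) (fun n => ?_) this
    have h1 : (n : ℝ) ^ h / ((n : ℝ) + 1) ^ δ ≤ ((n : ℝ) + 1) ^ (h - δ) := by
      rw [Real.rpow_sub (by positivity)]
      gcongr
      linarith
    refine (pow_le_pow_left₀ (by positivity) h1 _).trans (le_of_eq ?_)
    rw [← Real.rpow_natCast, ← Real.rpow_mul (by positivity), ← Real.rpow_neg (by positivity)]
    push_cast
    congr 1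
    rw [hδ]; ring
  -- The ratio is 2 · (2^{-h/2})^{2m} = 2^{1 - mh} < 1.
  have hk : Summable fun k : ℕ => (2 : ℝ) ^ k * ((2 ^ h)⁻¹ ^ k / q ^ k) ^ (2 * m) := by
    have hr : (2 : ℝ) * (2 ^ (-(h / 2))) ^ (2 * m) < 1 := by
      rw [← Real.rpow_natCast, ← Real.rpow_mul two_pos.le, ← Real.rpow_one_add' two_pos.le]
      · apply Real.rpow_lt_one_of_one_lt_of_neg one_lt_two
        push_cast; linarith
      · push_cast; linarith
    refine (summable_geometric_of_lt_one (by positivity) hr).congr fun k => ?_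
    rw [mul_pow, ← pow_mul, mul_comm (2 * m) k, pow_mul, ← div_pow, ← pow_mul, ← pow_mul,
      ← Real.rpow_neg two_pos.le, hq, ← Real.rpow_sub two_pos]
    ring_nf
  have hZsum : ∑' i, ∫⁻ ω, ENNReal.ofReal (Z i ω) ∂P ≠ ⊤ := by
    have hb : ∀ i, ∫⁻ ω, ENNReal.ofReal (Z i ω) ∂P ≤
        ENNReal.ofReal (C * ((((i.1 : ℝ) + 1) ^ δ)⁻¹ ^ (2 * m))) *
        ENNReal.ofReal (((2 ^ h)⁻¹ ^ i.2.1 / q ^ i.2.1) ^ (2 * m)) := by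
      rintro ⟨n, k, j⟩
      refine (hscale (by positivity) (by positivity) (by positivity)).trans ?_
      rw [← ENNReal.ofReal_mul (by positivity)]
      refine ENNReal.ofReal_le_ofReal (le_of_eq ?_)
      have e1 : |(n : ℝ) + ((j : ℕ) + 1) / 2 ^ k - (n + (j : ℕ) / 2 ^ k)| = (2 ^ k)⁻¹ := by
        rw [← abs_of_pos (by positivity : (0 : ℝ) < (2 ^ k)⁻¹)]; congr 1; ring
      simp only
      rw [e1, Real.inv_rpow (by positivity), ← Real.rpow_natCast 2 k, ← Real.rpow_mul two_pos.le,
        mul_comm (k : ℝ) h, Real.rpow_mul two_pos.le, Real.rpow_natCast, inv_pow (2 ^ h : ℝ)]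
      rw [mul_assoc, ← mul_pow]
      congr 2
      field_simp
    refine ne_top_of_le_ne_top ?_ (ENNReal.tsum_le_tsum hb)
    rw [ENNReal.tsum_prod']
    simp_rw [ENNReal.tsum_mul_left, ENNReal.tsum_sigma', tsum_fintype, Finset.sum_const,
      Finset.card_univ, Fintype.card_fin]
    rw [ENNReal.tsum_mul_right]
    refine ENNReal.mul_ne_top ?_ ?_
    · exact (hn.mul_left C).tsum_ofReal_ne_top
    · refine ne_of_eq_of_ne ?_ hk.tsum_ofReal_ne_top
      congr 1 with k
      rw [nsmul_eq_mul, ENNReal.ofReal_mul (by positivity)]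
      congr 1
      rw [← ENNReal.ofReal_natCast]; push_cast; rfl
  have hZsum' : ∑' n, ∫⁻ ω, ENNReal.ofReal (Z' n ω) ∂P ≠ ⊤ := by
    refine ne_top_of_le_ne_top (hn'.mul_left C).tsum_ofReal_ne_top
      (ENNReal.tsum_le_tsum fun n => ?_)
    refine (hscale le_rfl (by positivity) (by positivity)).trans ?_
    simp
  filter_upwards [hzero, ae_exists_forall_le_of_tsum_lintegral_ne_top
    (fun i => by fun_prop) hZsum, ae_exists_forall_le_of_tsum_lintegral_ne_top
    (fun i => by fun_prop) hZsum'] with ω hω0 ⟨M, hM⟩ ⟨M', hM'⟩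
  set A := max 1 M
  set A' := max 1 M'
  have hA : 0 ≤ A := zero_le_one.trans (le_max_left _ _)
  have hA' : 0 ≤ A' := zero_le_one.trans (le_max_left _ _)
  have hinc : ∀ (n : ℕ) {t : ℝ}, 0 ≤ t → t ≤ 1 →
      |g (n + t) ω - g n ω| ≤ A * (n + 1 : ℝ) ^ δ / (1 - q) := by
    intro n t ht0 ht1
    refine abs_sub_le_of_dyadic (f := fun t => g t ω) (hcont ω) (by positivity) hq0.le hq1
      (fun k j hj => ?_) ht0 ht1
    have h1 := abs_le_max_one_of_pow_le hm0 (hM (n, ⟨k, ⟨j, hj⟩⟩))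
    simp only [abs_div] at h1
    rw [div_le_iff₀ (by positivity), abs_of_pos (by positivity : 0 < q ^ k * (n + 1 : ℝ) ^ δ)] at h1
    refine h1.trans (le_of_eq ?_)
    simp only [A]; ring
  have hint : ∀ n : ℕ, |g n ω| ≤ A' * (n + 1 : ℝ) ^ δ := by
    intro n
    have h1 := abs_le_max_one_of_pow_le hm0 (hM' n)
    rw [abs_div, div_le_iff₀ (by positivity), abs_of_pos (by positivity : 0 < (n + 1 : ℝ) ^ δ),
      hω0, sub_zero] at h1
    exact h1
  have hbound : ∀ t : ℝ, 0 < t → |g t ω / t| ≤ (A' + A / (1 - q)) * ((t + 1) ^ δ / t) := by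
    intro t ht
    have hfl := Nat.floor_le ht.le
    have hlt := Nat.lt_floor_add_one t
    have h1 := hinc ⌊t⌋₊ (t := t - ⌊t⌋₊) (by linarith) (by linarith)
    rw [add_sub_cancel] at h1
    have h2 := hint ⌊t⌋₊
    have h3 : |g t ω| ≤ (A' + A / (1 - q)) * ((⌊t⌋₊ : ℝ) + 1) ^ δ := by
      have := abs_sub_abs_le_abs_sub (g t ω) (g ⌊t⌋₊ ω)
      have e : A * ((⌊t⌋₊ : ℝ) + 1) ^ δ / (1 - q) = A / (1 - q) * ((⌊t⌋₊ : ℝ) + 1) ^ δ := by ring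
      rw [e] at h1
      linarith
    rw [abs_div, abs_of_pos ht, mul_div_assoc']
    have h4 : 0 ≤ A / (1 - q) := div_nonneg hA (by linarith)
    gcongr
    refine h3.trans ?_
    gcongr
  have hlim : Tendsto (fun t : ℝ => (A' + A / (1 - q)) * ((t + 1) ^ δ / t)) atTop (𝓝 0) := by
    have h1 : Tendsto (fun t : ℝ => (t + 1) ^ (-(1 - δ)) * ((t + 1) / t)) atTop (𝓝 (0 * 1)) := by
      refine ((tendsto_rpow_neg_atTop (by rw [hδ]; linarith)).comp
        (tendsto_atTop_add_const_right _ 1 tendsto_id)).mul ?_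
      have := (tendsto_inv_atTop_zero (𝕜 := ℝ)).const_add 1
      rw [add_zero] at this
      refine this.congr' ?_
      filter_upwards [eventually_gt_atTop 0] with t ht
      field_simp
    rw [zero_mul] at h1
    have h2 := h1.const_mul (A' + A / (1 - q))
    rw [mul_zero] at h2
    refine h2.congr' ?_
    filter_upwards [eventually_gt_atTop 0] with t ht
    have ht1 : 0 < t + 1 := by linarith
    rw [neg_sub, Real.rpow_sub ht1, Real.rpow_one]
    field_simp
  refine squeeze_zero_norm' ?_ hlim
  filter_upwards [eventually_gt_atTop 0] with t ht
  exact hbound t ht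

end

end BifractionalVasicek

namespace BifractionalVasicek

/-! ### Exponentially weighted averages -/

theorem exists_forall_abs_le_of_tendsto {f : ℝ → ℝ} {c : ℝ} (hf : Continuous f)
    (hc : Tendsto f atTop (𝓝 c)) : ∃ C, 0 ≤ C ∧ ∀ s, 0 ≤ s → |f s| ≤ C := by
  obtain ⟨A, hA⟩ := eventually_atTop.1 (hc.abs.eventually_le_const (lt_add_one |c|))
  obtain ⟨B, hB⟩ := (isCompact_Icc (a := (0 : ℝ)) (b := A)).exists_bound_of_continuousOn
    hf.continuousOn
  refine ⟨max (|c| + 1) B, le_max_of_le_left (by positivity), fun s hs => ?_⟩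
  rcases le_total s A with h | h
  · exact (hB s ⟨hs, h⟩).trans (le_max_right _ _)
  · exact (hA s h).trans (le_max_left _ _)

section

variable {θ : ℝ} (hθ : 0 < θ)
include hθ

/-- The exponentially weighted average of `f` on `[0, t]`, as an integral against the exponential
law. -/
theorem exp_mul_integral_eq_integral_expLaw (f : ℝ → ℝ) {t : ℝ} (ht : 0 ≤ t) :
    Real.exp (-θ * t) * ∫ s in (0 : ℝ)..t, θ * Real.exp (θ * s) * f s =
      ∫ u, (Set.Iic t).indicator (fun u => f (t - u)) u ∂(expLaw θ) := by
  rw [integral_expLaw hθ]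
  have e : ∀ u, θ * Real.exp (-θ * u) * (Set.Iic t).indicator (fun u => f (t - u)) u =
      (Set.Iic t).indicator (fun u => θ * Real.exp (-θ * u) * f (t - u)) u := fun u => by
    by_cases hu : u ∈ Set.Iic t <;> simp [hu]
  simp_rw [e]
  rw [setIntegral_indicator measurableSet_Iic, Set.Ioi_inter_Iic,
    ← intervalIntegral.integral_of_le ht, ← intervalIntegral.integral_const_mul]
  have h := intervalIntegral.integral_comp_sub_left
    (fun s => Real.exp (-θ * t) * (θ * Real.exp (θ * s) * f s)) (a := 0) (b := t) t
  rw [sub_self, sub_zero] at h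
  rw [← h]
  refine intervalIntegral.integral_congr fun u _ => ?_
  have : Real.exp (-θ * u) = Real.exp (-θ * t) * Real.exp (θ * (t - u)) := by
    rw [← Real.exp_add]; ring_nf
  rw [this]; ring

/-- A continuous Toeplitz lemma: the weighted average is the mean of f(t - u) over an exponential u,
and dominated convergence applies because f is bounded on [0, ∞). -/
theorem tendsto_exp_mul_integral {f : ℝ → ℝ} {c : ℝ} (hf : Continuous f)
    (hc : Tendsto f atTop (𝓝 c)) :
    Tendsto (fun t => Real.exp (-θ * t) * ∫ s in (0 : ℝ)..t, θ * Real.exp (θ * s) * f s) atTop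
      (𝓝 c) := by
  have := isProbabilityMeasure_expLaw hθ
  obtain ⟨C, hC, hb⟩ := exists_forall_abs_le_of_tendsto hf hc
  have h1 : Tendsto (fun t => ∫ u, (Set.Iic t).indicator (fun u => f (t - u)) u ∂(expLaw θ)) atTop
      (𝓝 (∫ _, c ∂(expLaw θ))) := by
    refine tendsto_integral_filter_of_dominated_convergence (fun _ => C)
      (Eventually.of_forall fun t => ?_) (Eventually.of_forall fun t => ?_)
      (integrable_const _) (Eventually.of_forall fun u => ?_)
    · exact ((by fun_prop : Measurable fun u => f (t - u)).indicator
        measurableSet_Iic).aestronglyMeasurable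
    · refine Eventually.of_forall fun u => ?_
      by_cases hu : u ≤ t
      · simpa [hu] using hb (t - u) (by linarith)
      · simpa [hu] using hC
    · have h2 : Tendsto (fun t => f (t - u)) atTop (𝓝 c) :=
        hc.comp (tendsto_atTop_add_const_right _ (-u) tendsto_id)
      refine h2.congr' ?_
      filter_upwards [eventually_ge_atTop u] with t ht
      simp [ht]
  simp only [integral_const, probReal_univ, one_smul] at h1
  refine h1.congr' ?_
  filter_upwards [eventually_ge_atTop 0] with t ht
  rw [exp_mul_integral_eq_integral_expLaw hθ f ht]

end

/-! ### Paths of sublinear growth -/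

section

variable {θ : ℝ} {g : ℝ → ℝ}

theorem tendsto_exp_mul_of_tendsto_div (hg : Tendsto (fun t => g t / t) atTop (𝓝 0)) {a : ℝ}
    (ha : 0 < a) : Tendsto (fun t => Real.exp (-a * t) * g t) atTop (𝓝 0) := by
  have h := (tendsto_rpow_mul_exp_neg_mul_atTop_nhds_zero 1 a ha).mul hg
  rw [mul_zero] at h
  refine h.congr' ?_
  filter_upwards [eventually_gt_atTop 0] with t ht
  rw [Real.rpow_one]; field_simp

theorem exists_abs_le_exp (hgc : Continuous g) (hg : Tendsto (fun t => g t / t) atTop (𝓝 0))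
    {a : ℝ} (ha : 0 < a) : ∃ C, 0 ≤ C ∧ ∀ s, 0 ≤ s → |g s| ≤ C * Real.exp (a * s) := by
  obtain ⟨C, hC, h⟩ := exists_forall_abs_le_of_tendsto (f := fun t => Real.exp (-a * t) * g t)
    (by fun_prop) (tendsto_exp_mul_of_tendsto_div hg ha)
  refine ⟨C, hC, fun s hs => ?_⟩
  have := h s hs
  rw [abs_mul, Real.abs_exp, neg_mul, Real.exp_neg, inv_mul_le_iff₀ (Real.exp_pos _)] at this
  linarith

/-- `μ + θ ∫_0^t e^{-θ s} g_s ds`. -/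
noncomputable def drift (θ μ : ℝ) (g : ℝ → ℝ) (t : ℝ) : ℝ :=
  μ + ∫ s in (0 : ℝ)..t, θ * Real.exp (-θ * s) * g s

/-- The limit `μ + θ ∫_0^∞ e^{-θ s} g_s ds`. -/
noncomputable def driftLim (θ μ : ℝ) (g : ℝ → ℝ) : ℝ :=
  μ + θ * ∫ s in Set.Ioi (0 : ℝ), Real.exp (-θ * s) * g s

/-- The exponentially weighted noise `e^{-θ t} ∫_0^t e^{θ s} dg_s`. -/
noncomputable def noise (θ : ℝ) (g : ℝ → ℝ) (t : ℝ) : ℝ :=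
  g t - Real.exp (-θ * t) * ∫ s in (0 : ℝ)..t, θ * Real.exp (θ * s) * g s

variable (hθ : 0 < θ) (hgc : Continuous g) (hg : Tendsto (fun t => g t / t) atTop (𝓝 0))
include hθ hgc hg

theorem integrableOn_exp_mul : IntegrableOn (fun s => Real.exp (-θ * s) * g s) (Set.Ioi 0) := by
  obtain ⟨C, hC, hb⟩ := exists_abs_le_exp hgc hg (half_pos hθ)
  refine (Integrable.mono' ((integrableOn_exp_mul_Ioi (a := -(θ / 2)) (by linarith) 0).const_mul C)
    (by fun_prop) ?_)
  filter_upwards [ae_restrict_mem measurableSet_Ioi] with s hs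
  rw [Real.norm_eq_abs, abs_mul, Real.abs_exp]
  calc Real.exp (-θ * s) * |g s| ≤ Real.exp (-θ * s) * (C * Real.exp (θ / 2 * s)) := by
        gcongr; exact hb s (le_of_lt hs)
    _ = C * (Real.exp (-θ * s) * Real.exp (θ / 2 * s)) := by ring
    _ = C * Real.exp (-(θ / 2) * s) := by rw [← Real.exp_add]; ring_nf

theorem tendsto_drift (μ : ℝ) : Tendsto (drift θ μ g) atTop (𝓝 (driftLim θ μ g)) := by
  have h := (intervalIntegral_tendsto_integral_Ioi 0 (integrableOn_exp_mul hθ hgc hg)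
    tendsto_id).const_mul θ |>.const_add μ
  refine h.congr fun t => ?_
  simp [drift, mul_assoc, intervalIntegral.integral_const_mul]

/-- Bounding |g s| by (1 + t) |g s|/(1 + s) for s ≤ t reduces the claim to the weighted average of a
function tending to 0. -/
theorem tendsto_noise_div : Tendsto (fun t => noise θ g t / t) atTop (𝓝 0) := by
  let f : ℝ → ℝ := fun s => |g s| / (1 + |s|)
  have hf : Continuous f := hgc.abs.div (by fun_prop) fun s => by positivity
  have hf0 : Tendsto f atTop (𝓝 0) := by
    refine squeeze_zero' (Eventually.of_forall fun s => by positivity) ?_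
      (by simpa using hg.abs : Tendsto (fun t => |g t / t|) atTop (𝓝 0))
    filter_upwards [eventually_gt_atTop 0] with s hs
    rw [abs_div]
    exact div_le_div_of_nonneg_left (abs_nonneg _) (abs_pos.2 hs.ne') (by linarith)
  have h1 := tendsto_exp_mul_integral hθ hf hf0
  have h2 : Tendsto (fun t : ℝ => (1 + t) / t) atTop (𝓝 1) := by
    have := (tendsto_inv_atTop_zero (𝕜 := ℝ)).add_const 1
    rw [zero_add] at this
    refine this.congr' ?_
    filter_upwards [eventually_gt_atTop 0] with t ht
    field_simp
  have h3 := h2.mul h1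
  rw [mul_zero] at h3
  have h4 : Tendsto (fun t => (Real.exp (-θ * t) * ∫ s in (0 : ℝ)..t, θ * Real.exp (θ * s) * g s) / t)
      atTop (𝓝 0) := by
    refine squeeze_zero_norm' ?_ h3
    filter_upwards [eventually_gt_atTop 0] with t ht
    rw [norm_div, norm_mul, Real.norm_of_nonneg (Real.exp_pos _).le, Real.norm_of_nonneg ht.le,
      div_mul_eq_mul_div]
    gcongr ?_ / t
    rw [mul_left_comm]
    gcongr
    rw [← intervalIntegral.integral_const_mul]
    refine intervalIntegral.norm_integral_le_of_norm_le ht.le (Eventually.of_forall fun s hs => ?_)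
      (Continuous.intervalIntegrable (by fun_prop) _ _)
    simp only [f]
    rw [norm_mul, Real.norm_of_nonneg (by positivity), Real.norm_eq_abs, abs_of_pos hs.1,
      mul_left_comm]
    gcongr
    have hs1 : 0 < 1 + s := by linarith [hs.1]
    rw [mul_div_assoc', le_div_iff₀ hs1, mul_comm]
    gcongr
    exact hs.2
  have h5 := hg.sub h4
  rw [sub_zero] at h5
  refine h5.congr fun t => ?_
  rw [noise, sub_div]

/-- With |g r| ≤ C e^{θr/4}, the integral of θ e^{-θr}|g r| beyond s is at most (4/3) C e^{-3θs/4};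
a further factor |g s| still leaves the rate θ/2. -/
theorem exists_abs_drift_sub_le (μ : ℝ) : ∃ C, 0 ≤ C ∧ ∀ s t, 0 ≤ s → s ≤ t →
    |drift θ μ g t - drift θ μ g s| * |g s| ≤ C * Real.exp (-(θ / 2) * s) := by
  obtain ⟨C, hC, hb⟩ := exists_abs_le_exp hgc hg (a := θ / 4) (by linarith)
  refine ⟨4 / 3 * C * C, by positivity, fun s t hs hst => ?_⟩
  have hI : ∀ a b, IntervalIntegrable (fun s => θ * Real.exp (-θ * s) * g s) volume a b :=
    fun a b => Continuous.intervalIntegrable (by fun_prop) a b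
  have e1 : drift θ μ g t - drift θ μ g s = ∫ r in s..t, θ * Real.exp (-θ * r) * g r := by
    rw [← intervalIntegral.integral_interval_sub_left (hI 0 t) (hI 0 s), drift, drift]; ring
  have e2 : ∫ r in s..t, θ * C * Real.exp (-(3 * θ / 4) * r) =
      4 / 3 * C * (Real.exp (-(3 * θ / 4) * s) - Real.exp (-(3 * θ / 4) * t)) := by
    rw [intervalIntegral.integral_const_mul,
      intervalIntegral.integral_comp_mul_left (fun x => Real.exp x) (by linarith), integral_exp,
      smul_eq_mul]
    field_simp
    ring
  have h1 : |drift θ μ g t - drift θ μ g s| ≤ 4 / 3 * C * Real.exp (-(3 * θ / 4) * s) := by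
    rw [e1, ← Real.norm_eq_abs]
    refine (intervalIntegral.norm_integral_le_of_norm_le hst (g := fun r =>
      θ * C * Real.exp (-(3 * θ / 4) * r)) (Eventually.of_forall fun r hr => ?_)
      (Continuous.intervalIntegrable (by fun_prop) _ _)).trans ?_
    · rw [norm_mul, Real.norm_of_nonneg (by positivity), Real.norm_eq_abs]
      calc θ * Real.exp (-θ * r) * |g r|
          ≤ θ * Real.exp (-θ * r) * (C * Real.exp (θ / 4 * r)) := by
            gcongr; exact hb r (hs.trans hr.1.le)
        _ = θ * C * (Real.exp (-θ * r) * Real.exp (θ / 4 * r)) := by ring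
        _ = _ := by rw [← Real.exp_add]; ring_nf
    · rw [e2]
      have := Real.exp_pos (-(3 * θ / 4) * t)
      gcongr
      linarith
  calc |drift θ μ g t - drift θ μ g s| * |g s|
      ≤ 4 / 3 * C * Real.exp (-(3 * θ / 4) * s) * (C * Real.exp (θ / 4 * s)) := by
        gcongr; exact hb s hs
    _ = 4 / 3 * C * C * (Real.exp (-(3 * θ / 4) * s) * Real.exp (θ / 4 * s)) := by ring
    _ = _ := by rw [← Real.exp_add]; ring_nf

end

/-! ### The Vasicek path -/

section

variable {θ μ : ℝ} {g x : ℝ → ℝ} (hgc : Continuous g) (hxc : Continuous x)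
  (hx : ∀ t, 0 ≤ t → x t = (∫ s in (0 : ℝ)..t, θ * (μ + x s)) + g t)
include hgc hxc hx

/-- Variation of constants. Since x - g is differentiable, e^{-θt}(x - g + μ) has derivative θ
e^{-θt} g, the same as the drift; no derivative of g is needed. -/
theorem vasicek_eq {t : ℝ} (ht : 0 ≤ t) :
    x t = g t + Real.exp (θ * t) * drift θ μ g t - μ := by
  let w : ℝ → ℝ := fun t => Real.exp (-θ * t) * ((∫ s in (0 : ℝ)..t, θ * (μ + x s)) + μ) -
    drift θ μ g t
  have hw : ∀ s, 0 ≤ s → HasDerivAt w 0 s := by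
    intro s hs
    have h1 : HasDerivAt (fun t => ∫ s in (0 : ℝ)..t, θ * (μ + x s)) (θ * (μ + x s)) s :=
      (by fun_prop : Continuous fun s => θ * (μ + x s)).integral_hasStrictDerivAt 0 s |>.hasDerivAt
    have h2 : HasDerivAt (drift θ μ g) (θ * Real.exp (-θ * s) * g s) s :=
      ((by fun_prop : Continuous fun s => θ * Real.exp (-θ * s) * g s).integral_hasStrictDerivAt
        0 s |>.hasDerivAt).const_add μ
    have h3 : HasDerivAt (fun t => Real.exp (-θ * t)) (Real.exp (-θ * s) * (-θ)) s := by
      simpa using ((hasDerivAt_id s).const_mul (-θ)).exp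
    refine ((h3.mul (h1.add_const μ)).sub h2).congr_deriv ?_
    have := hx s hs
    rw [this]; ring
  have hconst := constant_of_has_deriv_right_zero (f := w) (a := 0) (b := t)
    (fun s hs => (hw s hs.1).continuousAt.continuousWithinAt)
    (fun s hs => (hw s hs.1).hasDerivWithinAt) t ⟨ht, le_rfl⟩
  simp only [w, drift, intervalIntegral.integral_same, mul_zero, Real.exp_zero, zero_add, one_mul,
    add_zero, sub_self] at hconst
  have h4 : Real.exp (θ * t) * Real.exp (-θ * t) = 1 := by
    rw [← Real.exp_add]; simp
  rw [hx t ht, drift]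
  linear_combination Real.exp (θ * t) * hconst - ((∫ s in (0 : ℝ)..t, θ * (μ + x s)) + μ) * h4

omit hgc in
theorem mul_integral_vasicek {t : ℝ} (ht : 0 ≤ t) :
    θ * ∫ s in (0 : ℝ)..t, x s = x t - θ * μ * t - g t := by
  rw [hx t ht, intervalIntegral.integral_const_mul, intervalIntegral.integral_add
    (continuous_const.intervalIntegrable _ _) (hxc.intervalIntegrable _ _)]
  simp only [intervalIntegral.integral_const, sub_zero, smul_eq_mul]
  ring

/-- Integration by parts for `∫ x dg = x_t²/2 - θ ∫ x² - θ μ ∫ x`. -/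
theorem vasicek_energy {t : ℝ} (ht : 0 ≤ t) :
    1 / 2 * x t ^ 2 - θ * (∫ s in (0 : ℝ)..t, x s ^ 2) - θ * μ * (∫ s in (0 : ℝ)..t, x s) =
      x t * g t - 1 / 2 * g t ^ 2 - ∫ s in (0 : ℝ)..t, θ * (g s * (μ + x s)) := by
  -- y = x - g is continuously differentiable, so ∫ y y' = y²/2 is classical; substituting back
  -- produces the terms in g.
  let y : ℝ → ℝ := fun t => ∫ s in (0 : ℝ)..t, θ * (μ + x s)
  have hy : ∀ s, HasDerivAt y (θ * (μ + x s)) s := fun s =>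
    (by fun_prop : Continuous fun s => θ * (μ + x s)).integral_hasStrictDerivAt 0 s |>.hasDerivAt
  have hyc : Continuous y := continuous_iff_continuousAt.2 fun s => (hy s).continuousAt
  have h1 : ∫ s in (0 : ℝ)..t, y s * (θ * (μ + x s)) = 1 / 2 * y t ^ 2 := by
    rw [intervalIntegral.integral_eq_sub_of_hasDerivAt (f := fun s => 1 / 2 * y s ^ 2)
      (fun s _ => (((hy s).pow 2).const_mul (1 / 2)).congr_deriv (by simp; ring))
      (Continuous.intervalIntegrable (by fun_prop) _ _)]
    simp [y]
  have h2 : ∫ s in (0 : ℝ)..t, y s * (θ * (μ + x s)) =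
      ∫ s in (0 : ℝ)..t, (θ * x s ^ 2 + θ * μ * x s) - θ * (g s * (μ + x s)) := by
    refine intervalIntegral.integral_congr fun s hs => ?_
    rw [Set.uIcc_of_le ht] at hs
    have := hx s hs.1
    rw [show y s = x s - g s by simp only [y]; linarith]; ring
  rw [intervalIntegral.integral_sub (Continuous.intervalIntegrable (by fun_prop) _ _)
    (Continuous.intervalIntegrable (by fun_prop) _ _), intervalIntegral.integral_add
    (Continuous.intervalIntegrable (by fun_prop) _ _)
    (Continuous.intervalIntegrable (by fun_prop) _ _), intervalIntegral.integral_const_mul,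
    intervalIntegral.integral_const_mul] at h2
  have h3 : y t = x t - g t := by have := hx t ht; simp only [y]; linarith
  rw [h1, h3] at h2
  linarith

variable (hθ : 0 < θ) (hg : Tendsto (fun t => g t / t) atTop (𝓝 0))
include hθ hg

theorem tendsto_exp_mul_vasicek :
    Tendsto (fun t => Real.exp (-θ * t) * x t) atTop (𝓝 (driftLim θ μ g)) := by
  have h1 := tendsto_exp_mul_of_tendsto_div hg hθ
  have h2 : Tendsto (fun t : ℝ => Real.exp (-θ * t) * μ) atTop (𝓝 0) :=
    tendsto_exp_mul_of_tendsto_div (tendsto_const_nhds.div_atTop tendsto_id) hθ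
  have h := (h1.add (tendsto_drift hθ hgc hg μ)).sub h2
  rw [zero_add, sub_zero] at h
  refine h.congr' ?_
  filter_upwards [eventually_ge_atTop 0] with t ht
  rw [vasicek_eq hgc hxc hx ht]
  have h4 : Real.exp (θ * t) * Real.exp (-θ * t) = 1 := by
    rw [← Real.exp_add]; simp
  linear_combination (-drift θ μ g t) * h4

theorem tendsto_exp_mul_integral_vasicek :
    Tendsto (fun t => Real.exp (-θ * t) * ∫ s in (0 : ℝ)..t, x s) atTop
      (𝓝 (driftLim θ μ g / θ)) := by
  have h1 := tendsto_exp_mul_of_tendsto_div hg hθ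
  have h2 : Tendsto (fun t : ℝ => Real.exp (-θ * t) * (θ * μ * t)) atTop (𝓝 0) := by
    have := (tendsto_rpow_mul_exp_neg_mul_atTop_nhds_zero 1 θ hθ).const_mul (θ * μ)
    rw [mul_zero] at this
    refine this.congr fun t => ?_
    rw [Real.rpow_one]; ring
  have h := (((tendsto_exp_mul_vasicek hgc hxc hx hθ hg).sub h2).sub h1).div_const θ
  rw [sub_zero, sub_zero] at h
  refine h.congr' ?_
  filter_upwards [eventually_ge_atTop 0] with t ht
  rw [div_eq_iff hθ.ne']
  linear_combination (-Real.exp (-θ * t)) * mul_integral_vasicek hxc hx ht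

/-- The Toeplitz lemma at rate 2θ, applied to (e^{-θt}x_t)². -/
theorem tendsto_exp_mul_integral_sq_vasicek :
    Tendsto (fun t => Real.exp (-θ * t) ^ 2 * ∫ s in (0 : ℝ)..t, x s ^ 2) atTop
      (𝓝 (driftLim θ μ g ^ 2 / (2 * θ))) := by
  have h := (tendsto_exp_mul_integral (θ := 2 * θ) (by linarith)
    (by fun_prop : Continuous fun t => (Real.exp (-θ * t) * x t) ^ 2)
    ((tendsto_exp_mul_vasicek hgc hxc hx hθ hg).pow 2)).div_const (2 * θ)
  refine h.congr fun t => ?_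
  have e : ∀ s, 2 * θ * Real.exp (2 * θ * s) * (Real.exp (-θ * s) * x s) ^ 2 = 2 * θ * x s ^ 2 := by
    intro s
    have : Real.exp (2 * θ * s) * Real.exp (-θ * s) ^ 2 = 1 := by
      rw [← Real.exp_nat_mul, ← Real.exp_add]; simp; ring
    linear_combination 2 * θ * x s ^ 2 * this
  simp_rw [e]
  rw [intervalIntegral.integral_const_mul, ← Real.exp_nat_mul, div_eq_iff (by positivity)]
  push_cast
  rw [show 2 * (-θ * t) = -(2 * θ) * t by ring]
  ring

/-- Up to a vanishing error, `e^{-θ t} ∫ x dg` is the weighted noise times the drift. -/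
theorem tendsto_energy_sub_drift_mul_noise :
    Tendsto (fun t => Real.exp (-θ * t) * (1 / 2 * x t ^ 2 - θ * (∫ s in (0 : ℝ)..t, x s ^ 2) -
      θ * μ * (∫ s in (0 : ℝ)..t, x s)) - drift θ μ g t * noise θ g t) atTop (𝓝 0) := by
  have hdc : Continuous (drift θ μ g) := by
    refine continuous_const.add (continuous_iff_continuousAt.2 fun s => ?_)
    exact ((by fun_prop : Continuous fun s => θ * Real.exp (-θ * s) *
      g s).integral_hasStrictDerivAt 0 s).hasDerivAt.continuousAt
  obtain ⟨C, hC, hb⟩ := exists_abs_drift_sub_le hθ hgc hg μ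
  have hsq : Tendsto (fun t => Real.exp (-θ * t) * g t ^ 2) atTop (𝓝 0) := by
    have := (tendsto_exp_mul_of_tendsto_div hg (half_pos hθ)).pow 2
    rw [zero_pow two_ne_zero] at this
    refine this.congr fun t => ?_
    rw [mul_pow, ← Real.exp_nat_mul]
    congr 2
    push_cast; ring
  have h1 := (hsq.const_mul (1 / 2)).sub ((tendsto_exp_mul_of_tendsto_div hg hθ).const_mul μ)
  have h2 := tendsto_exp_mul_integral hθ (by fun_prop : Continuous fun t =>
    Real.exp (-θ * t) * g t ^ 2) hsq
  -- The error from freezing the drift at its terminal value: the integrand without its weight is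
  -- O(e^{-θs/2}), so its weighted average vanishes.
  have h3 : Tendsto (fun t => Real.exp (-θ * t) *
      ∫ s in (0 : ℝ)..t, θ * Real.exp (θ * s) * ((drift θ μ g t - drift θ μ g s) * g s))
      atTop (𝓝 0) := by
    have h4 : Tendsto (fun s : ℝ => C * Real.exp (-(θ / 2) * s)) atTop (𝓝 0) := by
      have := (tendsto_rpow_mul_exp_neg_mul_atTop_nhds_zero 0 (θ / 2) (half_pos hθ)).const_mul C
      simpa using this
    refine squeeze_zero_norm' ?_ (tendsto_exp_mul_integral hθ (by fun_prop) h4)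
    filter_upwards [eventually_ge_atTop 0] with t ht
    rw [norm_mul, Real.norm_of_nonneg (Real.exp_pos _).le]
    gcongr
    refine intervalIntegral.norm_integral_le_of_norm_le ht (Eventually.of_forall fun s hs => ?_)
      (Continuous.intervalIntegrable (by fun_prop) _ _)
    rw [norm_mul, Real.norm_of_nonneg (by positivity), norm_mul]
    refine mul_le_mul_of_nonneg_left ?_ (by positivity)
    exact hb s t hs.1.le hs.2
  have h := (h1.sub h2).add h3
  rw [mul_zero, mul_zero, sub_zero, sub_zero, add_zero] at h
  refine h.congr' ?_
  filter_upwards [eventually_ge_atTop 0] with t ht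
  have hexp : ∀ s : ℝ, Real.exp (θ * s) * Real.exp (-θ * s) = 1 := fun s => by
    rw [← Real.exp_add]; simp
  -- Inserting μ + x_s = g_s + e^{θs}D_s separates a negligible quadratic term in g from the drift
  -- term.
  have e1 : ∫ s in (0 : ℝ)..t, θ * (g s * (μ + x s)) =
      (∫ s in (0 : ℝ)..t, θ * Real.exp (θ * s) * (Real.exp (-θ * s) * g s ^ 2)) +
      ∫ s in (0 : ℝ)..t, θ * Real.exp (θ * s) * (drift θ μ g s * g s) := by
    rw [← intervalIntegral.integral_add (Continuous.intervalIntegrable (by fun_prop) _ _)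
      (Continuous.intervalIntegrable (by fun_prop) _ _)]
    refine intervalIntegral.integral_congr fun s hs => ?_
    rw [Set.uIcc_of_le ht] at hs
    rw [vasicek_eq hgc hxc hx hs.1]
    linear_combination (-θ * g s ^ 2) * hexp s
  have e2 : ∫ s in (0 : ℝ)..t, θ * Real.exp (θ * s) * ((drift θ μ g t - drift θ μ g s) * g s) =
      drift θ μ g t * (∫ s in (0 : ℝ)..t, θ * Real.exp (θ * s) * g s) -
      ∫ s in (0 : ℝ)..t, θ * Real.exp (θ * s) * (drift θ μ g s * g s) := by
    rw [← intervalIntegral.integral_const_mul, ← intervalIntegral.integral_sub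
      (Continuous.intervalIntegrable (by fun_prop) _ _)
      (Continuous.intervalIntegrable (by fun_prop) _ _)]
    congr 1 with s
    ring
  rw [vasicek_energy hgc hxc hx ht, e1, e2, noise]
  rw [vasicek_eq hgc hxc hx ht]
  linear_combination (-drift θ μ g t * g t) * hexp t

end

end BifractionalVasicek

namespace BifractionalVasicek

/-! ### Second moments -/

section

variable {Ω : Type*} [MeasurableSpace Ω] {P : Measure Ω}

theorem abs_integral_mul_le_sqrt {U V : Ω → ℝ} (hU : MemLp U 2 P) (hV : MemLp V 2 P) :
    |∫ ω, U ω * V ω ∂P| ≤ √(∫ ω, U ω ^ 2 ∂P) * √(∫ ω, V ω ^ 2 ∂P) := by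
  have key : ∀ {Z W : Ω → ℝ} (hZ : MemLp Z 2 P) (hW : MemLp W 2 P),
      inner ℝ (hZ.toLp Z) (hW.toLp W) = ∫ ω, Z ω * W ω ∂P := by
    intro Z W hZ hW
    rw [L2.inner_def]
    refine integral_congr_ae ?_
    filter_upwards [hZ.coeFn_toLp, hW.coeFn_toLp] with ω h1 h2
    rw [h1, h2]
    simp [mul_comm]
  have hn : ∀ {Z : Ω → ℝ} (hZ : MemLp Z 2 P), ‖hZ.toLp Z‖ = √(∫ ω, Z ω ^ 2 ∂P) := by
    intro Z hZ
    rw [norm_eq_sqrt_real_inner, key hZ hZ]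
    simp [sq]
  rw [← key hU hV, ← hn hU, ← hn hV]
  exact abs_real_inner_le_norm _ _

theorem InHull.integral {ι : Type*} {G : ι → Ω → ℝ} [IsProbabilityMeasure P] {ν : Measure ℝ}
    [IsProbabilityMeasure ν] {y : ℝ → Ω → ℝ} (hy : MemLp (Function.uncurry y) 2 (ν.prod P))
    (h : ∀ᵐ s ∂ν, InHull G P (y s)) : InHull G P (fun ω => ∫ s, y s ω ∂ν) :=
  ⟨memLp_two_integral hy, fun W hW h0 => by
    rw [integral_integral_mul hy hW, integral_eq_zero_of_ae]
    exact h.mono fun s hs => hs.2 W hW h0⟩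

end

/-! ### Continuous versions -/

/-- `g` is a version, indexed by all reals, of the process `G`, with continuous paths and
measurable marginals. -/
structure IsContinuousVersion {Ω : Type*} [MeasurableSpace Ω] (G : ℝ≥0 → Ω → ℝ) (g : ℝ → Ω → ℝ)
    (P : Measure Ω) : Prop where
  continuous : ∀ ω, Continuous fun s => g s ω
  measurable : ∀ s, Measurable (g s)
  ae_eq : ∀ᵐ ω ∂P, ∀ s, g s ω = G s.toNNReal ω

section

variable {Ω : Type*} [MeasurableSpace Ω] {P : Measure Ω} {H K θ : ℝ} {G : ℝ≥0 → Ω → ℝ}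
  {g : ℝ → Ω → ℝ}

/-- Setting the process to 0 on a measurable null set containing the bad paths gives continuity for
every ω, hence the joint measurability needed for Fubini. -/
theorem exists_isContinuousVersion (hGm : ∀ t, Measurable (G t))
    (hGcont : ∀ᵐ ω ∂P, Continuous fun t => G t ω) : ∃ g, IsContinuousVersion G g P := by
  obtain ⟨t, hst, htm, ht0⟩ := exists_measurable_superset_of_null (ae_iff.1 hGcont)
  have hc : ∀ ω ∈ tᶜ, Continuous fun t => G t ω := fun ω hω => by
    by_contra h
    exact hω (hst h)
  refine ⟨fun s => tᶜ.indicator (G s.toNNReal), fun ω => ?_, fun s =>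
    (hGm _).indicator htm.compl, ?_⟩
  · by_cases hω : ω ∈ tᶜ
    · simp only [Set.indicator_of_mem hω]
      exact (hc ω hω).comp continuous_real_toNNReal
    · simp only [Set.indicator_of_notMem hω]
      exact continuous_const
  · filter_upwards [(measure_eq_zero_iff_ae_notMem.1 ht0)] with ω hω s
    rw [Set.indicator_of_mem hω]

namespace IsContinuousVersion

theorem measurable_uncurry (hg : IsContinuousVersion G g P) : Measurable (Function.uncurry g) :=
  measurable_uncurry_of_continuous_of_measurable hg.continuous hg.measurable

theorem ae_eq_apply (hg : IsContinuousVersion G g P) (s : ℝ) : g s =ᵐ[P] G s.toNNReal :=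
  hg.ae_eq.mono fun _ h => h s

end IsContinuousVersion

/-- The increment over `[T - u, T]`, for `u ≤ T`. -/
noncomputable def backIncr (g : ℝ → Ω → ℝ) (T u : ℝ) (ω : Ω) : ℝ :=
  (Set.Iic T).indicator (fun u => g T ω - g (T - u) ω) u

/-- Subtracting g from its terminal value g T turns the noise into an exponential mean of backward
increments, whose L² norms are bounded uniformly in T; the missing mass of the weight leaves
e^{-θT}g T. -/
theorem noise_eq_add_integral (hθ : 0 < θ) (hg : IsContinuousVersion G g P) {T : ℝ} (hT : 0 ≤ T)
    (ω : Ω) : noise θ (fun s => g s ω) T =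
      Real.exp (-θ * T) * g T ω + ∫ u, backIncr g T u ω ∂(expLaw θ) := by
  have hc := hg.continuous ω
  simp only [backIncr]
  rw [← exp_mul_integral_eq_integral_expLaw hθ (fun s => g T ω - g s ω) hT, noise]
  simp only [mul_sub]
  rw [intervalIntegral.integral_sub (Continuous.intervalIntegrable (by fun_prop) _ _)
    (Continuous.intervalIntegrable (by fun_prop) _ _), intervalIntegral.integral_mul_const]
  have h1 : ∫ s in (0 : ℝ)..T, θ * Real.exp (θ * s) = Real.exp (θ * T) - 1 := by
    rw [intervalIntegral.integral_eq_sub_of_hasDerivAt (f := fun s => Real.exp (θ * s))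
      (fun s _ => by simpa [mul_comm] using ((hasDerivAt_id s).const_mul θ).exp)
      (Continuous.intervalIntegrable (by fun_prop) _ _)]
    simp
  have h2 : Real.exp (-θ * T) * Real.exp (θ * T) = 1 := by rw [← Real.exp_add]; simp
  rw [h1]
  linear_combination (-g T ω) * h2

theorem driftLim_eq_add_integral (hθ : 0 < θ) (μ : ℝ) (f : ℝ → ℝ) :
    driftLim θ μ f = μ + ∫ s, f s ∂(expLaw θ) := by
  rw [integral_expLaw hθ, driftLim]
  simp only [mul_assoc]
  rw [integral_const_mul]

/-! ### Covariances of the weighted noise, the scaled driving path and the limit ζ_∞ -/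

variable [IsProbabilityMeasure P] (hH : H ∈ Set.Ioo (0 : ℝ) 1) (hK : K ∈ Set.Ioc (0 : ℝ) 1)
  (hθ : 0 < θ) (hG : IsBifractionalBrownianMotion H K G P) (hg : IsContinuousVersion G g P)

omit [IsProbabilityMeasure P] in
include hG in
theorem memLp_marginal (t : ℝ≥0) : MemLp (G t) 2 P := (hG.gaussian.hasGaussianLaw_eval t).memLp_two

include hG hg

omit [IsProbabilityMeasure P] in
theorem inHull_version (s : ℝ) : InHull G P (g s) :=
  (InHull.of_mem (memLp_marginal hG) s.toNNReal).congr (hg.ae_eq_apply s).symm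

omit [IsProbabilityMeasure P] in
theorem memLp_version (s : ℝ) : MemLp (g s) 2 P := (inHull_version hG hg s).1

omit [IsProbabilityMeasure P] in
theorem integral_version_mul {s t : ℝ} (hs : 0 ≤ s) (ht : 0 ≤ t) :
    ∫ ω, g s ω * g t ω ∂P = bifCov H K s t := by
  have h := hG.covariance_eq s.toNNReal t.toNNReal
  rw [Real.coe_toNNReal _ hs, Real.coe_toNNReal _ ht] at h
  rw [bifCov, ← h]
  refine integral_congr_ae ?_
  filter_upwards [hg.ae_eq] with ω hω
  rw [hω, hω]

omit [IsProbabilityMeasure P] in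
theorem memLp_backIncr (T u : ℝ) : MemLp (backIncr g T u) 2 P := by
  by_cases hu : u ≤ T
  · have e : backIncr g T u = g T - g (T - u) := by ext ω; simp [backIncr, hu]
    rw [e]
    exact (memLp_version hG hg T).sub (memLp_version hG hg (T - u))
  · have e : backIncr g T u = 0 := by ext ω; simp [backIncr, hu]
    rw [e]
    exact MemLp.zero

omit [IsProbabilityMeasure P] in
theorem inHull_backIncr (T u : ℝ) : InHull G P (backIncr g T u) := by
  by_cases hu : u ≤ T
  · have e : backIncr g T u = fun ω => g T ω - g (T - u) ω := by ext ω; simp [backIncr, hu]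
    rw [e]
    exact (inHull_version hG hg T).sub (inHull_version hG hg (T - u))
  · have e : backIncr g T u = fun ω => 0 * g T ω := by ext ω; simp [backIncr, hu]
    rw [e]
    exact (inHull_version hG hg T).const_mul 0

omit [IsProbabilityMeasure P] in
theorem integral_backIncr_mul {T u s : ℝ} (hu0 : 0 ≤ u) (hu : u ≤ T) (hs : 0 ≤ s) :
    ∫ ω, backIncr g T u ω * g s ω ∂P = bifCov H K T s - bifCov H K (T - u) s := by
  have h := integral_sub ((memLp_version hG hg T).integrable_mul (memLp_version hG hg s))
    ((memLp_version hG hg (T - u)).integrable_mul (memLp_version hG hg s))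
  simp only [Pi.mul_apply] at h
  rw [integral_version_mul hG hg (hu0.trans hu) hs,
    integral_version_mul hG hg (sub_nonneg.2 hu) hs] at h
  rw [← h]
  simp only [backIncr, Set.indicator, Set.mem_Iic, hu, if_true, sub_mul]

omit [IsProbabilityMeasure P] in
theorem integral_backIncr_mul_backIncr {T u v : ℝ} (hu0 : 0 ≤ u) (hu : u ≤ T)
    (hv : v ≤ T) : ∫ ω, backIncr g T u ω * backIncr g T v ω ∂P =
      bifCov H K T T - bifCov H K (T - u) T - bifCov H K T (T - v) +
        bifCov H K (T - u) (T - v) := by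
  have hT := hu0.trans hu
  have h := integral_sub
    ((memLp_backIncr hG hg T u).integrable_mul (memLp_version hG hg T))
    ((memLp_backIncr hG hg T u).integrable_mul (memLp_version hG hg (T - v)))
  simp only [Pi.mul_apply] at h
  rw [integral_backIncr_mul hG hg hu0 hu hT,
    integral_backIncr_mul hG hg hu0 hu (sub_nonneg.2 hv)] at h
  have e : ∀ ω, backIncr g T u ω * backIncr g T v ω =
      backIncr g T u ω * g T ω - backIncr g T u ω * g (T - v) ω := fun ω => by
    rw [← mul_sub]; simp [backIncr, hv]
  simp_rw [e]
  rw [h]; ring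

include hH hK

omit [IsProbabilityMeasure P] in
theorem integral_version_sq {s : ℝ} (hs : 0 ≤ s) : ∫ ω, g s ω ^ 2 ∂P = s ^ (2 * H * K) := by
  simp_rw [sq]
  rw [integral_version_mul hG hg hs hs, bifCov_self hH hK hs]

omit [IsProbabilityMeasure P] in
theorem sqrt_integral_version_sq {s : ℝ} (hs : 0 ≤ s) :
    √(∫ ω, g s ω ^ 2 ∂P) = s ^ (H * K) := by
  rw [integral_version_sq hH hK hG hg hs, Real.sqrt_eq_rpow, ← Real.rpow_mul hs]
  congr 1; ring

omit [IsProbabilityMeasure P] in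
theorem integral_increment_sq_le {s t : ℝ} (hs : 0 ≤ s) (ht : 0 ≤ t) :
    ∫ ω, (g t ω - g s ω) ^ 2 ∂P ≤ 2 * |t - s| ^ (2 * H * K) := by
  refine le_trans (le_of_eq ?_) (bifCov_increment_le hH hK hs ht)
  have h1 := (memLp_version hG hg t).integrable_mul (memLp_version hG hg t)
  have h2 := (memLp_version hG hg s).integrable_mul (memLp_version hG hg s)
  have h3 := ((memLp_version hG hg s).integrable_mul (memLp_version hG hg t)).const_mul 2
  have h := integral_sub (h1.add h2) h3
  have h' := integral_add h1 h2
  simp only [Pi.mul_apply, Pi.add_apply] at h h'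
  rw [h', integral_const_mul, integral_version_mul hG hg ht ht, integral_version_mul hG hg hs hs,
    integral_version_mul hG hg hs ht] at h
  rw [← h]
  congr 1 with ω
  ring

omit [IsProbabilityMeasure P] in
theorem integral_backIncr_sq_le {T u : ℝ} (hu : 0 ≤ u) :
    ∫ ω, backIncr g T u ω ^ 2 ∂P ≤ 2 * u ^ (2 * H * K) := by
  by_cases huT : u ≤ T
  · have := integral_increment_sq_le hH hK hG hg (sub_nonneg.2 huT) (hu.trans huT)
    rw [sub_sub_cancel, abs_of_nonneg hu] at this
    simpa [backIncr, huT] using this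
  · simp only [backIncr, Set.indicator, Set.mem_Iic, huT, if_false]
    simp only [ne_eq, OfNat.ofNat_ne_zero, not_false_eq_true, zero_pow, integral_zero]
    positivity

omit [IsProbabilityMeasure P] in
theorem sqrt_integral_backIncr_sq_le {T u : ℝ} (hu : 0 ≤ u) :
    √(∫ ω, backIncr g T u ω ^ 2 ∂P) ≤ 2 * u ^ (H * K) := by
  -- The factor 2 is a convenient replacement for √2.
  refine Real.sqrt_le_iff.2 ⟨by positivity, (integral_backIncr_sq_le hH hK hG hg hu).trans ?_⟩
  rw [mul_pow, ← Real.rpow_natCast (u ^ (H * K)), ← Real.rpow_mul hu]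
  push_cast
  rw [show H * K * 2 = 2 * H * K by ring]
  have := Real.rpow_nonneg hu (2 * H * K)
  linarith

include hθ

omit hθ hG hH hK [IsProbabilityMeasure P] in
theorem measurable_uncurry_backIncr (T : ℝ) : Measurable (Function.uncurry (backIncr g T)) := by
  have e : Function.uncurry (backIncr g T) = {z : ℝ × Ω | z.1 ≤ T}.indicator
      fun z => g T z.2 - Function.uncurry g (T - z.1, z.2) := by
    ext z
    simp [Function.uncurry, backIncr, Set.indicator]
  rw [e]
  refine Measurable.indicator ?_ (measurableSet_le measurable_fst measurable_const)
  exact ((hg.measurable T).comp measurable_snd).sub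
    (hg.measurable_uncurry.comp (by fun_prop))

theorem memLp_uncurry_backIncr (T : ℝ) :
    MemLp (Function.uncurry (backIncr g T)) 2 ((expLaw θ).prod P) := by
  have := isProbabilityMeasure_expLaw hθ
  refine memLp_two_prod_of_integrable (measurable_uncurry_backIncr hg T)
    (Eventually.of_forall fun u => memLp_backIncr hG hg T u) ?_
  refine ((integrable_rpow_expLaw hθ (two_mul_mul_pos hH hK).le).const_mul 2).mono' ?_ ?_
  · exact ((measurable_uncurry_backIncr hg T).pow_const
      2).stronglyMeasurable.integral_prod_right.aestronglyMeasurable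
  · filter_upwards [ae_expLaw_pos (θ := θ)] with u hu
    rw [Real.norm_of_nonneg (integral_nonneg fun ω => sq_nonneg _)]
    exact integral_backIncr_sq_le hH hK hG hg hu.le

theorem memLp_uncurry_version : MemLp (Function.uncurry g) 2 ((expLaw θ).prod P) := by
  have := isProbabilityMeasure_expLaw hθ
  refine memLp_two_prod_of_integrable hg.measurable_uncurry
    (Eventually.of_forall fun u => memLp_version hG hg u) ?_
  refine (integrable_rpow_expLaw hθ (two_mul_mul_pos hH hK).le).congr ?_
  filter_upwards [ae_expLaw_pos (θ := θ)] with u hu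
  rw [integral_version_sq hH hK hG hg hu.le]

/-- The centered limit `ζ_∞`, as an average of the version `g`. -/
theorem inHull_zeta : InHull G P (fun ω => ∫ s, g s ω ∂(expLaw θ)) := by
  have := isProbabilityMeasure_expLaw hθ
  exact InHull.integral (memLp_uncurry_version hH hK hθ hG hg)
    (Eventually.of_forall fun s => inHull_version hG hg s)

theorem inHull_noise {T : ℝ} (hT : 0 ≤ T) : InHull G P (fun ω => noise θ (fun s => g s ω) T) := by
  have := isProbabilityMeasure_expLaw hθ
  refine (((inHull_version hG hg T).const_mul (Real.exp (-θ * T))).add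
    (InHull.integral (memLp_uncurry_backIncr hH hK hθ hG hg T)
    (Eventually.of_forall fun s => inHull_backIncr hG hg T s))).congr ?_
  exact Eventually.of_forall fun ω => (noise_eq_add_integral hθ hg hT ω).symm

theorem integral_noise_mul {T : ℝ} (hT : 0 ≤ T) {Y : Ω → ℝ} (hY : MemLp Y 2 P) :
    ∫ ω, noise θ (fun s => g s ω) T * Y ω ∂P = Real.exp (-θ * T) * ∫ ω, g T ω * Y ω ∂P +
      ∫ u, ∫ ω, backIncr g T u ω * Y ω ∂P ∂(expLaw θ) := by
  have := isProbabilityMeasure_expLaw hθ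
  have hm := memLp_uncurry_backIncr hH hK hθ hG hg T
  rw [← integral_integral_mul hm hY, ← integral_const_mul]
  have h := integral_add (((memLp_version hG hg T).integrable_mul hY).const_mul (Real.exp (-θ * T)))
    ((memLp_two_integral hm).integrable_mul hY)
  simp only [Pi.mul_apply] at h
  rw [← h]
  congr 1 with ω
  rw [noise_eq_add_integral hθ hg hT ω]
  ring

theorem aestronglyMeasurable_integral_backIncr_mul (T : ℝ) {Y : Ω → ℝ} (hY : MemLp Y 2 P) :
    AEStronglyMeasurable (fun u => ∫ ω, backIncr g T u ω * Y ω ∂P) (expLaw θ) := by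
  have := isProbabilityMeasure_expLaw hθ
  have hint : Integrable (fun z : ℝ × Ω => backIncr g T z.1 z.2 * Y z.2) ((expLaw θ).prod P) :=
    (memLp_uncurry_backIncr hH hK hθ hG hg T).integrable_mul (hY.comp_snd (expLaw θ))
  exact hint.integral_prod_left.aestronglyMeasurable

omit [IsProbabilityMeasure P] hθ in
theorem abs_integral_backIncr_mul_le {T u M : ℝ} (hu : 0 ≤ u) {Y : Ω → ℝ} (hY : MemLp Y 2 P)
    (hM : √(∫ ω, Y ω ^ 2 ∂P) ≤ M) :
    |∫ ω, backIncr g T u ω * Y ω ∂P| ≤ 2 * M * u ^ (H * K) := by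
  refine (abs_integral_mul_le_sqrt (memLp_backIncr hG hg T u) hY).trans ?_
  rw [mul_right_comm]
  exact mul_le_mul (sqrt_integral_backIncr_sq_le hH hK hG hg hu) hM (Real.sqrt_nonneg _)
    (by positivity)

omit hH hK hG hg [IsProbabilityMeasure P] in
theorem tendsto_exp_neg_mul_rpow (p : ℝ) :
    Tendsto (fun T : ℝ => Real.exp (-θ * T) * T ^ p) atTop (𝓝 0) := by
  simpa [mul_comm] using tendsto_rpow_mul_exp_neg_mul_atTop_nhds_zero p θ hθ

/-- Covariances of the weighted noise converge as soon as those of the increments do. -/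
theorem tendsto_integral_noise_mul {Y : ℝ → Ω → ℝ} {M : ℝ} {l : ℝ → ℝ}
    (hY : ∀ᶠ T in atTop, MemLp (Y T) 2 P ∧ √(∫ ω, Y T ω ^ 2 ∂P) ≤ M)
    (hl : ∀ u, 0 < u → Tendsto (fun T => ∫ ω, backIncr g T u ω * Y T ω ∂P) atTop (𝓝 (l u))) :
    Tendsto (fun T => ∫ ω, noise θ (fun s => g s ω) T * Y T ω ∂P) atTop
      (𝓝 (∫ u, l u ∂(expLaw θ))) := by
  have := isProbabilityMeasure_expLaw hθ
  have hh : 0 < H * K := mul_pos hH.1 hK.1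
  have h1 : Tendsto (fun T => Real.exp (-θ * T) * ∫ ω, g T ω * Y T ω ∂P) atTop (𝓝 0) := by
    have hb := (tendsto_exp_neg_mul_rpow hθ (H * K)).mul_const M
    rw [zero_mul] at hb
    refine squeeze_zero_norm' ?_ hb
    filter_upwards [hY, eventually_ge_atTop 0] with T hT hT0
    rw [norm_mul, Real.norm_of_nonneg (Real.exp_pos _).le, mul_assoc]
    gcongr
    refine (abs_integral_mul_le_sqrt (memLp_version hG hg T) hT.1).trans ?_
    rw [sqrt_integral_version_sq hH hK hG hg hT0]
    gcongr
    exact hT.2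
  have h2 : Tendsto (fun T => ∫ u, ∫ ω, backIncr g T u ω * Y T ω ∂P ∂(expLaw θ)) atTop
      (𝓝 (∫ u, l u ∂(expLaw θ))) := by
    refine tendsto_integral_filter_of_dominated_convergence (fun u => 2 * M * u ^ (H * K)) ?_ ?_
      ((integrable_rpow_expLaw hθ hh.le).const_mul _) ?_
    · filter_upwards [hY] with T hT
      exact aestronglyMeasurable_integral_backIncr_mul hH hK hθ hG hg T hT.1
    · filter_upwards [hY] with T hT
      filter_upwards [ae_expLaw_pos (θ := θ)] with u hu
      exact abs_integral_backIncr_mul_le hH hK hG hg hu.le hT.1 hT.2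
    · filter_upwards [ae_expLaw_pos (θ := θ)] with u hu
      exact hl u hu
  have h := h1.add h2
  rw [zero_add] at h
  refine h.congr' ?_
  filter_upwards [hY, eventually_ge_atTop 0] with T hT hT0
  rw [integral_noise_mul hH hK hθ hG hg hT0 hT.1]

/-- Fubini turns this into an average over s of the covariance with G_s, which vanishes for each
fixed s; Cauchy–Schwarz supplies a majorant independent of T. -/
theorem tendsto_integral_backIncr_mul_zeta {u : ℝ} (hu : 0 ≤ u) :
    Tendsto (fun T => ∫ ω, backIncr g T u ω * (∫ s, g s ω ∂(expLaw θ)) ∂P) atTop (𝓝 0) := by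
  have := isProbabilityMeasure_expLaw hθ
  have hh : 0 < H * K := mul_pos hH.1 hK.1
  have hm := memLp_uncurry_version hH hK hθ hG hg
  have h : Tendsto (fun T => ∫ s, ∫ ω, g s ω * backIncr g T u ω ∂P ∂(expLaw θ)) atTop
      (𝓝 (∫ _, 0 ∂(expLaw θ))) := by
    refine tendsto_integral_filter_of_dominated_convergence
      (fun s => 2 * u ^ (H * K) * s ^ (H * K)) (Eventually.of_forall fun T => ?_)
      (Eventually.of_forall fun T => ?_) ((integrable_rpow_expLaw hθ hh.le).const_mul _) ?_
    · have hint : Integrable (fun z : ℝ × Ω => g z.1 z.2 * backIncr g T u z.2)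
          ((expLaw θ).prod P) :=
        hm.integrable_mul ((memLp_backIncr hG hg T u).comp_snd (expLaw θ))
      exact hint.integral_prod_left.aestronglyMeasurable
    · filter_upwards [ae_expLaw_pos (θ := θ)] with s hs
      refine (abs_integral_mul_le_sqrt (memLp_version hG hg s) (memLp_backIncr hG hg T u)).trans ?_
      rw [sqrt_integral_version_sq hH hK hG hg hs.le, mul_comm]
      gcongr
      exact sqrt_integral_backIncr_sq_le hH hK hG hg hu
    · filter_upwards [ae_expLaw_pos (θ := θ)] with s hs
      refine (tendsto_bifCov_sub_shift hH hK (u := u) hs.le).congr' ?_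
      filter_upwards [eventually_ge_atTop u] with T hT
      rw [← integral_backIncr_mul hG hg hu hT hs.le]
      congr 1 with ω
      ring
  rw [integral_zero] at h
  refine h.congr fun T => ?_
  rw [← integral_integral_mul hm (memLp_backIncr hG hg T u)]
  congr 1 with ω
  ring

theorem tendsto_integral_noise_mul_zeta :
    Tendsto (fun T => ∫ ω, noise θ (fun s => g s ω) T * (∫ s, g s ω ∂(expLaw θ)) ∂P) atTop
      (𝓝 0) := by
  have h := tendsto_integral_noise_mul hH hK hθ hG hg (Y := fun _ ω => ∫ s, g s ω ∂(expLaw θ))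
    (l := fun _ => 0) (Eventually.of_forall fun T => ⟨(inHull_zeta hH hK hθ hG hg).1, le_rfl⟩)
    (fun u hu => tendsto_integral_backIncr_mul_zeta hH hK hθ hG hg hu.le)
  simpa using h

theorem tendsto_integral_noise_mul_version :
    Tendsto (fun T => ∫ ω, noise θ (fun s => g s ω) T * ((T ^ (H * K))⁻¹ * g T ω) ∂P) atTop
      (𝓝 0) := by
  have h := tendsto_integral_noise_mul hH hK hθ hG hg
    -- The normalized value has unit L² norm, so M = 1.
    (Y := fun T ω => (T ^ (H * K))⁻¹ * g T ω) (M := 1) (l := fun _ => 0) ?_ ?_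
  · simpa using h
  · filter_upwards [eventually_gt_atTop 0] with T hT
    refine ⟨(memLp_version hG hg T).const_mul _, ?_⟩
    simp only [mul_pow]
    rw [integral_const_mul, Real.sqrt_mul (by positivity), Real.sqrt_sq (by positivity),
      sqrt_integral_version_sq hH hK hG hg hT.le, inv_mul_cancel₀ (by positivity)]
  · intro u hu
    refine (tendsto_bifCov_self_sub_div_rpow hH hK hu.le).congr' ?_
    filter_upwards [eventually_ge_atTop u] with T hT
    rw [← integral_backIncr_mul hG hg hu.le hT (hu.le.trans hT), div_eq_inv_mul,
      ← integral_const_mul]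
    congr 1 with ω
    ring

theorem tendsto_integral_version_mul_zeta :
    Tendsto (fun T => ∫ ω, ((T ^ (H * K))⁻¹ * g T ω) * (∫ s, g s ω ∂(expLaw θ)) ∂P) atTop
      (𝓝 0) := by
  have := isProbabilityMeasure_expLaw hθ
  have hh : 0 < H * K := mul_pos hH.1 hK.1
  have hm := memLp_uncurry_version hH hK hθ hG hg
  have h : Tendsto (fun T => ∫ s, ∫ ω, g s ω * ((T ^ (H * K))⁻¹ * g T ω) ∂P ∂(expLaw θ)) atTop
      (𝓝 (∫ _, 0 ∂(expLaw θ))) := by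
    refine tendsto_integral_filter_of_dominated_convergence
      (fun s => s ^ (H * K)) (Eventually.of_forall fun T => ?_)
      ?_ (integrable_rpow_expLaw hθ hh.le) ?_
    · have hint : Integrable (fun z : ℝ × Ω => g z.1 z.2 * ((T ^ (H * K))⁻¹ * g T z.2))
          ((expLaw θ).prod P) :=
        hm.integrable_mul (((memLp_version hG hg T).const_mul _).comp_snd (expLaw θ))
      exact hint.integral_prod_left.aestronglyMeasurable
    · filter_upwards [eventually_gt_atTop 0] with T hT
      filter_upwards [ae_expLaw_pos (θ := θ)] with s hs
      refine (abs_integral_mul_le_sqrt (memLp_version hG hg s)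
        ((memLp_version hG hg T).const_mul _)).trans (le_of_eq ?_)
      simp only [mul_pow]
      rw [sqrt_integral_version_sq hH hK hG hg hs.le, integral_const_mul,
        Real.sqrt_mul (by positivity), Real.sqrt_sq (by positivity),
        sqrt_integral_version_sq hH hK hG hg hT.le, inv_mul_cancel₀ (by positivity), mul_one]
    · filter_upwards [ae_expLaw_pos (θ := θ)] with s hs
      refine (tendsto_bifCov_div_rpow hH hK hs.le).congr' ?_
      filter_upwards [eventually_ge_atTop 0] with T hT
      rw [← integral_version_mul hG hg hT hs.le, div_eq_inv_mul, ← integral_const_mul]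
      congr 1 with ω
      ring
  rw [integral_zero] at h
  refine h.congr fun T => ?_
  rw [← integral_integral_mul hm ((memLp_version hG hg T).const_mul _)]
  congr 1 with ω
  ring

/-- A uniform L² bound, obtained by pairing the noise with itself. It allows the noise to serve as
the test variable Y in `tendsto_integral_noise_mul`. -/
theorem eventually_sqrt_integral_noise_sq_le : ∃ M, ∀ᶠ T in atTop,
    MemLp (fun ω => noise θ (fun s => g s ω) T) 2 P ∧
      √(∫ ω, noise θ (fun s => g s ω) T ^ 2 ∂P) ≤ M := by
  have := isProbabilityMeasure_expLaw hθ
  have hh : 0 < H * K := mul_pos hH.1 hK.1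
  set M := 1 + ∫ u, 2 * u ^ (H * K) ∂(expLaw θ)
  refine ⟨M, ?_⟩
  filter_upwards [eventually_ge_atTop 0, (tendsto_exp_neg_mul_rpow hθ (H * K)).eventually_le_const
    one_pos] with T hT0 hT1
  have hA := (inHull_noise hH hK hθ hG hg hT0).1
  refine ⟨hA, ?_⟩
  set q := √(∫ ω, noise θ (fun s => g s ω) T ^ 2 ∂P) with hq
  have hq0 : 0 ≤ q := Real.sqrt_nonneg _
  -- `‖A‖² = E[A A] ≤ M ‖A‖`
  have h1 : q * q ≤ M * q := by
    rw [hq, Real.mul_self_sqrt (integral_nonneg fun ω => sq_nonneg _), ← hq]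
    simp_rw [sq]
    rw [integral_noise_mul hH hK hθ hG hg hT0 hA, add_mul, one_mul]
    refine add_le_add ?_ ?_
    · have h2 := (le_abs_self _).trans (abs_integral_mul_le_sqrt (memLp_version hG hg T) hA)
      rw [sqrt_integral_version_sq hH hK hG hg hT0] at h2
      calc _ ≤ Real.exp (-θ * T) * (T ^ (H * K) * q) := by gcongr
        _ = Real.exp (-θ * T) * T ^ (H * K) * q := by ring
        _ ≤ 1 * q := by gcongr
        _ = q := one_mul q
    · rw [← integral_mul_const]
      refine (le_abs_self _).trans ?_
      rw [← Real.norm_eq_abs]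
      refine norm_integral_le_of_norm_le
        (((integrable_rpow_expLaw hθ hh.le).const_mul 2).mul_const q) ?_
      filter_upwards [ae_expLaw_pos (θ := θ)] with u hu
      refine (abs_integral_backIncr_mul_le hH hK hG hg hu.le hA hq.ge).trans (le_of_eq ?_)
      ring
  rcases hq0.eq_or_lt with h | h
  · rw [← h]
    have : 0 ≤ ∫ u, 2 * u ^ (H * K) ∂(expLaw θ) := by
      refine integral_nonneg_of_ae ?_
      filter_upwards [ae_expLaw_pos (θ := θ)] with u hu
      exact mul_nonneg zero_le_two (Real.rpow_nonneg hu.le _)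
    simp only [M]; linarith
  · exact le_of_mul_le_mul_right h1 h

/-- The variance of the weighted noise converges to `σ²`. -/
theorem tendsto_integral_noise_sq :
    Tendsto (fun T => ∫ ω, noise θ (fun s => g s ω) T ^ 2 ∂P) atTop (𝓝 (sigma H K θ ^ 2)) := by
  obtain ⟨M, hM⟩ := eventually_sqrt_integral_noise_sq_le hH hK hθ hG hg
  rw [← integral_integral_eq_sigma_sq hθ hH hK]
  simp_rw [sq]
  -- The covariance lemma is used twice: with the noise itself as test variable, then with a single
  -- backward increment, which produces the double integral.
  refine tendsto_integral_noise_mul hH hK hθ hG hg hM fun u hu => ?_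
  have h := tendsto_integral_noise_mul hH hK hθ hG hg (Y := fun T ω => backIncr g T u ω)
    (M := 2 * u ^ (H * K)) (l := fun v => 1 / 2 ^ K * (v ^ (2 * H * K) + u ^ (2 * H * K) -
      |v - u| ^ (2 * H * K))) (Eventually.of_forall fun T => ⟨memLp_backIncr hG hg T u,
      sqrt_integral_backIncr_sq_le hH hK hG hg hu.le⟩) fun v hv => ?_
  · have e : ∫ v, 1 / 2 ^ K * (v ^ (2 * H * K) + u ^ (2 * H * K) - |v - u| ^ (2 * H * K))
        ∂(expLaw θ) = ∫ v, 1 / 2 ^ K * (u ^ (2 * H * K) + v ^ (2 * H * K) -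
          |u - v| ^ (2 * H * K)) ∂(expLaw θ) := by
      congr 1 with v
      rw [abs_sub_comm, add_comm (v ^ _)]
    rw [← e]
    refine h.congr fun T => ?_
    congr 1 with ω
    ring
  · refine (tendsto_bifCov_second_difference hH hK hv.le hu.le).congr' ?_
    filter_upwards [eventually_ge_atTop u, eventually_ge_atTop v] with T hTu hTv
    rw [integral_backIncr_mul_backIncr hG hg hv.le hTv hTu]

/-- The covariance of ζ_∞ with G_1 is an average of strictly positive covariances, so by
Cauchy–Schwarz ζ_∞ cannot vanish in L². -/
theorem integral_zeta_sq_pos : 0 < ∫ ω, (∫ s, g s ω ∂(expLaw θ)) ^ 2 ∂P := by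
  have := isProbabilityMeasure_expLaw hθ
  have hm := memLp_uncurry_version hH hK hθ hG hg
  have hint : Integrable (fun z : ℝ × Ω => g z.1 z.2 * g 1 z.2) ((expLaw θ).prod P) :=
    hm.integrable_mul ((memLp_version hG hg 1).comp_snd (expLaw θ))
  have h1 : 0 < ∫ s, ∫ ω, g s ω * g 1 ω ∂P ∂(expLaw θ) := by
    have hpos : ∀ᵐ s ∂(expLaw θ), 0 < ∫ ω, g s ω * g 1 ω ∂P := by
      filter_upwards [ae_expLaw_pos (θ := θ)] with s hs
      rw [integral_version_mul hG hg hs.le zero_le_one]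
      exact bifCov_pos hH hK hs one_pos
    have hnn := hpos.mono fun s hs => hs.le
    refine (integral_nonneg_of_ae hnn).lt_of_ne' fun h0 => ?_
    rw [integral_eq_zero_iff_of_nonneg_ae hnn hint.integral_prod_left] at h0
    obtain ⟨s, h1, h2⟩ := (h0.and hpos).exists
    exact h2.ne' h1
  have h2 := abs_integral_mul_le_sqrt (inHull_zeta hH hK hθ hG hg).1 (memLp_version hG hg 1)
  rw [integral_integral_mul hm (memLp_version hG hg 1),
    sqrt_integral_version_sq hH hK hG hg zero_le_one, Real.one_rpow, mul_one] at h2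
  exact Real.sqrt_pos.1 (h1.trans_le ((le_abs_self _).trans h2))

end

end BifractionalVasicek

namespace BifractionalVasicek

/-! ### Pathwise behaviour of the estimators -/

/-- The common denominator of the estimators, divided by `T e^{2θT}`. -/
noncomputable def scaledDet (θ : ℝ) (x : ℝ≥0 → ℝ) (T : ℝ≥0) : ℝ :=
  Real.exp (-θ * T) ^ 2 * integralSqPath x T - (Real.exp (-θ * T) * integralPath x T) ^ 2 / T

/-- The energy of the driving noise. -/
noncomputable def energy (θ μ : ℝ) (x : ℝ≥0 → ℝ) (T : ℝ≥0) : ℝ :=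
  1 / 2 * x T ^ 2 - θ * integralSqPath x T - θ * μ * integralPath x T

/-- The part of the scaled energy which is not explained by the weighted noise. -/
noncomputable def energyRem (θ μ : ℝ) (g : ℝ → ℝ) (x : ℝ≥0 → ℝ) (T : ℝ≥0) : ℝ :=
  Real.exp (-θ * T) * energy θ μ x T - drift θ μ g T * noise θ g T

/-- The coefficients in the representation of the scaled errors of the estimators through the
weighted noise and the scaled driving path. -/
noncomputable def errVec (θ μ h : ℝ) (g : ℝ → ℝ) (x : ℝ≥0 → ℝ) (T : ℝ≥0) : ℝ × ℝ × ℝ × ℝ × ℝ :=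
  (driftLim θ μ g * drift θ μ g T / (2 * θ * scaledDet θ x T),
    (energyRem θ μ g x T - g T / T * (Real.exp (-θ * T) * integralPath x T)) / scaledDet θ x T,
    Real.exp (-θ * T) ^ 2 * integralSqPath x T / scaledDet θ x T,
    (T : ℝ) ^ (-h) * (drift θ μ g T * (Real.exp (-θ * T) * integralPath x T) / scaledDet θ x T),
    -((T : ℝ) ^ (-h) * (energyRem θ μ g x T * (Real.exp (-θ * T) * integralPath x T) /
      scaledDet θ x T)))

section

variable {θ μ h : ℝ} {γ x : ℝ≥0 → ℝ} {g : ℝ → ℝ} (hθ : 0 < θ) (hgc : Continuous g)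
  (hgγ : ∀ s, g s = γ s.toNNReal) (hx : IsVasicekPath θ μ γ x)
  (hg : Tendsto (fun t => g t / t) atTop (𝓝 0))

include hgγ in
theorem eq_integral_add_of_isVasicekPath (hx : IsVasicekPath θ μ γ x) {t : ℝ} (ht : 0 ≤ t) :
    x t.toNNReal = (∫ s in (0 : ℝ)..t, θ * (μ + x s.toNNReal)) + g t := by
  rw [hx.2.2, hgγ, Real.coe_toNNReal t ht]

theorem continuous_comp_toNNReal_of_isVasicekPath (hx : IsVasicekPath θ μ γ x) :
    Continuous fun s : ℝ => x s.toNNReal := hx.1.comp continuous_real_toNNReal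

include hgγ hx in
theorem mul_integralPath (T : ℝ≥0) : θ * integralPath x T = x T - θ * μ * T - g T := by
  have h := mul_integral_vasicek (continuous_comp_toNNReal_of_isVasicekPath hx)
    (fun t ht => eq_integral_add_of_isVasicekPath hgγ hx ht) T.2
  simpa [integralPath] using h

include hgγ hx in
-- Cramer's rule for the errors: the true parameters solve the estimating system up to the
-- right-hand sides g T and the energy.
theorem thetaEst_sub {T : ℝ≥0} (hD : T * integralSqPath x T - integralPath x T ^ 2 ≠ 0) :
    thetaEst x T - θ = (T * energy θ μ x T - g T * integralPath x T) /
      (T * integralSqPath x T - integralPath x T ^ 2) := by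
  have h := mul_integralPath hgγ hx T
  rw [thetaEst, eq_div_iff hD, sub_mul, div_mul_cancel₀ _ hD, energy]
  linear_combination (integralPath x T) * h

include hgγ hx in
theorem alphaEst_sub {T : ℝ≥0} (hD : T * integralSqPath x T - integralPath x T ^ 2 ≠ 0) :
    alphaEst x T - θ * μ = (g T * integralSqPath x T - energy θ μ x T * integralPath x T) /
      (T * integralSqPath x T - integralPath x T ^ 2) := by
  have h := mul_integralPath hgγ hx T
  rw [alphaEst, eq_div_iff hD, sub_mul, div_mul_cancel₀ _ hD, energy]
  linear_combination (-integralSqPath x T) * h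

/-- The determinant and a factor x T cancel, which is why both must be non-zero. -/
theorem muEst_eq_div {T : ℝ≥0} (hD : T * integralSqPath x T - integralPath x T ^ 2 ≠ 0)
    (hx0 : x T ≠ 0) : muEst x T = alphaEst x T / thetaEst x T := by
  rw [muEst, alphaEst, thetaEst, div_div_div_cancel_right₀ hD]
  have e1 : x T * integralSqPath x T - 1 / 2 * x T ^ 2 * integralPath x T =
    x T * (integralSqPath x T - 1 / 2 * x T * integralPath x T) := by ring
  have e2 : 1 / 2 * T * x T ^ 2 - x T * integralPath x T =
    x T * (1 / 2 * T * x T - integralPath x T) := by ring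
  rw [e1, e2, mul_div_mul_left _ _ hx0]

theorem det_eq_mul_scaledDet {T : ℝ≥0} (hT : T ≠ 0) :
    T * integralSqPath x T - integralPath x T ^ 2 =
      T * Real.exp (θ * T) ^ 2 * scaledDet θ x T := by
  have hT' : (T : ℝ) ≠ 0 := by simpa using hT
  have h2 : Real.exp (-θ * T) = (Real.exp (θ * T))⁻¹ := by rw [← Real.exp_neg]; ring_nf
  rw [scaledDet, h2]
  field_simp [(Real.exp_pos (θ * T)).ne']

include hθ hgc hgγ hx hg

theorem tendsto_scaledInt : Tendsto (fun T : ℝ≥0 => Real.exp (-θ * T) * integralPath x T) atTop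
    (𝓝 (driftLim θ μ g / θ)) :=
  (tendsto_exp_mul_integral_vasicek hgc (continuous_comp_toNNReal_of_isVasicekPath hx)
    (fun _ ht => eq_integral_add_of_isVasicekPath hgγ hx ht) hθ hg).comp
    (NNReal.tendsto_coe_atTop.2 tendsto_id)

theorem tendsto_scaledSq : Tendsto (fun T : ℝ≥0 => Real.exp (-θ * T) ^ 2 * integralSqPath x T)
    atTop (𝓝 (driftLim θ μ g ^ 2 / (2 * θ))) :=
  (tendsto_exp_mul_integral_sq_vasicek hgc (continuous_comp_toNNReal_of_isVasicekPath hx)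
    (fun _ ht => eq_integral_add_of_isVasicekPath hgγ hx ht) hθ hg).comp
    (NNReal.tendsto_coe_atTop.2 tendsto_id)

theorem tendsto_scaledDet : Tendsto (scaledDet θ x) atTop (𝓝 (driftLim θ μ g ^ 2 / (2 * θ))) := by
  have h := (tendsto_scaledSq hθ hgc hgγ hx hg).sub
    (((tendsto_scaledInt hθ hgc hgγ hx hg).pow 2).div_atTop
      (NNReal.tendsto_coe_atTop.2 tendsto_id))
  rw [sub_zero] at h
  exact h

theorem tendsto_energyRem : Tendsto (energyRem θ μ g x) atTop (𝓝 0) := by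
  have h := (tendsto_energy_sub_drift_mul_noise hgc
    (continuous_comp_toNNReal_of_isVasicekPath hx)
    (fun _ ht => eq_integral_add_of_isVasicekPath hgγ hx ht) hθ hg).comp
    (NNReal.tendsto_coe_atTop.2 tendsto_id)
  refine h.congr fun T => ?_
  simp [energyRem, energy, integralPath, integralSqPath]

variable (hz : driftLim θ μ g ≠ 0)
include hz

theorem eventually_scaledDet_ne_zero : ∀ᶠ T in atTop, scaledDet θ x T ≠ 0 :=
  (tendsto_scaledDet hθ hgc hgγ hx hg).eventually_ne (by positivity)

theorem eventually_det_ne_zero :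
    ∀ᶠ T in atTop, T * integralSqPath x T - integralPath x T ^ 2 ≠ 0 := by
  filter_upwards [eventually_scaledDet_ne_zero hθ hgc hgγ hx hg hz, eventually_gt_atTop 0]
    with T h1 hT
  rw [det_eq_mul_scaledDet (θ := θ) hT.ne']
  have : (T : ℝ) ≠ 0 := by simpa using hT.ne'
  positivity

theorem eventually_ne_zero_of_isVasicekPath : ∀ᶠ T in atTop, x T ≠ 0 := by
  have h := ((tendsto_exp_mul_vasicek hgc (continuous_comp_toNNReal_of_isVasicekPath hx)
    (fun _ ht => eq_integral_add_of_isVasicekPath hgγ hx ht) hθ hg).comp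
    (NNReal.tendsto_coe_atTop.2 tendsto_id)).eventually_ne hz
  filter_upwards [h] with T hT h0
  simp [h0] at hT

theorem tendsto_errVec (hh : 0 < h) :
    Tendsto (errVec θ μ h g x) atTop (𝓝 (1, 0, 1, 0, 0)) := by
  have hcoe : Tendsto (fun T : ℝ≥0 => (T : ℝ)) atTop atTop := NNReal.tendsto_coe_atTop.2 tendsto_id
  have hd := (tendsto_drift hθ hgc hg μ).comp hcoe
  have hI := tendsto_scaledInt hθ hgc hgγ hx hg
  have hS := tendsto_scaledSq hθ hgc hgγ hx hg
  have hD := tendsto_scaledDet hθ hgc hgγ hx hg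
  have hE := tendsto_energyRem hθ hgc hgγ hx hg
  have hgT := hg.comp hcoe
  have hh' := (tendsto_rpow_neg_atTop hh).comp hcoe
  have hD0 : driftLim θ μ g ^ 2 / (2 * θ) ≠ 0 := by positivity
  refine Tendsto.prodMk_nhds ?_ (Tendsto.prodMk_nhds ?_ (Tendsto.prodMk_nhds ?_
    (Tendsto.prodMk_nhds ?_ ?_)))
  · have h := (hd.const_mul (driftLim θ μ g)).div (hD.const_mul (2 * θ)) (by positivity)
    exact h.mono_right (congrArg 𝓝 (by field_simp)).le
  · have h := (hE.sub (hgT.mul hI)).div hD hD0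
    exact h.mono_right (congrArg 𝓝 (by simp)).le
  · have h := hS.div hD hD0
    exact h.mono_right (congrArg 𝓝 (by field_simp)).le
  · have h := hh'.mul ((hd.mul hI).div hD hD0)
    exact h.mono_right (congrArg 𝓝 (by simp)).le
  · have h := (hh'.mul ((hE.mul hI).div hD hD0)).neg
    exact h.mono_right (congrArg 𝓝 (by simp)).le

theorem eventually_exp_mul_thetaEst_sub (h : ℝ) : ∀ᶠ T : ℝ≥0 in atTop,
    Real.exp (θ * T) * (thetaEst x T - θ) =
      2 * θ * (driftLim θ μ g)⁻¹ * noise θ g T * (errVec θ μ h g x T).1 +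
        (errVec θ μ h g x T).2.1 := by
  filter_upwards [eventually_scaledDet_ne_zero hθ hgc hgγ hx hg hz, eventually_gt_atTop 0,
    eventually_det_ne_zero hθ hgc hgγ hx hg hz] with T h1 hT h2
  have hT' : (T : ℝ) ≠ 0 := by simpa using hT.ne'
  have h3 : Real.exp (-θ * T) = (Real.exp (θ * T))⁻¹ := by rw [← Real.exp_neg]; ring_nf
  rw [thetaEst_sub hgγ hx h2, det_eq_mul_scaledDet (θ := θ) hT.ne', errVec, energyRem, h3]
  field_simp [(Real.exp_pos (θ * T)).ne']
  ring

theorem eventually_rpow_mul_alphaEst_sub (h : ℝ) : ∀ᶠ T : ℝ≥0 in atTop,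
    (T : ℝ) ^ (1 - h) * (alphaEst x T - θ * μ) =
      ((T : ℝ) ^ h)⁻¹ * g T * (errVec θ μ h g x T).2.2.1 -
        (errVec θ μ h g x T).2.2.2.1 * noise θ g T + (errVec θ μ h g x T).2.2.2.2 := by
  filter_upwards [eventually_scaledDet_ne_zero hθ hgc hgγ hx hg hz, eventually_gt_atTop 0,
    eventually_det_ne_zero hθ hgc hgγ hx hg hz] with T h1 hT h2
  have hT0 : (0 : ℝ) < T := by simpa using hT
  have h3 : Real.exp (-θ * T) = (Real.exp (θ * T))⁻¹ := by rw [← Real.exp_neg]; ring_nf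
  rw [alphaEst_sub hgγ hx h2, det_eq_mul_scaledDet (θ := θ) hT.ne', errVec, energyRem, h3,
    Real.rpow_sub hT0, Real.rpow_one, Real.rpow_neg hT0.le]
  have hTh := (Real.rpow_pos_of_pos hT0 h).ne'
  field_simp [(Real.exp_pos (θ * T)).ne']
  ring

/-- The error is e^{-θT} times a quantity of size o(T), so it beats every power of T. This is why
the error in θ does not affect the limit law of the estimator of μ. -/
theorem tendsto_rpow_mul_thetaEst_sub (p : ℝ) :
    Tendsto (fun T : ℝ≥0 => (T : ℝ) ^ p * (thetaEst x T - θ)) atTop (𝓝 0) := by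
  have hcoe : Tendsto (fun T : ℝ≥0 => (T : ℝ)) atTop atTop := NNReal.tendsto_coe_atTop.2 tendsto_id
  have he := tendsto_errVec hθ hgc hgγ hx hg hz one_pos
  have h1 := (continuous_fst.tendsto _).comp he
  have h2 := ((continuous_fst.comp continuous_snd).tendsto _).comp he
  have hA := (tendsto_noise_div hθ hgc hg).comp hcoe
  have e1 := (tendsto_exp_neg_mul_rpow hθ (p + 1)).comp hcoe
  have e2 := (tendsto_exp_neg_mul_rpow hθ p).comp hcoe
  have key := ((e1.mul hA).mul (h1.const_mul (2 * θ * (driftLim θ μ g)⁻¹))).add (e2.mul h2)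
  simp only [mul_zero, zero_mul, add_zero] at key
  refine key.congr' ?_
  filter_upwards [eventually_exp_mul_thetaEst_sub hθ hgc hgγ hx hg hz 1, eventually_gt_atTop 0]
    with T hT hT0
  have hT0' : (0 : ℝ) < T := by simpa using hT0
  have h3 : Real.exp (-θ * T) * Real.exp (θ * T) = 1 := by rw [← Real.exp_add]; simp
  have h4 : (T : ℝ) ^ p * (thetaEst x T - θ) =
      Real.exp (-θ * T) * (T : ℝ) ^ p * (Real.exp (θ * T) * (thetaEst x T - θ)) := by
    linear_combination (-(T : ℝ) ^ p * (thetaEst x T - θ)) * h3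
  rw [h4, hT]
  simp only [Function.comp_apply, Real.rpow_add hT0', Real.rpow_one]
  field_simp

theorem tendsto_thetaEst : Tendsto (thetaEst x) atTop (𝓝 θ) := by
  have h := (tendsto_rpow_mul_thetaEst_sub hθ hgc hgγ hx hg hz 0).add_const θ
  simpa using h

/-- After scaling, both terms of the error carry a factor 1/T, and g_T/T, A_T/T and the scaled
energy remainder all vanish. -/
theorem tendsto_alphaEst : Tendsto (alphaEst x) atTop (𝓝 (θ * μ)) := by
  have hcoe : Tendsto (fun T : ℝ≥0 => (T : ℝ)) atTop atTop := NNReal.tendsto_coe_atTop.2 tendsto_id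
  have hI := tendsto_scaledInt hθ hgc hgγ hx hg
  have hS := tendsto_scaledSq hθ hgc hgγ hx hg
  have hD := tendsto_scaledDet hθ hgc hgγ hx hg
  have hE := tendsto_energyRem hθ hgc hgγ hx hg
  have hgT := hg.comp hcoe
  have hd := (tendsto_drift hθ hgc hg μ).comp hcoe
  have hA := (tendsto_noise_div hθ hgc hg).comp hcoe
  have hinv : Tendsto (fun T : ℝ≥0 => (T : ℝ)⁻¹) atTop (𝓝 0) := tendsto_inv_atTop_zero.comp hcoe
  have key := (((hgT.mul hS).sub ((hd.mul hA).mul hI)).sub ((hE.mul hinv).mul hI)).div hD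
    (by positivity)
  have key := key.add_const (θ * μ)
  simp only [mul_zero, zero_mul, sub_zero, zero_div, zero_add] at key
  refine key.congr' ?_
  filter_upwards [eventually_scaledDet_ne_zero hθ hgc hgγ hx hg hz, eventually_gt_atTop 0,
    eventually_det_ne_zero hθ hgc hgγ hx hg hz] with T h1 hT h2
  have hT' : (T : ℝ) ≠ 0 := by simpa using hT.ne'
  have h3 : Real.exp (-θ * T) = (Real.exp (θ * T))⁻¹ := by rw [← Real.exp_neg]; ring_nf
  symm
  rw [← sub_eq_iff_eq_add, alphaEst_sub hgγ hx h2, det_eq_mul_scaledDet (θ := θ) hT.ne']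
  simp only [Pi.div_apply, Function.comp_apply, energyRem, h3]
  field_simp [(Real.exp_pos (θ * T)).ne']
  ring

theorem tendsto_muEst : Tendsto (muEst x) atTop (𝓝 μ) := by
  have h := (tendsto_alphaEst hθ hgc hgγ hx hg hz).div (tendsto_thetaEst hθ hgc hgγ hx hg hz) hθ.ne'
  rw [mul_div_cancel_left₀ _ hθ.ne'] at h
  refine h.congr' ?_
  filter_upwards [eventually_ne_zero_of_isVasicekPath hθ hgc hgγ hx hg hz,
    eventually_det_ne_zero hθ hgc hgγ hx hg hz] with T h1 h2
  rw [muEst_eq_div h2 h1, Pi.div_apply]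

/-- Linearizes the quotient exactly: its error is the error in α minus μ times the error in θ,
divided by the estimator of θ. -/
theorem eventually_rpow_mul_muEst_sub (p : ℝ) : ∀ᶠ T : ℝ≥0 in atTop,
    (T : ℝ) ^ p * (muEst x T - μ) =
      (thetaEst x T)⁻¹ * ((T : ℝ) ^ p * (alphaEst x T - θ * μ)) +
        -(μ * (thetaEst x T)⁻¹ * ((T : ℝ) ^ p * (thetaEst x T - θ))) := by
  filter_upwards [eventually_ne_zero_of_isVasicekPath hθ hgc hgγ hx hg hz,
    eventually_det_ne_zero hθ hgc hgγ hx hg hz,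
    (tendsto_thetaEst hθ hgc hgγ hx hg hz).eventually_ne hθ.ne'] with T h1 h2 h3
  rw [muEst_eq_div h2 h1]
  field_simp
  ring

end

end BifractionalVasicek

namespace BifractionalVasicek

/-! ### Convergence in distribution -/

section

variable {Ω ι E F : Type*} [MeasurableSpace Ω] {P : Measure Ω} [IsProbabilityMeasure P]
  {l : Filter ι}

/-- Adding an independent component preserves convergence in distribution. -/
theorem tendstoInDistribution_prodMk_of_indepFun
    [TopologicalSpace E] [MeasurableSpace E] [BorelSpace E] [SecondCountableTopology E]
    [TopologicalSpace.PseudoMetrizableSpace E]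
    [TopologicalSpace F] [MeasurableSpace F] [BorelSpace F] [SecondCountableTopology F]
    [TopologicalSpace.PseudoMetrizableSpace F]
    {W : Ω → E} {Y : ι → Ω → F} {V : Ω → F} (hW : AEMeasurable W P)
    (hY : ∀ i, IndepFun W (Y i) P) (hV : IndepFun W V P)
    (h : TendstoInDistribution Y l V (fun _ => P) P) :
    TendstoInDistribution (fun i ω => (W ω, Y i ω)) l (fun ω => (W ω, V ω)) (fun _ => P) P where
  forall_aemeasurable i := hW.prodMk (h.forall_aemeasurable i)
  aemeasurable_limit := hW.prodMk h.aemeasurable_limit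
  tendsto := by
    let w : ProbabilityMeasure E := ⟨P.map W, Measure.isProbabilityMeasure_map hW⟩
    -- By independence the joint laws are product measures, and the product is weakly continuous.
    have key := (ProbabilityMeasure.continuous_prod (α := E) (β := F)).continuousAt.tendsto.comp
      (tendsto_const_nhds (x := w).prodMk_nhds h.tendsto)
    have e1 : ∀ i, w.prod ⟨P.map (Y i), Measure.isProbabilityMeasure_map (h.forall_aemeasurable i)⟩ =
        (⟨P.map fun ω => (W ω, Y i ω), Measure.isProbabilityMeasure_map
          (hW.prodMk (h.forall_aemeasurable i))⟩ : ProbabilityMeasure (E × F)) := fun i =>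
      Subtype.ext
        ((indepFun_iff_map_prod_eq_prod_map_map hW (h.forall_aemeasurable i)).1 (hY i)).symm
    have e2 : w.prod ⟨P.map V, Measure.isProbabilityMeasure_map h.aemeasurable_limit⟩ =
        (⟨P.map fun ω => (W ω, V ω), Measure.isProbabilityMeasure_map
          (hW.prodMk h.aemeasurable_limit)⟩ : ProbabilityMeasure (E × F)) :=
      Subtype.ext ((indepFun_iff_map_prod_eq_prod_map_map hW h.aemeasurable_limit).1 hV).symm
    exact (key.congr e1).mono_right (congrArg 𝓝 e2).le

/-- For a continuous time parameter the claim is checked along sequences, which suffices for a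
countably generated filter. -/
theorem tendstoInMeasure_of_ae_tendsto [l.IsCountablyGenerated] [PseudoEMetricSpace E]
    {Y : ι → Ω → E} {c : E} (hY : ∀ i, AEStronglyMeasurable (Y i) P)
    (h : ∀ᵐ ω ∂P, Tendsto (fun i => Y i ω) l (𝓝 c)) : TendstoInMeasure P Y l fun _ => c := by
  intro ε hε
  refine tendsto_of_seq_tendsto fun u hu => ?_
  exact tendstoInMeasure_of_tendsto_ae (fun n => hY (u n)) (h.mono fun ω hω => hω.comp hu) ε hε

end

section

variable {Ω ι : Type*} [MeasurableSpace Ω] {P : Measure Ω} [IsProbabilityMeasure P]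
  {κ : Type*} {G : κ → Ω → ℝ} (hG : IsGaussianProcess G P) (hG0 : ∀ t, ∫ ω, G t ω ∂P = 0)

include hG hG0

omit [IsProbabilityMeasure P] hG hG0 in
theorem integrable_mul_of_memLp_two {A B : Ω → ℝ} (hA : MemLp A 2 P) (hB : MemLp B 2 P) :
    Integrable (fun ω => A ω * B ω) P := hA.integrable_mul hB

/-- In a Gaussian Hilbert space, orthogonality is independence. -/
theorem InHull.indepFun_prodMk {A B Z : Ω → ℝ} (hA : InHull G P A) (hB : InHull G P B)
    (hZ : InHull G P Z) (hAZ : ∫ ω, A ω * Z ω ∂P = 0) (hBZ : ∫ ω, B ω * Z ω ∂P = 0) :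
    IndepFun Z (fun ω => (A ω, B ω)) P := by
  have hL : ∀ (L : ℝ × ℝ →L[ℝ] ℝ) ω, L (A ω, B ω) = L (1, 0) * A ω + L (0, 1) * B ω := by
    intro L ω
    have : (A ω, B ω) = A ω • ((1 : ℝ), (0 : ℝ)) + B ω • ((0 : ℝ), (1 : ℝ)) := by simp
    rw [this, map_add, map_smul, map_smul, smul_eq_mul, smul_eq_mul]
    ring
  have hAB : ∀ L : ℝ × ℝ →L[ℝ] ℝ, InHull G P (fun ω => L (A ω, B ω)) := fun L => by
    simp only [hL]
    exact (hA.const_mul _).add (hB.const_mul _)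
  have hZ' : ∀ L : ℝ →L[ℝ] ℝ, InHull G P (fun ω => L (Z ω)) := fun L => by
    have : ∀ ω, L (Z ω) = L 1 * Z ω := fun ω => by
      rw [← mul_one (Z ω), ← smul_eq_mul, map_smul, smul_eq_mul, smul_eq_mul]; ring
    simp only [this]
    exact hZ.const_mul _
  have hlaw : HasGaussianLaw (fun ω => (Z ω, (A ω, B ω))) P := by
    refine hasGaussianLaw_of_forall_inHull hG hG0
      (hZ.1.aestronglyMeasurable.aemeasurable.prodMk
        (hA.1.aestronglyMeasurable.aemeasurable.prodMk hB.1.aestronglyMeasurable.aemeasurable))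
      fun L => ?_
    have : ∀ ω, L (Z ω, (A ω, B ω)) = (L.comp (.inl ℝ ℝ (ℝ × ℝ))) (Z ω) +
        (L.comp (.inr ℝ ℝ (ℝ × ℝ))) (A ω, B ω) := fun ω => by
      simp [← map_add]
    simp only [this]
    exact (hZ' _).add (hAB _)
  refine hlaw.indepFun_of_covariance_strongDual fun L₁ L₂ => ?_
  have hcov := covariance_eq_sub (X := L₁ ∘ Z) (Y := L₂ ∘ fun ω => (A ω, B ω)) (hZ' L₁).1 (hAB L₂).1
  rw [hcov]
  have h0 : P[L₁ ∘ Z] = 0 := (hZ' L₁).integral_eq_zero hG0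
  rw [h0, zero_mul, sub_zero]
  have hz : ∀ ω, L₁ (Z ω) = L₁ 1 * Z ω := fun ω => by
    rw [← mul_one (Z ω), ← smul_eq_mul, map_smul, smul_eq_mul, smul_eq_mul]; ring
  have : ∀ ω, (L₁ ∘ Z * L₂ ∘ fun ω => (A ω, B ω)) ω =
      L₁ 1 * L₂ (1, 0) * (A ω * Z ω) + L₁ 1 * L₂ (0, 1) * (B ω * Z ω) := fun ω => by
    simp only [Pi.mul_apply, Function.comp_apply, hL, hz]; ring
  simp only [this]
  rw [integral_add ((integrable_mul_of_memLp_two hA.1 hZ.1).const_mul _)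
    ((integrable_mul_of_memLp_two hB.1 hZ.1).const_mul _), integral_const_mul, integral_const_mul,
    hAZ, hBZ]
  simp

theorem InHull.integral_cexp {Y : Ω → ℝ} (hY : InHull G P Y) :
    ∫ ω, Complex.exp (Y ω * Complex.I) ∂P = Complex.exp (-(∫ ω, Y ω ^ 2 ∂P : ℝ) / 2) := by
  have h := charFun_gaussianReal (μ := 0) (v := (∫ ω, Y ω ^ 2 ∂P).toNNReal) 1
  rw [← hY.map_eq_gaussianReal hG hG0, charFun_apply_real,
    integral_map hY.1.aestronglyMeasurable.aemeasurable (by fun_prop)] at h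
  have hn : 0 ≤ ∫ ω, Y ω ^ 2 ∂P := integral_nonneg fun ω => sq_nonneg _
  rw [Real.coe_toNNReal _ hn] at h
  simpa [neg_div] using h

omit [IsProbabilityMeasure P] hG hG0 in
theorem integral_add_mul_sq {A B : Ω → ℝ} (hA : MemLp A 2 P) (hB : MemLp B 2 P) (s t : ℝ) :
    ∫ ω, (s * A ω + t * B ω) ^ 2 ∂P =
      s ^ 2 * ∫ ω, A ω ^ 2 ∂P + 2 * s * t * ∫ ω, A ω * B ω ∂P + t ^ 2 * ∫ ω, B ω ^ 2 ∂P := by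
  have e : ∀ ω, (s * A ω + t * B ω) ^ 2 =
      s ^ 2 * A ω ^ 2 + 2 * s * t * (A ω * B ω) + t ^ 2 * B ω ^ 2 := fun ω => by ring
  have i1 := hA.integrable_sq.const_mul (s ^ 2)
  have i2 := (integrable_mul_of_memLp_two hA hB).const_mul (2 * s * t)
  have i12 : Integrable (fun ω => s ^ 2 * A ω ^ 2 + 2 * s * t * (A ω * B ω)) P := i1.add i2
  simp only [e]
  rw [integral_add i12 (hB.integrable_sq.const_mul _), integral_add i1 i2, integral_const_mul,
    integral_const_mul, integral_const_mul]

/-- Centered Gaussian pairs with converging covariance matrix, in the uncorrelated case. -/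
theorem tendstoInDistribution_prodMk_of_inHull {l : Filter ι} [l.IsCountablyGenerated]
    {A B : ι → Ω → ℝ} {V₁ V₂ : Ω → ℝ} {v₁ v₂ : ℝ≥0}
    (hA : ∀ i, InHull G P (A i)) (hB : ∀ i, InHull G P (B i))
    (hAA : Tendsto (fun i => ∫ ω, A i ω ^ 2 ∂P) l (𝓝 v₁))
    (hBB : Tendsto (fun i => ∫ ω, B i ω ^ 2 ∂P) l (𝓝 v₂))
    (hAB : Tendsto (fun i => ∫ ω, A i ω * B i ω ∂P) l (𝓝 0))
    (hV₁ : HasLaw V₁ (gaussianReal 0 v₁) P) (hV₂ : HasLaw V₂ (gaussianReal 0 v₂) P)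
    (hV : IndepFun V₁ V₂ P) :
    TendstoInDistribution (fun i ω => (A i ω, B i ω)) l (fun ω => (V₁ ω, V₂ ω))
      (fun _ => P) P := by
  have hAm : ∀ i, AEMeasurable (A i) P := fun i => (hA i).1.aestronglyMeasurable.aemeasurable
  have hBm : ∀ i, AEMeasurable (B i) P := fun i => (hB i).1.aestronglyMeasurable.aemeasurable
  have hm : ∀ i, AEMeasurable (fun ω => WithLp.toLp 2 (A i ω, B i ω)) P := fun i =>
    (WithLp.measurable_toLp 2 _).comp_aemeasurable ((hAm i).prodMk (hBm i))
  have hmV : AEMeasurable (fun ω => WithLp.toLp 2 (V₁ ω, V₂ ω)) P :=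
    (WithLp.measurable_toLp 2 _).comp_aemeasurable (hV₁.aemeasurable.prodMk hV₂.aemeasurable)
  -- The characteristic function uses the inner product, so the pair is carried to the Euclidean
  -- plane; Lévy's theorem is applied there along sequences, and the result is mapped back.
  have key : TendstoInDistribution (fun i ω => WithLp.toLp 2 (A i ω, B i ω)) l
      (fun ω => WithLp.toLp 2 (V₁ ω, V₂ ω)) (fun _ => P) P := by
    refine ⟨hm, hmV, ?_⟩
    refine tendsto_of_seq_tendsto fun u hu => ?_
    refine ProbabilityMeasure.tendsto_iff_tendsto_charFun.2 fun t => ?_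
    have h1 := (indepFun_iff_charFun_prod hV₁.aemeasurable hV₂.aemeasurable).1 hV t
    have h2 : ∀ i, charFun (P.map fun ω => WithLp.toLp 2 (A i ω, B i ω)) t =
        Complex.exp (-(t.fst ^ 2 * (∫ ω, A i ω ^ 2 ∂P) + 2 * t.fst * t.snd *
          (∫ ω, A i ω * B i ω ∂P) + t.snd ^ 2 * (∫ ω, B i ω ^ 2 ∂P) : ℝ) / 2) := by
      intro i
      rw [← integral_add_mul_sq (hA i).1 (hB i).1, ← InHull.integral_cexp hG hG0
        (((hA i).const_mul _).add ((hB i).const_mul _)), charFun_apply,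
        integral_map (hm i) (by fun_prop)]
      congr 1 with ω
    rw [hV₁.map_eq, hV₂.map_eq, charFun_gaussianReal, charFun_gaussianReal, ← Complex.exp_add] at h1
    refine (Tendsto.congr (fun n => (h2 (u n)).symm) ?_).mono_right (congrArg 𝓝 h1.symm).le
    refine (Complex.continuous_exp.tendsto _).comp ?_
    have h3 := ((((hAA.comp hu).const_mul (t.fst ^ 2)).add
      ((hAB.comp hu).const_mul (2 * t.fst * t.snd))).add ((hBB.comp hu).const_mul (t.snd ^ 2)))
    have h4 := ((Complex.continuous_ofReal.tendsto _).comp h3).neg.div_const 2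
    refine h4.mono_right (congrArg 𝓝 ?_).le
    simp
    ring
  exact key.continuous_comp (WithLp.prod_continuous_ofLp 2 ℝ ℝ)

/-- Gaussian pairs which are asymptotically uncorrelated with a fixed element `Z` of the Gaussian
Hilbert space become asymptotically independent of `Z`. -/
theorem tendstoInDistribution_of_asymptotically_uncorrelated {l : Filter ι}
    [l.IsCountablyGenerated] {A B : ι → Ω → ℝ} {Z V₁ V₂ : Ω → ℝ} {v₁ v₂ : ℝ≥0} {w : ℝ → ℝ}
    (hw : Measurable w)
    (hA : ∀ i, InHull G P (A i)) (hB : ∀ i, InHull G P (B i)) (hZ : InHull G P Z)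
    (hZ0 : ∫ ω, Z ω ^ 2 ∂P ≠ 0)
    (hAA : Tendsto (fun i => ∫ ω, A i ω ^ 2 ∂P) l (𝓝 v₁))
    (hBB : Tendsto (fun i => ∫ ω, B i ω ^ 2 ∂P) l (𝓝 v₂))
    (hAB : Tendsto (fun i => ∫ ω, A i ω * B i ω ∂P) l (𝓝 0))
    (hAZ : Tendsto (fun i => ∫ ω, A i ω * Z ω ∂P) l (𝓝 0))
    (hBZ : Tendsto (fun i => ∫ ω, B i ω * Z ω ∂P) l (𝓝 0))
    (hV₁ : HasLaw V₁ (gaussianReal 0 v₁) P) (hV₂ : HasLaw V₂ (gaussianReal 0 v₂) P)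
    (hV : IndepFun V₁ V₂ P) (hVZ : IndepFun Z (fun ω => (V₁ ω, V₂ ω)) P) :
    TendstoInDistribution (fun i ω => (w (Z ω), (A i ω, B i ω))) l
      (fun ω => (w (Z ω), (V₁ ω, V₂ ω))) (fun _ => P) P := by
  set q := ∫ ω, Z ω ^ 2 ∂P with hq
  -- Regression coefficients on Z: the residuals A - aZ and B - bZ are exactly orthogonal to Z,
  -- hence jointly independent of it, and a, b → 0.
  set a : ι → ℝ := fun i => (∫ ω, A i ω * Z ω ∂P) / q
  set b : ι → ℝ := fun i => (∫ ω, B i ω * Z ω ∂P) / q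
  have ha : Tendsto a l (𝓝 0) := by simpa using hAZ.div_const q
  have hb : Tendsto b l (𝓝 0) := by simpa using hBZ.div_const q
  have hZm := hZ.1.aestronglyMeasurable.aemeasurable
  have hA' : ∀ i, InHull G P (fun ω => A i ω - a i * Z ω) := fun i => (hA i).sub (hZ.const_mul _)
  have hB' : ∀ i, InHull G P (fun ω => B i ω - b i * Z ω) := fun i => (hB i).sub (hZ.const_mul _)
  have bil : ∀ {C D : Ω → ℝ}, MemLp C 2 P → MemLp D 2 P → ∀ c d : ℝ,
      ∫ ω, (C ω - c * Z ω) * (D ω - d * Z ω) ∂P = ∫ ω, C ω * D ω ∂P - d * ∫ ω, C ω * Z ω ∂P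
        - c * (∫ ω, D ω * Z ω ∂P) + c * d * q := by
    intro C D hC hD c d
    have e : ∀ ω, (C ω - c * Z ω) * (D ω - d * Z ω) =
      C ω * D ω - d * (C ω * Z ω) - c * (D ω * Z ω) + c * d * Z ω ^ 2 := fun ω => by ring
    have i1 := integrable_mul_of_memLp_two hC hD
    have i2 := (integrable_mul_of_memLp_two hC hZ.1).const_mul d
    have i3 := (integrable_mul_of_memLp_two hD hZ.1).const_mul c
    have i12 : Integrable (fun ω => C ω * D ω - d * (C ω * Z ω)) P := i1.sub i2
    have i123 : Integrable (fun ω => C ω * D ω - d * (C ω * Z ω) - c * (D ω * Z ω)) P :=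
      i12.sub i3
    have i4 := hZ.1.integrable_sq.const_mul (c * d)
    simp only [e]
    rw [integral_add i123 i4, integral_sub i12 i3, integral_sub i1 i2,
      integral_const_mul, integral_const_mul, integral_const_mul]
  have orth : ∀ {C : Ω → ℝ}, MemLp C 2 P →
      ∫ ω, (C ω - (∫ ω, C ω * Z ω ∂P) / q * Z ω) * Z ω ∂P = 0 := by
    intro C hC
    have e : ∀ ω, (C ω - (∫ ω, C ω * Z ω ∂P) / q * Z ω) * Z ω =
      C ω * Z ω - (∫ ω, C ω * Z ω ∂P) / q * Z ω ^ 2 := fun ω => by ring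
    simp only [e]
    rw [integral_sub (integrable_mul_of_memLp_two hC hZ.1) (hZ.1.integrable_sq.const_mul _),
      integral_const_mul, ← hq, div_mul_cancel₀ _ hZ0, sub_self]
  have h1 : TendstoInDistribution (fun i ω => (A i ω - a i * Z ω, B i ω - b i * Z ω)) l
      (fun ω => (V₁ ω, V₂ ω)) (fun _ => P) P := by
    refine tendstoInDistribution_prodMk_of_inHull hG hG0 hA' hB' ?_ ?_ ?_ hV₁ hV₂ hV
    · simp only [sq, bil (hA _).1 (hA _).1]
      have := ((hAA.sub (ha.mul hAZ)).sub (ha.mul hAZ)).add ((ha.mul ha).mul_const q)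
      simpa [sq] using this
    · simp only [sq, bil (hB _).1 (hB _).1]
      have := ((hBB.sub (hb.mul hBZ)).sub (hb.mul hBZ)).add ((hb.mul hb).mul_const q)
      simpa [sq] using this
    · simp only [bil (hA _).1 (hB _).1]
      have := ((hAB.sub (hb.mul hAZ)).sub (ha.mul hBZ)).add ((ha.mul hb).mul_const q)
      simpa using this
  -- Z is carried along with w(Z) so that aZ and bZ can be added back by Slutsky's lemma.
  have h2 : TendstoInDistribution
      (fun i ω => ((w (Z ω), Z ω), (A i ω - a i * Z ω, B i ω - b i * Z ω))) l
      (fun ω => ((w (Z ω), Z ω), (V₁ ω, V₂ ω))) (fun _ => P) P := by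
    have hwZ : Measurable fun z => (w z, z) := hw.prodMk measurable_id
    refine tendstoInDistribution_prodMk_of_indepFun (W := fun ω => (w (Z ω), Z ω))
      (hwZ.comp_aemeasurable hZm) (fun i => ?_) ?_ h1
    · exact (InHull.indepFun_prodMk hG hG0 (hA' i) (hB' i) hZ (orth (hA i).1)
        (orth (hB i).1)).comp hwZ measurable_id
    · exact hVZ.comp hwZ measurable_id
  have h3 := h2.continuous_comp_prodMk_of_tendstoInMeasure_const
    (g := fun x : ((ℝ × ℝ) × (ℝ × ℝ)) × (ℝ × ℝ) =>
      (x.1.1.1, (x.1.2.1 + x.2.1 * x.1.1.2, x.1.2.2 + x.2.2 * x.1.1.2)))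
    (Y := fun i _ => (a i, b i)) (c := (0, 0)) (by fun_prop)
    (tendstoInMeasure_of_ae_tendsto (fun i => aestronglyMeasurable_const)
      (Eventually.of_forall fun ω => ha.prodMk_nhds hb)) (fun i => aemeasurable_const)
  simpa using h3

end

end BifractionalVasicek

namespace BifractionalVasicek

/-! ### Measurability of the observed path -/

section

variable {Ω : Type*} [MeasurableSpace Ω] {P : Measure Ω} {H K θ : ℝ} {G : ℝ≥0 → Ω → ℝ}
  {g : ℝ → Ω → ℝ}

theorem measurable_intervalIntegral {f : ℝ → Ω → ℝ} (hf : Measurable (Function.uncurry f))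
    (a b : ℝ) : Measurable fun ω => ∫ s in a..b, f s ω := by
  simp only [intervalIntegral]
  exact hf.stronglyMeasurable.integral_prod_left.measurable.sub
    hf.stronglyMeasurable.integral_prod_left.measurable

theorem continuous_drift {f : ℝ → ℝ} (hf : Continuous f) (θ μ : ℝ) : Continuous (drift θ μ f) :=
  continuous_const.add (intervalIntegral.continuous_primitive
    (fun a b => Continuous.intervalIntegrable (by fun_prop) a b) 0)

/-- The explicit solution of the Vasicek equation. -/
noncomputable def vasicekSol (θ μ : ℝ) (g : ℝ → ℝ) (T : ℝ≥0) : ℝ :=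
  g T + Real.exp (θ * T) * drift θ μ g T - μ

theorem IsVasicekPath.eq_vasicekSol {μ : ℝ} {f : ℝ → ℝ} {γ x : ℝ≥0 → ℝ} (hf : Continuous f)
    (hfγ : ∀ s, f s = γ s.toNNReal) (hx : IsVasicekPath θ μ γ x) : x = vasicekSol θ μ f := by
  ext T
  have h := vasicek_eq hf (continuous_comp_toNNReal_of_isVasicekPath hx)
    (fun _ ht => eq_integral_add_of_isVasicekPath hfγ hx ht) T.2
  simpa [vasicekSol] using h

theorem noiseConvolution_eq_noise {f : ℝ → ℝ} {γ : ℝ≥0 → ℝ} (hfγ : ∀ s, f s = γ s.toNNReal)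
    (T : ℝ≥0) : noiseConvolution θ γ T = noise θ f T := by
  have h2 : Real.exp (-θ * T) * Real.exp (θ * T) = 1 := by rw [← Real.exp_add]; simp
  simp only [noiseConvolution, noise, hfγ, Real.toNNReal_coe]
  linear_combination γ T * h2

theorem zetaInf_eq_integral_expLaw (hθ : 0 < θ) {f : ℝ → ℝ} {γ : ℝ≥0 → ℝ}
    (hfγ : ∀ s, f s = γ s.toNNReal) : zetaInf θ γ = ∫ s, f s ∂(expLaw θ) := by
  have h := driftLim_eq_add_integral hθ 0 f
  simpa only [driftLim, hfγ, zero_add, zetaInf] using h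

namespace IsContinuousVersion

variable (hg : IsContinuousVersion G g P)
include hg

theorem measurable_drift (μ t : ℝ) : Measurable fun ω => drift θ μ (fun s => g s ω) t :=
  (measurable_intervalIntegral (f := fun s ω => θ * Real.exp (-θ * s) * g s ω)
    ((by fun_prop : Measurable fun z : ℝ × Ω => θ * Real.exp (-θ * z.1)).mul
      hg.measurable_uncurry) 0 t).const_add μ

theorem measurable_noise (t : ℝ) : Measurable fun ω => noise θ (fun s => g s ω) t :=
  (hg.measurable t).sub ((measurable_intervalIntegral
    (f := fun s ω => θ * Real.exp (θ * s) * g s ω)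
    ((by fun_prop : Measurable fun z : ℝ × Ω => θ * Real.exp (θ * z.1)).mul
      hg.measurable_uncurry) 0 t).const_mul _)

theorem measurable_driftLim (μ : ℝ) : Measurable fun ω => driftLim θ μ fun s => g s ω := by
  have h : Measurable (Function.uncurry fun s ω => Real.exp (-θ * s) * g s ω) :=
    (by fun_prop : Measurable fun z : ℝ × Ω => Real.exp (-θ * z.1)).mul hg.measurable_uncurry
  exact (h.stronglyMeasurable.integral_prod_left.measurable.const_mul θ).const_add μ

theorem measurable_vasicekSol (μ : ℝ) (T : ℝ≥0) :
    Measurable fun ω => vasicekSol θ μ (fun s => g s ω) T :=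
  ((hg.measurable T).add ((hg.measurable_drift μ T).const_mul _)).sub_const μ

theorem measurable_uncurry_vasicekSol (μ : ℝ) :
    Measurable (Function.uncurry fun (s : ℝ) ω =>
      vasicekSol θ μ (fun s => g s ω) s.toNNReal) := by
  refine measurable_uncurry_of_continuous_of_measurable (fun ω => ?_)
    (fun s => hg.measurable_vasicekSol μ _)
  have h1 := hg.continuous ω
  have h2 := continuous_drift h1 θ μ
  have h3 : Continuous fun s : ℝ => (s.toNNReal : ℝ) :=
    NNReal.continuous_coe.comp continuous_real_toNNReal
  unfold vasicekSol
  fun_prop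

theorem measurable_integralPath (μ : ℝ) (T : ℝ≥0) :
    Measurable fun ω => integralPath (vasicekSol θ μ fun s => g s ω) T :=
  measurable_intervalIntegral (hg.measurable_uncurry_vasicekSol μ) 0 T

theorem measurable_integralSqPath (μ : ℝ) (T : ℝ≥0) :
    Measurable fun ω => integralSqPath (vasicekSol θ μ fun s => g s ω) T :=
  measurable_intervalIntegral ((hg.measurable_uncurry_vasicekSol μ).pow_const 2) 0 T

theorem measurable_thetaEst (μ : ℝ) (T : ℝ≥0) :
    Measurable fun ω => thetaEst (vasicekSol θ μ fun s => g s ω) T := by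
  have h1 := hg.measurable_vasicekSol (θ := θ) μ T
  have h2 := hg.measurable_integralPath (θ := θ) μ T
  have h3 := hg.measurable_integralSqPath (θ := θ) μ T
  unfold thetaEst
  fun_prop

theorem measurable_alphaEst (μ : ℝ) (T : ℝ≥0) :
    Measurable fun ω => alphaEst (vasicekSol θ μ fun s => g s ω) T := by
  have h1 := hg.measurable_vasicekSol (θ := θ) μ T
  have h2 := hg.measurable_integralPath (θ := θ) μ T
  have h3 := hg.measurable_integralSqPath (θ := θ) μ T
  unfold alphaEst
  fun_prop

theorem measurable_muEst (μ : ℝ) (T : ℝ≥0) :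
    Measurable fun ω => muEst (vasicekSol θ μ fun s => g s ω) T := by
  have h1 := hg.measurable_vasicekSol (θ := θ) μ T
  have h2 := hg.measurable_integralPath (θ := θ) μ T
  have h3 := hg.measurable_integralSqPath (θ := θ) μ T
  unfold muEst
  fun_prop

theorem measurable_errVec (μ h : ℝ) (T : ℝ≥0) : Measurable fun ω =>
    errVec θ μ h (fun s => g s ω) (vasicekSol θ μ fun s => g s ω) T := by
  have h1 := hg.measurable_vasicekSol (θ := θ) μ T
  have h2 := hg.measurable_integralPath (θ := θ) μ T
  have h3 := hg.measurable_integralSqPath (θ := θ) μ T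
  have h4 := hg.measurable_noise (θ := θ) T
  have h5 := hg.measurable_drift (θ := θ) μ T
  have h6 := hg.measurable_driftLim (θ := θ) μ
  have h7 := hg.measurable T
  unfold errVec energyRem energy scaledDet
  fun_prop

end IsContinuousVersion

end

/-! ### Almost sure behaviour of the driving path -/

section

variable {Ω : Type*} [MeasurableSpace Ω] {P : Measure Ω} [IsProbabilityMeasure P]
  {H K θ : ℝ} {G : ℝ≥0 → Ω → ℝ} {g : ℝ → Ω → ℝ}
  (hH : H ∈ Set.Ioo (0 : ℝ) 1) (hK : K ∈ Set.Ioc (0 : ℝ) 1) (hθ : 0 < θ)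
  (hG : IsBifractionalBrownianMotion H K G P) (hg : IsContinuousVersion G g P)

include hH hK hG hg

/-- Increments are centered Gaussian with variance at most 2|t - s|^{2HK}, so all even moments scale
with Hölder exponent HK in (0, 1). -/
theorem ae_tendsto_version_div_atTop : ∀ᵐ ω ∂P, Tendsto (fun t => g t ω / t) atTop (𝓝 0) := by
  have hh := mul_pos hH.1 hK.1
  refine ae_tendsto_div_atTop_of_moments hh (mul_lt_one_of_mem hH hK) hg.measurable
    hg.continuous ?_ fun m => ?_
  · have h := integral_version_sq hH hK hG hg le_rfl
    have hnn : 0 ≤ᵐ[P] fun ω => g 0 ω ^ 2 := Eventually.of_forall fun ω => sq_nonneg (g 0 ω)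
    rw [Real.zero_rpow (two_mul_mul_pos hH hK).ne', integral_eq_zero_iff_of_nonneg_ae hnn
      (memLp_version hG hg 0).integrable_sq] at h
    filter_upwards [h] with ω hω
    exact pow_eq_zero_iff two_ne_zero |>.1 hω
  · obtain ⟨C, hC, h⟩ := exists_lintegral_pow_le (P := P) m
    refine ⟨C * 2 ^ m, by positivity, fun s t hs ht => ?_⟩
    have hi : InHull G P (fun ω => g t ω - g s ω) :=
      (inHull_version hG hg t).sub (inHull_version hG hg s)
    refine (h _ _ hi.1.aestronglyMeasurable.aemeasurable
      (hi.map_eq_gaussianReal hG.gaussian hG.centered)).trans (ENNReal.ofReal_le_ofReal ?_)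
    rw [Real.coe_toNNReal _ (integral_nonneg fun ω => sq_nonneg _), mul_assoc]
    gcongr
    calc (∫ ω, (g t ω - g s ω) ^ 2 ∂P) ^ m ≤ (2 * |t - s| ^ (2 * H * K)) ^ m := by
          gcongr
          exact integral_increment_sq_le hH hK hG hg hs ht
      _ = 2 ^ m * (|t - s| ^ (H * K)) ^ (2 * m) := by
          rw [mul_pow, pow_mul (|t - s| ^ (H * K)), ← Real.rpow_natCast (|t - s| ^ (H * K)) 2,
            ← Real.rpow_mul (abs_nonneg _)]
          congr 3
          push_cast
          ring

include hθ

/-- A nondegenerate Gaussian law has no atom at -μ. -/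
theorem ae_driftLim_ne_zero (μ : ℝ) : ∀ᵐ ω ∂P, driftLim θ μ (fun s => g s ω) ≠ 0 := by
  have hZ := inHull_zeta hH hK hθ hG hg
  have hmap := hZ.map_eq_gaussianReal hG.gaussian hG.centered
  have hv : (∫ ω, (∫ s, g s ω ∂(expLaw θ)) ^ 2 ∂P).toNNReal ≠ 0 :=
    (Real.toNNReal_pos.2 (integral_zeta_sq_pos hH hK hθ hG hg)).ne'
  have := nullSingletonClass_gaussianReal (μ := 0) hv
  have h0 : P.map (fun ω => ∫ s, g s ω ∂(expLaw θ)) {-μ} = 0 := by rw [hmap]; simp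
  rw [Measure.map_apply_of_aemeasurable hZ.1.aestronglyMeasurable.aemeasurable
    (measurableSet_singleton _)] at h0
  filter_upwards [measure_eq_zero_iff_ae_notMem.1 h0] with ω hω h
  rw [driftLim_eq_add_integral hθ] at h
  exact hω (by simp only [Set.mem_preimage, Set.mem_singleton_iff]; linarith)

end

/-! ### Mutual independence of three variables -/

section

variable {Ω : Type*} [MeasurableSpace Ω] {P : Measure Ω} [IsProbabilityMeasure P]

theorem iIndepFun_fin_three {Z N₁ N₂ : Ω → ℝ} (h : IndepFun (fun ω => (N₁ ω, N₂ ω)) Z P)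
    (hN : IndepFun N₁ N₂ P) : iIndepFun ![Z, N₁, N₂] P := by
  rw [iIndepFun_iff_measure_inter_preimage_eq_mul]
  intro S sets hS
  classical
  -- Indices outside S receive the whole line, so every subfamily is covered by the threefold
  -- product formula.
  set t : Fin 3 → Set ℝ := fun i => if i ∈ S then sets i else Set.univ
  have ht : ∀ i, MeasurableSet (t i) := fun i => by
    by_cases hi : i ∈ S
    · simpa [t, hi] using hS i hi
    · simp [t, hi]
  have e1 : ⋂ i ∈ S, (![Z, N₁, N₂] : Fin 3 → Ω → ℝ) i ⁻¹' sets i =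
      (fun ω => (N₁ ω, N₂ ω)) ⁻¹' (t 1 ×ˢ t 2) ∩ Z ⁻¹' t 0 := by
    ext ω
    simp only [Set.mem_iInter, Set.mem_inter_iff, Set.mem_preimage, Set.mem_prod, t]
    rw [Fin.forall_fin_succ, Fin.forall_fin_two]
    by_cases h0 : (0 : Fin 3) ∈ S <;> by_cases h1 : (1 : Fin 3) ∈ S <;>
      by_cases h2 : (2 : Fin 3) ∈ S <;> simp [h0, h1, h2] <;> tauto
  have e2 : ∏ i ∈ S, P ((![Z, N₁, N₂] : Fin 3 → Ω → ℝ) i ⁻¹' sets i) =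
      ∏ i, P ((![Z, N₁, N₂] : Fin 3 → Ω → ℝ) i ⁻¹' t i) := by
    rw [← Finset.prod_subset (Finset.subset_univ S)]
    · exact Finset.prod_congr rfl fun i hi => by simp [t, hi]
    · intro i _ hi
      simp [t, hi]
  rw [e1, e2, h.measure_inter_preimage_eq_mul _ _ ((ht 1).prod (ht 2)) (ht 0),
    Set.mk_preimage_prod, hN.measure_inter_preimage_eq_mul _ _ (ht 1) (ht 2), Fin.prod_univ_three]
  simp only [Matrix.cons_val_zero, Matrix.cons_val_one, Matrix.cons_val]
  ring

end

end BifractionalVasicek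

namespace BifractionalVasicek

/-! ### Limit theorems for the estimators -/

section

variable {Ω : Type*} [MeasurableSpace Ω] {P : Measure Ω} [IsProbabilityMeasure P]
  {H K θ μ : ℝ} {G X : ℝ≥0 → Ω → ℝ} {g : ℝ → Ω → ℝ}
  (hH : H ∈ Set.Ioo (0 : ℝ) 1) (hK : K ∈ Set.Ioc (0 : ℝ) 1) (hθ : 0 < θ)
  (hG : IsBifractionalBrownianMotion H K G P) (hg : IsContinuousVersion G g P)
  (hX : ∀ᵐ ω ∂P, IsVasicekPath θ μ (fun t => G t ω) (fun t => X t ω))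

omit [IsProbabilityMeasure P] in
include hg hX in
theorem ae_eq_vasicekSol :
    ∀ᵐ ω ∂P, (fun t => X t ω) = vasicekSol θ μ fun s => g s ω := by
  filter_upwards [hX, hg.ae_eq] with ω h1 h2
  exact h1.eq_vasicekSol (hg.continuous ω) h2

include hH hK hθ hG hg

/-- The joint convergence of the weighted noise and the scaled driving path, given the limiting
drift. -/
theorem tendstoInDistribution_noise_version {N₁ N₂ : Ω → ℝ} (hN₁ : HasLaw N₁ (gaussianReal 0 1) P)
    (hN₂ : HasLaw N₂ (gaussianReal 0 1) P) (hN : IndepFun N₁ N₂ P)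
    (hNG : IndepFun (fun ω => (N₁ ω, N₂ ω)) (fun ω t => G t ω) P) :
    TendstoInDistribution (fun (T : ℝ≥0) ω => ((driftLim θ μ fun s => g s ω)⁻¹,
        (noise θ (fun s => g s ω) T, ((T : ℝ) ^ (H * K))⁻¹ * g T ω))) atTop
      (fun ω => ((driftLim θ μ fun s => g s ω)⁻¹, (sigma H K θ * N₂ ω, N₁ ω)))
      (fun _ => P) P := by
  have hcoe : Tendsto (fun T : ℝ≥0 => (T : ℝ)) atTop atTop := NNReal.tendsto_coe_atTop.2 tendsto_id
  have hZ := inHull_zeta hH hK hθ hG hg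
  have hVZ : IndepFun (fun ω => (N₁ ω, N₂ ω)) (fun ω => ∫ s, g s ω ∂(expLaw θ)) P :=
    hZ.indepFun hG.measurable (memLp_marginal hG) hNG
  have hlaw := gaussianReal_const_mul hN₂ (sigma H K θ)
  rw [mul_zero, mul_one] at hlaw
  simp only [driftLim_eq_add_integral hθ]
  refine tendstoInDistribution_of_asymptotically_uncorrelated hG.gaussian hG.centered
    (w := fun z => (μ + z)⁻¹) (Z := fun ω => ∫ s, g s ω ∂(expLaw θ)) (v₂ := 1)
    (v₁ := .mk (sigma H K θ ^ 2) (sq_nonneg _)) (by fun_prop)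
    (fun T => inHull_noise hH hK hθ hG hg T.coe_nonneg)
    (fun T => (inHull_version hG hg T).const_mul _) hZ
    (integral_zeta_sq_pos hH hK hθ hG hg).ne'
    ((tendsto_integral_noise_sq hH hK hθ hG hg).comp hcoe) ?_
    ((tendsto_integral_noise_mul_version hH hK hθ hG hg).comp hcoe)
    ((tendsto_integral_noise_mul_zeta hH hK hθ hG hg).comp hcoe)
    ((tendsto_integral_version_mul_zeta hH hK hθ hG hg).comp hcoe)
    hlaw hN₁ (hN.symm.comp (measurable_const_mul (sigma H K θ)) measurable_id)
    (hVZ.symm.comp measurable_id (φ := id)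
      (ψ := fun x : ℝ × ℝ => (sigma H K θ * x.2, x.1)) (by fun_prop))
  refine tendsto_const_nhds.congr' ?_
  filter_upwards [eventually_gt_atTop 0] with T hT
  have hT' : (0 : ℝ) < T := by simpa using hT
  simp only [mul_pow]
  rw [integral_const_mul, integral_version_sq hH hK hG hg T.coe_nonneg, inv_pow, ← Real.rpow_natCast,
    ← Real.rpow_mul hT'.le]
  have e : H * K * ((2 : ℕ) : ℝ) = 2 * H * K := by push_cast; ring
  rw [e, inv_mul_cancel₀ (by positivity), NNReal.coe_one]

include hX

/-- The joint limit theorem for the estimators of `θ` and `α = θ μ`. -/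
theorem tendstoInDistribution_theta_alpha {N₁ N₂ : Ω → ℝ}
    (hN₁ : HasLaw N₁ (gaussianReal 0 1) P) (hN₂ : HasLaw N₂ (gaussianReal 0 1) P)
    (hN : IndepFun N₁ N₂ P) (hNG : IndepFun (fun ω => (N₁ ω, N₂ ω)) (fun ω t => G t ω) P) :
    TendstoInDistribution (fun (T : ℝ≥0) ω =>
        (Real.exp (θ * T) * (thetaEst (fun t => X t ω) T - θ),
          (T : ℝ) ^ (1 - H * K) * (alphaEst (fun t => X t ω) T - θ * μ))) atTop
      (fun ω => (2 * θ * sigma H K θ * N₂ ω / (μ + zetaInf θ fun t => G t ω), N₁ ω))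
      (fun _ => P) P := by
  have hh := mul_pos hH.1 hK.1
  have hXs := ae_eq_vasicekSol hg hX
  have hgrow := ae_tendsto_version_div_atTop hH hK hG hg
  have hne := ae_driftLim_ne_zero hH hK hθ hG hg μ
  have hUm : ∀ T : ℝ≥0, AEMeasurable (fun ω =>
      (Real.exp (θ * T) * (thetaEst (fun t => X t ω) T - θ),
        (T : ℝ) ^ (1 - H * K) * (alphaEst (fun t => X t ω) T - θ * μ))) P := fun T => by
    have h1 := hg.measurable_thetaEst (θ := θ) μ T
    have h2 := hg.measurable_alphaEst (θ := θ) μ T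
    refine AEMeasurable.congr (f := fun ω =>
      (Real.exp (θ * T) * (thetaEst (vasicekSol θ μ fun s => g s ω) T - θ),
        (T : ℝ) ^ (1 - H * K) * (alphaEst (vasicekSol θ μ fun s => g s ω) T - θ * μ)))
      (by fun_prop) ?_
    filter_upwards [hXs] with ω hω
    rw [hω]
  -- Slutsky: the coefficients `errVec` converge almost surely to (1, 0, 1, 0, 0), which leaves
  -- 2θA_T/(μ + ζ_∞) and T^{-HK}G_T.
  have hslut := (tendstoInDistribution_noise_version (μ := μ) hH hK hθ hG hg hN₁ hN₂ hN
    hNG).continuous_comp_prodMk_of_tendstoInMeasure_const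
    (g := fun x : (ℝ × (ℝ × ℝ)) × (ℝ × ℝ × ℝ × ℝ × ℝ) =>
      (2 * θ * x.1.1 * x.1.2.1 * x.2.1 + x.2.2.1,
        x.1.2.2 * x.2.2.2.1 - x.2.2.2.2.1 * x.1.2.1 + x.2.2.2.2.2))
    (Y := fun T ω => errVec θ μ (H * K) (fun s => g s ω) (vasicekSol θ μ fun s => g s ω) T)
    (c := (1, 0, 1, 0, 0)) (by fun_prop)
    (tendstoInMeasure_of_ae_tendsto
      (fun T => (hg.measurable_errVec μ (H * K) T).aestronglyMeasurable) (by
        filter_upwards [hX, hg.ae_eq, hgrow, hne, hXs] with ω h1 h2 h3 h4 h5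
        rw [← h5]
        exact tendsto_errVec hθ (hg.continuous ω) h2 h1 h3 h4 hh))
    (fun T => (hg.measurable_errVec μ (H * K) T).aemeasurable)
  refine TendstoInDistribution.congr (fun T => EventuallyEq.rfl) ?_
    (tendstoInDistribution_of_tendstoInMeasure_sub _ _ hslut
      (tendstoInMeasure_of_ae_tendsto
        (fun T => ((hUm T).sub (hslut.forall_aemeasurable T)).aestronglyMeasurable) ?_) hUm)
  · filter_upwards [hg.ae_eq] with ω h2
    rw [driftLim_eq_add_integral hθ, zetaInf_eq_integral_expLaw hθ h2]
    simp only [Prod.mk.injEq]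
    constructor <;> ring
  -- The representation holds only beyond a random time, so the two sides are compared through a
  -- difference that is eventually 0 along almost every path.
  · filter_upwards [hX, hg.ae_eq, hgrow, hne, hXs] with ω h1 h2 h3 h4 h5
    refine tendsto_const_nhds.congr' ?_
    filter_upwards [eventually_exp_mul_thetaEst_sub hθ (hg.continuous ω) h2 h1 h3 h4 (H * K),
      eventually_rpow_mul_alphaEst_sub hθ (hg.continuous ω) h2 h1 h3 h4 (H * K)] with T e1 e2
    rw [h5] at e1 e2
    simp only [Pi.sub_apply, h5, e1, e2, sub_self]
    rfl

/-- The joint limit theorem for the estimators of `θ` and `μ`. -/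
theorem tendstoInDistribution_theta_mu {N₁ N₂ : Ω → ℝ}
    (hN₁ : HasLaw N₁ (gaussianReal 0 1) P) (hN₂ : HasLaw N₂ (gaussianReal 0 1) P)
    (hN : IndepFun N₁ N₂ P) (hNG : IndepFun (fun ω => (N₁ ω, N₂ ω)) (fun ω t => G t ω) P) :
    TendstoInDistribution (fun (T : ℝ≥0) ω =>
        (Real.exp (θ * T) * (thetaEst (fun t => X t ω) T - θ),
          (T : ℝ) ^ (1 - H * K) * (muEst (fun t => X t ω) T - μ))) atTop
      (fun ω => (2 * θ * sigma H K θ * N₂ ω / (μ + zetaInf θ fun t => G t ω), 1 / θ * N₁ ω))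
      (fun _ => P) P := by
  have hXs := ae_eq_vasicekSol hg hX
  have hgrow := ae_tendsto_version_div_atTop hH hK hG hg
  have hne := ae_driftLim_ne_zero hH hK hθ hG hg μ
  have hUm : ∀ T : ℝ≥0, AEMeasurable (fun ω =>
      (Real.exp (θ * T) * (thetaEst (fun t => X t ω) T - θ),
        (T : ℝ) ^ (1 - H * K) * (muEst (fun t => X t ω) T - μ))) P := fun T => by
    have h1 := hg.measurable_thetaEst (θ := θ) μ T
    have h2 := hg.measurable_muEst (θ := θ) μ T
    refine AEMeasurable.congr (f := fun ω =>
      (Real.exp (θ * T) * (thetaEst (vasicekSol θ μ fun s => g s ω) T - θ),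
        (T : ℝ) ^ (1 - H * K) * (muEst (vasicekSol θ μ fun s => g s ω) T - μ)))
      (by fun_prop) ?_
    filter_upwards [hXs] with ω hω
    rw [hω]
  have hτm : ∀ T : ℝ≥0, AEMeasurable (fun ω => ((thetaEst (fun t => X t ω) T)⁻¹,
      -(μ * (thetaEst (fun t => X t ω) T)⁻¹ *
        ((T : ℝ) ^ (1 - H * K) * (thetaEst (fun t => X t ω) T - θ))))) P := fun T => by
    have h1 := hg.measurable_thetaEst (θ := θ) μ T
    refine AEMeasurable.congr (f := fun ω =>
      ((thetaEst (vasicekSol θ μ fun s => g s ω) T)⁻¹,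
        -(μ * (thetaEst (vasicekSol θ μ fun s => g s ω) T)⁻¹ * ((T : ℝ) ^ (1 - H * K) *
          (thetaEst (vasicekSol θ μ fun s => g s ω) T - θ))))) (by fun_prop) ?_
    filter_upwards [hXs] with ω hω
    rw [hω]
  -- Slutsky again: the error in α is multiplied by a factor tending to 1/θ, and the contribution of
  -- the error in θ vanishes.
  have hslut := (tendstoInDistribution_theta_alpha hH hK hθ hG hg hX hN₁ hN₂ hN
    hNG).continuous_comp_prodMk_of_tendstoInMeasure_const
    (g := fun x : (ℝ × ℝ) × (ℝ × ℝ) => (x.1.1, x.2.1 * x.1.2 + x.2.2))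
    (c := (θ⁻¹, 0)) (by fun_prop)
    (tendstoInMeasure_of_ae_tendsto (fun T => (hτm T).aestronglyMeasurable) (by
        filter_upwards [hX, hg.ae_eq, hgrow, hne] with ω h1 h2 h3 h4
        have t1 := (tendsto_thetaEst hθ (hg.continuous ω) h2 h1 h3 h4).inv₀ hθ.ne'
        have t2 := tendsto_rpow_mul_thetaEst_sub hθ (hg.continuous ω) h2 h1 h3 h4 (1 - H * K)
        have t3 := ((t1.const_mul μ).mul t2).neg
        rw [mul_zero, neg_zero] at t3
        exact t1.prodMk_nhds t3)) hτm
  refine TendstoInDistribution.congr (fun T => EventuallyEq.rfl) ?_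
    (tendstoInDistribution_of_tendstoInMeasure_sub _ _ hslut
      (tendstoInMeasure_of_ae_tendsto
        (fun T => ((hUm T).sub (hslut.forall_aemeasurable T)).aestronglyMeasurable) ?_) hUm)
  · exact Eventually.of_forall fun ω => by simp
  · filter_upwards [hX, hg.ae_eq, hgrow, hne] with ω h1 h2 h3 h4
    refine tendsto_const_nhds.congr' ?_
    filter_upwards [eventually_rpow_mul_muEst_sub hθ (hg.continuous ω) h2 h1 h3 h4 (1 - H * K)]
      with T e1
    simp only [Pi.sub_apply, e1, sub_self]
    rfl

end

end BifractionalVasicek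

/-! ### The main theorem -/

theorem mainTheorem5 {Ω : Type*} [MeasurableSpace Ω] (P : Measure Ω) [IsProbabilityMeasure P]
    (H K θ μ : ℝ) (hH : H ∈ Set.Ioo (0 : ℝ) 1) (hK : K ∈ Set.Ioc (0 : ℝ) 1) (hθ : 0 < θ)
    (G X : ℝ≥0 → Ω → ℝ)
    (hG : BifractionalVasicek.IsBifractionalBrownianMotion H K G P)
    (hGcont : ∀ᵐ ω ∂P, Continuous fun t => G t ω)
    (hX : ∀ᵐ ω ∂P, BifractionalVasicek.IsVasicekPath θ μ (fun t => G t ω) (fun t => X t ω)) :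
    -- strong consistency
    (∀ᵐ ω ∂P, Tendsto (fun T : ℝ≥0 =>
        (BifractionalVasicek.thetaEst (fun t => X t ω) T,
          BifractionalVasicek.muEst (fun t => X t ω) T)) atTop (𝓝 (θ, μ))) ∧
    (∀ᵐ ω ∂P, Tendsto (fun T : ℝ≥0 =>
        (BifractionalVasicek.thetaEst (fun t => X t ω) T,
          BifractionalVasicek.alphaEst (fun t => X t ω) T)) atTop (𝓝 (θ, θ * μ))) ∧
    -- `σ²` is the limiting variance of `e^{-θT} ∫_0^T e^{θs} dG_s`
    Tendsto (fun T : ℝ≥0 =>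
        ∫ ω, BifractionalVasicek.noiseConvolution θ (fun t => G t ω) T ^ 2 ∂P) atTop
      (𝓝 (BifractionalVasicek.sigma H K θ ^ 2)) ∧
    -- `ζ_∞` is well defined, square integrable and centered Gaussian
    (∀ᵐ ω ∂P, IntegrableOn (fun s : ℝ => Real.exp (-θ * s) * G s.toNNReal ω) (Set.Ioi 0)) ∧
    MemLp (fun ω => BifractionalVasicek.zetaInf θ (fun t => G t ω)) 2 P ∧
    HasLaw (fun ω => BifractionalVasicek.zetaInf θ (fun t => G t ω))
      (gaussianReal 0
        (∫ ω, BifractionalVasicek.zetaInf θ (fun t => G t ω) ^ 2 ∂P).toNNReal) P ∧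
    -- joint limit theorems, for `N₁`, `N₂` standard normal and `N₁`, `N₂`, `G` independent
    ∀ N₁ N₂ : Ω → ℝ, HasLaw N₁ (gaussianReal 0 1) P → HasLaw N₂ (gaussianReal 0 1) P →
      IndepFun N₁ N₂ P → IndepFun (fun ω => (N₁ ω, N₂ ω)) (fun ω t => G t ω) P →
      iIndepFun ![fun ω => BifractionalVasicek.zetaInf θ (fun t => G t ω), N₁, N₂] P ∧
      TendstoInDistribution
        (fun (T : ℝ≥0) ω =>
          (Real.exp (θ * T) * (BifractionalVasicek.thetaEst (fun t => X t ω) T - θ),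
            (T : ℝ) ^ (1 - H * K) * (BifractionalVasicek.muEst (fun t => X t ω) T - μ)))
        atTop
        (fun ω => (2 * θ * BifractionalVasicek.sigma H K θ * N₂ ω /
            (μ + BifractionalVasicek.zetaInf θ (fun t => G t ω)), 1 / θ * N₁ ω))
        (fun _ => P) P ∧
      TendstoInDistribution
        (fun (T : ℝ≥0) ω =>
          (Real.exp (θ * T) * (BifractionalVasicek.thetaEst (fun t => X t ω) T - θ),
            (T : ℝ) ^ (1 - H * K) * (BifractionalVasicek.alphaEst (fun t => X t ω) T - θ * μ)))
        atTop
        (fun ω => (2 * θ * BifractionalVasicek.sigma H K θ * N₂ ω /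
            (μ + BifractionalVasicek.zetaInf θ (fun t => G t ω)), N₁ ω))
        (fun _ => P) P := by
  -- Every assertion depends on the paths only up to a null set, so an everywhere continuous version
  -- may be used.
  obtain ⟨g, hg⟩ := BifractionalVasicek.exists_isContinuousVersion hG.measurable hGcont
  have hgrow := BifractionalVasicek.ae_tendsto_version_div_atTop hH hK hG hg
  have hne := BifractionalVasicek.ae_driftLim_ne_zero hH hK hθ hG hg μ
  have hζae : (fun ω => ∫ s, g s ω ∂(BifractionalVasicek.expLaw θ)) =ᵐ[P]
      fun ω => BifractionalVasicek.zetaInf θ fun t => G t ω := by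
    filter_upwards [hg.ae_eq] with ω h
    exact (BifractionalVasicek.zetaInf_eq_integral_expLaw hθ h).symm
  have hζ := (BifractionalVasicek.inHull_zeta hH hK hθ hG hg).congr hζae
  refine ⟨?_, ?_, ?_, ?_, hζ.1, ⟨hζ.1.aestronglyMeasurable.aemeasurable,
    hζ.map_eq_gaussianReal hG.gaussian hG.centered⟩, fun N₁ N₂ hN₁ hN₂ hN hNG => ⟨?_,
    BifractionalVasicek.tendstoInDistribution_theta_mu hH hK hθ hG hg hX hN₁ hN₂ hN hNG,
    BifractionalVasicek.tendstoInDistribution_theta_alpha hH hK hθ hG hg hX hN₁ hN₂ hN hNG⟩⟩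
  · filter_upwards [hX, hg.ae_eq, hgrow, hne] with ω h1 h2 h3 h4
    exact (BifractionalVasicek.tendsto_thetaEst hθ (hg.continuous ω) h2 h1 h3 h4).prodMk_nhds
      (BifractionalVasicek.tendsto_muEst hθ (hg.continuous ω) h2 h1 h3 h4)
  · filter_upwards [hX, hg.ae_eq, hgrow, hne] with ω h1 h2 h3 h4
    exact (BifractionalVasicek.tendsto_thetaEst hθ (hg.continuous ω) h2 h1 h3 h4).prodMk_nhds
      (BifractionalVasicek.tendsto_alphaEst hθ (hg.continuous ω) h2 h1 h3 h4)
  · refine ((BifractionalVasicek.tendsto_integral_noise_sq hH hK hθ hG hg).comp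
      (NNReal.tendsto_coe_atTop.2 tendsto_id)).congr fun T => integral_congr_ae ?_
    filter_upwards [hg.ae_eq] with ω h
    rw [BifractionalVasicek.noiseConvolution_eq_noise (f := fun s => g s ω) h]
    rfl
  · filter_upwards [hg.ae_eq, hgrow] with ω h h3
    simpa only [h] using BifractionalVasicek.integrableOn_exp_mul hθ (hg.continuous ω) h3
  · exact BifractionalVasicek.iIndepFun_fin_three (hζ.indepFun hG.measurable
      (BifractionalVasicek.memLp_marginal hG) hNG) hN
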